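/- **Setting.** Let $\mathsf{Const}$, $\mathsf{Null}$, $\mathsf{Var}$ be disjoint countably infinite sets of constants, nulls and variables. An instance is a finite set of facts $R(u_1,\dots,u_n)$ with $u_i\in\mathsf{Const}\cup\mathsf{Null}$, and $\mathrm{adom}(J)$ is the set of constants and nulls occurring in $J$. A data exchange setting $\mathcal S=\langle \mathsf S,\mathsf T,\Sigma_{st},\Sigma_t\rangle$ consists of disjoint finite relational schemas $\mathsf S$ (source) and $\mathsf T$ (target), a finite set $\Sigma_{st}$ of TGDs $\varphi(\mathbf x,\mathbf y)\to\exists\mathbf z\,\psi(\mathbf y,\mathbf z)$ with body over $\mathsf S$ and head over $\mathsf T$, and a finite set $\Sigma_t$ of TGDs and EGDs over $\mathsf T$ (dependencies may mention constants but no nulls). For a TGD $\rho$, $\mathsf{fr}(\rho)=\mathbf y$ is the tuple of variables shared by body and head, and $\mathsf{exvar}(\rho)=\mathbf z$. The setting is *weakly acyclic* if the dependency graph of the TGDs in $\Sigma_t$ has no cycle through a special edge; this graph has the positions $R[i]$ as nodes and, for each TGD $\rho$, each $x\in\mathsf{fr}(\rho)$ and each body position $\pi$ of $x$, a normal edge from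 $\pi$ to each head position of $x$ and a special edge from $\pi$ to each head position of each $z\in\mathsf{exvar}(\rho)$. A source instance is an instance over $\mathsf S$ without nulls. **Supported certain answers.** An ex-choice $\gamma$ maps each TGD $\rho$ and each tuple $\mathbf t$ of constants for $\mathsf{fr}(\rho)$ to a choice of one constant for each $z\in\mathsf{exvar}(\rho)$. For a set $\Sigma$ of dependencies, $\Sigma^\gamma$ is obtained by replacing each TGD $\rho$ with all its ground versions $h(\mathrm{body}(\rho))\to h(\mathrm{head}(\rho))$, where $h$ maps the variables of $\rho$ to constants and agrees with $\gamma(\rho,h(\mathbf y))$ on $\mathsf{exvar}(\rho)$. An instance $J$ over $\mathsf T$ is a *supported solution* of $I$ if there is an ex-choice $\gamma$ such that $I\cup J\models\Sigma_{st}^\gamma$ and $J\models\Sigma_t^\gamma$, and no $J'\subsetneq J$ satisfies $I\cup J'\models\Sigma_{st}^\gamma$ and $J'\models\Sigma_t^\gamma$. For a first-order query $Q$ over $\mathsf T$ (with equality and constants, active domain semantics), let $Q(J)$ be the set of tuples over $\mathrm{adom}(J)$ that satisfy $Q$ in $J$. The set of *supported certain answers* $\mathrm{scert}(I,Q,\mathcal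 S)$ is $\bigcap_J Q(J)$ over all supported solutions $J$ of $I$ (all tuples, if there are none). For fixed $\mathcal S$ and $Q$, the problem $\mathrm{SCERT}(\mathcal S,Q)$ has as input a source instance $I$ and a tuple $\mathbf t$ of constants of length $\mathrm{ar}(Q)$, and asks whether $\mathbf t\in\mathrm{scert}(I,Q,\mathcal S)$. **Nondeterministic semi-oblivious chase.** A run on $I$ starts from $J_0=I$ with nothing marked. In step $i$, if $J_i$ satisfies the EGDs of $\Sigma_t$, it picks a TGD $\rho\in\Sigma_{st}\cup\Sigma_t$ and a homomorphism $h$ from $\mathrm{body}(\rho)$ to $J_i$ such that $(\rho,h(\mathsf{fr}(\rho)))$ is not marked, extends $h$ to $h'$ by arbitrary constants for the variables in $\mathsf{exvar}(\rho)$, marks $(\rho,h(\mathsf{fr}(\rho)))$ and sets $J_{i+1}=J_i\cup h'(\mathrm{head}(\rho))$. The run halts successfully if $J_i$ satisfies the EGDs and no such $\rho,h$ exist; its result is then $J_i$ without its facts over $\mathsf S$. **Theorem.** Let $\mathcal S$ be a weakly acyclic data exchange setting. Then: 1. For every first-order query $Q$ over $\mathsf T$, the problem $\mathrm{SCERT}(\mathcal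 S,Q)$ is in $\mathrm{coNP}$ (data complexity). 2. There is a polynomial $p$, depending only on $\mathcal S$, such that for every source instance $I$ every run of the chase on $I$ has at most $p(|I|)$ steps, where $|I|$ is the number of facts of $I$. 3. For every source instance $I$ and every instance $J$, some run of the chase on $I$ halts successfully with result $J$ if and only if $J$ is a supported solution of $I$. -/

import Mathlib

namespace DataExchange

/-! ### Constants, nulls, variables, relations, atoms, instances -/

/-- The countably infinite set of constants: all finite binary strings. -/
abbrev Const : Type := List Bool

/-- The countably infinite set of variables. -/
abbrev Var : Type := ℕ

/-- A relation symbol: a name (a binary string) together with its arity. -/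
structure RelSym where
  name : List Bool
  arity : ℕ
deriving DecidableEq

/-- The elements that occur in instances: constants and labeled nulls. -/
inductive Value where
  | const (c : Const)
  | null (n : ℕ)
deriving DecidableEq

/-- The terms that occur in dependencies and queries: constants and variables (no nulls). -/
inductive Term where
  | const (c : Const)
  | var (v : Var)
deriving DecidableEq

/-- An atom `R(t₁, …, tₙ)` with entries in `τ`. -/
structure Atom (τ : Type) where
  rel : RelSym
  args : Fin rel.arity → τ
deriving DecidableEq

namespace Atom

/-- Apply a function to all entries of an atom. -/
def map {τ τ' : Type} (f : τ → τ') (a : Atom τ) : Atom τ' := ⟨a.rel, fun i => f (a.args i)⟩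

/-- The variables of an atom. -/
def vars (a : Atom Term) : Set Var := {v | ∃ i, a.args i = Term.var v}

end Atom

/-- A fact is an atom without variables. -/
abbrev Fact : Type := Atom Value

/-- An instance is a finite set of facts. -/
abbrev Inst : Type := Finset Fact

/-- A schema is a finite set of relation symbols. -/
abbrev Schema : Type := Finset RelSym

/-- The instance `I` is over the schema `S`. -/
def Inst.Over (I : Inst) (S : Schema) : Prop := ∀ a ∈ I, a.rel ∈ S

/-- The active domain: all constants and nulls occurring in the instance. -/
def Inst.adom (I : Inst) : Set Value := {u | ∃ a ∈ I, ∃ i, a.args i = u}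

/-- A database is an instance without nulls. -/
def Inst.IsDatabase (I : Inst) : Prop := ∀ u ∈ I.adom, ∃ c : Const, u = Value.const c

/-- The value of a term under an assignment of values to variables; constants denote themselves. -/
def Term.eval (ν : Var → Value) : Term → Value
  | Term.const c => Value.const c
  | Term.var v => ν v

/-- The assignment of values induced by an assignment of constants. -/
def constVal (ν : Var → Const) : Var → Value := fun v => Value.const (ν v)

/-- All atoms of `A` become facts of `I` under `ν`: the restriction of `ν` to the variables of `A`
is a homomorphism from `A` to `I`. -/
def HomInto (ν : Var → Value) (A : List (Atom Term)) (I : Inst) : Prop :=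
  ∀ a ∈ A, a.map (Term.eval ν) ∈ I

/-- The variables of a conjunction of atoms. -/
def varsOf (A : List (Atom Term)) : Set Var := {v | ∃ a ∈ A, v ∈ a.vars}

/-! ### Dependencies -/

/-- A tuple-generating dependency `∀ x y, φ(x, y) → ∃ z, ψ(y, z)`, given by the conjunctions
`φ` (body) and `ψ` (head). -/
structure TGD where
  body : List (Atom Term)
  head : List (Atom Term)

namespace TGD

/-- The frontier `y`: the variables shared by body and head. -/
def frontier (ρ : TGD) : Set Var := varsOf ρ.body ∩ varsOf ρ.head

/-- The existential variables `z`: the variables of the head that do not occur in the body. -/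
def exvars (ρ : TGD) : Set Var := varsOf ρ.head \ varsOf ρ.body

/-- `I` satisfies the TGD: every homomorphism from the body extends to one from the head. -/
def Sat (ρ : TGD) (I : Inst) : Prop :=
  ∀ ν : Var → Value, HomInto ν ρ.body I →
    ∃ ν' : Var → Value, (∀ v ∈ varsOf ρ.body, ν' v = ν v) ∧ HomInto ν' ρ.head I

/-- Replace each variable `v` by the constant `ν v`. -/
def groundTerm (ν : Var → Const) : Term → Term
  | Term.const c => Term.const c
  | Term.var v => Term.const (ν v)

/-- The ground version of the TGD via `ν`. -/
def ground (ρ : TGD) (ν : Var → Const) : TGD :=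
  ⟨ρ.body.map (Atom.map (groundTerm ν)), ρ.head.map (Atom.map (groundTerm ν))⟩

end TGD

/-- An equality-generating dependency `∀ x, φ(x) → lhs = rhs`. -/
structure EGD where
  body : List (Atom Term)
  lhs : Var
  rhs : Var
  lhs_mem : lhs ∈ varsOf body
  rhs_mem : rhs ∈ varsOf body

/-- `I` satisfies the EGD. -/
def EGD.Sat (η : EGD) (I : Inst) : Prop :=
  ∀ ν : Var → Value, HomInto ν η.body I → ν η.lhs = ν η.rhs

/-- A dependency is a TGD or an EGD. -/
inductive Dependency where
  | tgd (ρ : TGD)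
  | egd (η : EGD)

/-- `I` satisfies the dependency. -/
def Dependency.Sat : Dependency → Inst → Prop
  | Dependency.tgd ρ, I => ρ.Sat I
  | Dependency.egd η, I => η.Sat I

/-- All atoms of the dependency are over the schema `S`. -/
def Dependency.Over (S : Schema) : Dependency → Prop
  | Dependency.tgd ρ => (∀ a ∈ ρ.body, a.rel ∈ S) ∧ ∀ a ∈ ρ.head, a.rel ∈ S
  | Dependency.egd η => ∀ a ∈ η.body, a.rel ∈ S

/-- `I` satisfies a (possibly infinite) set of dependencies. -/
def SatAll (D : Set Dependency) (I : Inst) : Prop := ∀ d ∈ D, d.Sat I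

/-! ### Data exchange settings -/

/-- A data exchange setting: disjoint source and target schemas, a finite set of source-to-target
TGDs and a finite set of target TGDs and EGDs. -/
structure Setting where
  src : Schema
  trg : Schema
  disjoint : Disjoint src trg
  stDeps : Finset TGD
  tDeps : Finset Dependency
  st_body : ∀ ρ ∈ stDeps, ∀ a ∈ ρ.body, a.rel ∈ src
  st_head : ∀ ρ ∈ stDeps, ∀ a ∈ ρ.head, a.rel ∈ trg
  t_over : ∀ d ∈ tDeps, d.Over trg

namespace Setting

/-- The source-to-target TGDs as a set of dependencies. -/
def stSet (S : Setting) : Set Dependency := {d | ∃ ρ ∈ S.stDeps, d = Dependency.tgd ρ}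

/-- The target dependencies as a set. -/
def tSet (S : Setting) : Set Dependency := {d | d ∈ S.tDeps}

/-- The TGDs among the target dependencies. -/
def tTGDs (S : Setting) : Set TGD := {ρ | Dependency.tgd ρ ∈ S.tDeps}

/-- All TGDs of the setting. -/
def allTGDs (S : Setting) : Set TGD := {ρ | ρ ∈ S.stDeps ∨ ρ ∈ S.tTGDs}

/-- A source instance is a database over the source schema. -/
def IsSource (S : Setting) (I : Inst) : Prop := I.Over S.src ∧ I.IsDatabase

/-- A target instance is an instance (possibly with nulls) over the target schema. -/
def IsTarget (S : Setting) (J : Inst) : Prop := J.Over S.trg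

end Setting

/-! ### Weak acyclicity -/

/-- A position `R[i]`. -/
abbrev Position : Type := (R : RelSym) × Fin R.arity

/-- The variable `v` occurs in the atoms `A` at position `π`. -/
def OccursAt (v : Var) (A : List (Atom Term)) (π : Position) : Prop :=
  ∃ a ∈ A, ∃ i, π = ⟨a.rel, i⟩ ∧ a.args i = Term.var v

/-- Normal edges of the dependency graph. -/
def NormalEdge (D : Set TGD) (π π' : Position) : Prop :=
  ∃ ρ ∈ D, ∃ x ∈ ρ.frontier, OccursAt x ρ.body π ∧ OccursAt x ρ.head π'

/-- Special edges of the dependency graph. -/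
def SpecialEdge (D : Set TGD) (π π' : Position) : Prop :=
  ∃ ρ ∈ D, ∃ x ∈ ρ.frontier, OccursAt x ρ.body π ∧ ∃ z ∈ ρ.exvars, OccursAt z ρ.head π'

/-- No cycle of the dependency graph contains a special edge: there is no special edge `(π, π')`
such that `π` is reachable from `π'`. -/
def WeaklyAcyclic (D : Set TGD) : Prop :=
  ¬ ∃ π π', SpecialEdge D π π' ∧
    Relation.ReflTransGen (fun π₁ π₂ => NormalEdge D π₁ π₂ ∨ SpecialEdge D π₁ π₂) π' π

/-- A setting is weakly acyclic if its set of target TGDs is. -/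
def Setting.IsWeaklyAcyclic (S : Setting) : Prop := WeaklyAcyclic S.tTGDs

/-! ### Supported solutions -/

/-- An ex-choice assigns, to each TGD and each tuple of constants for its frontier, a constant for
each existential variable of the TGD. -/
abbrev ExChoice : Type := (ρ : TGD) → (ρ.frontier → Const) → (ρ.exvars → Const)

/-- The ground version of `ρ` via `ν` is coherent with the ex-choice `γ`. -/
def Coherent (γ : ExChoice) (ρ : TGD) (ν : Var → Const) : Prop :=
  ∀ z : ρ.exvars, ν z = γ ρ (fun y => ν y) z

/-- The set obtained from `D` by replacing each TGD with all its ground versions that are coherent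
with `γ`; EGDs are kept. -/
def applyChoice (D : Set Dependency) (γ : ExChoice) : Set Dependency :=
  {d | (∃ η : EGD, Dependency.egd η ∈ D ∧ d = Dependency.egd η) ∨
    ∃ ρ : TGD, Dependency.tgd ρ ∈ D ∧ ∃ ν : Var → Const,
      Coherent γ ρ ν ∧ d = Dependency.tgd (ρ.ground ν)}

/-- `I ∪ J` satisfies the source-to-target TGDs and `J` satisfies the target dependencies, where
all TGDs are replaced with their ground versions coherent with `γ`. -/
def SatChoice (S : Setting) (γ : ExChoice) (I J : Inst) : Prop :=
  SatAll (applyChoice S.stSet γ) (I ∪ J) ∧ SatAll (applyChoice S.tSet γ) J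

/-- `J` is a supported solution of the source instance `I` with respect to `S`. -/
def SupportedSolution (S : Setting) (I J : Inst) : Prop :=
  S.IsTarget J ∧ ∃ γ : ExChoice, SatChoice S γ I J ∧
    ¬ ∃ J' : Inst, S.IsTarget J' ∧ J' ⊂ J ∧ SatChoice S γ I J'

/-! ### First-order queries -/

/-- First-order formulas with equality and constants; `∨`, `→`, `∀` are the usual abbreviations. -/
inductive Formula where
  | atom (a : Atom Term)
  | eq (s t : Term)
  | neg (φ : Formula)
  | and (φ ψ : Formula)
  | ex (v : Var) (φ : Formula)

namespace Formula

/-- The free variables of a formula. -/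
def freeVars : Formula → Set Var
  | atom a => a.vars
  | eq s t => {v | s = Term.var v ∨ t = Term.var v}
  | neg φ => φ.freeVars
  | and φ ψ => φ.freeVars ∪ ψ.freeVars
  | ex v φ => φ.freeVars \ {v}

/-- All atoms of the formula are over the schema `S`. -/
def Over (S : Schema) : Formula → Prop
  | atom a => a.rel ∈ S
  | eq _ _ => True
  | neg φ => φ.Over S
  | and φ ψ => φ.Over S ∧ ψ.Over S
  | ex _ φ => φ.Over S

/-- Satisfaction in `I` under active domain semantics. -/
def Holds (I : Inst) : Formula → (Var → Value) → Prop
  | atom a, ν => a.map (Term.eval ν) ∈ I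
  | eq s t, ν => s.eval ν = t.eval ν
  | neg φ, ν => ¬ φ.Holds I ν
  | and φ ψ, ν => φ.Holds I ν ∧ ψ.Holds I ν
  | ex v φ, ν => ∃ u ∈ I.adom, φ.Holds I (Function.update ν v u)

end Formula

/-- A query `Q(x)`: a formula with a tuple `x` of distinct variables that includes all its free
variables. -/
structure Query where
  arity : ℕ
  vars : Fin arity → Var
  vars_injective : Function.Injective vars
  formula : Formula
  free_subset : formula.freeVars ⊆ Set.range vars

/-- The output of the query on `I`: the tuples over the active domain that satisfy the formula. -/
def Query.output (Q : Query) (I : Inst) : Set (Fin Q.arity → Value) :=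
  {t | (∀ i, t i ∈ I.adom) ∧
    ∃ ν : Var → Value, (∀ i, ν (Q.vars i) = t i) ∧ Q.formula.Holds I ν}

/-- The supported certain answers (all tuples, if there is no supported solution). -/
def supportedCertain (S : Setting) (I : Inst) (Q : Query) : Set (Fin Q.arity → Value) :=
  ⋂ J ∈ {J : Inst | SupportedSolution S I J}, Q.output J

/-! ### The nondeterministic semi-oblivious chase -/

/-- A state of the chase: the current instance, and the set of pairs of a TGD and a frontier tuple
for which values of the existential variables have already been chosen. -/
structure ChaseState where
  inst : Inst
  chosen : Set ((ρ : TGD) × (ρ.frontier → Const))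

/-- The instance satisfies the EGDs of the setting. -/
def SatEGDs (S : Setting) (J : Inst) : Prop :=
  ∀ η : EGD, Dependency.egd η ∈ S.tDeps → η.Sat J

/-- `ν` maps the body of the TGD `ρ` of `S` into the current instance, and nothing has been chosen
yet for `ρ` and the frontier tuple given by `ν`. -/
def Trigger (S : Setting) (s : ChaseState) (ρ : TGD) (ν : Var → Const) : Prop :=
  ρ ∈ S.allTGDs ∧ HomInto (constVal ν) ρ.body s.inst ∧
    (⟨ρ, fun y => ν y⟩ : (ρ : TGD) × (ρ.frontier → Const)) ∉ s.chosen

/-- One chase step: the EGDs hold; guess a TGD, a homomorphism from its body and constants for its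
existential variables (all this is given by `ρ` and `ν`), and add the head. -/
def ChaseStep (S : Setting) (s s' : ChaseState) : Prop :=
  SatEGDs S s.inst ∧ ∃ (ρ : TGD) (ν : Var → Const), Trigger S s ρ ν ∧
    s'.inst = s.inst ∪ (ρ.head.map (Atom.map (Term.eval (constVal ν)))).toFinset ∧
    s'.chosen = insert ⟨ρ, fun y => ν y⟩ s.chosen

/-- The runs of the chase on `I`: `ChaseRun S I n s` means that some run of `n` steps leads from
`I` to the state `s`. -/
inductive ChaseRun (S : Setting) (I : Inst) : ℕ → ChaseState → Prop where
  | start : ChaseRun S I 0 ⟨I, ∅⟩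
  | step {n : ℕ} {s s' : ChaseState} (h : ChaseRun S I n s) (hs : ChaseStep S s s') :
      ChaseRun S I (n + 1) s'

/-- Some run of the chase on `I` halts successfully (the EGDs hold and no trigger is left) with the
result `J` (the final instance without the facts over the source schema). -/
def ChaseProduces (S : Setting) (I J : Inst) : Prop :=
  ∃ (n : ℕ) (s : ChaseState), ChaseRun S I n s ∧ SatEGDs S s.inst ∧
    (¬ ∃ (ρ : TGD) (ν : Var → Const), Trigger S s ρ ν) ∧
    J = s.inst.filter (fun a => a.rel ∉ S.src)

/-! ### The decision problem as a language -/

/-- The input alphabet. -/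
inductive Sym where
  | bit (b : Bool)
  | comma
  | semicolon
  | bar
deriving DecidableEq, Fintype

/-- The tuple `(c₁, …, cₙ)` is written as `,c₁,…,cₙ`. -/
def encodeTuple {n : ℕ} (t : Fin n → Const) : List Sym :=
  (List.ofFn t).flatMap (fun c => Sym.comma :: c.map Sym.bit)

/-- The fact `R(c₁, …, cₙ)` is written as `R,c₁,…,cₙ;`. -/
def encodeFact (a : Atom Const) : List Sym :=
  a.rel.name.map Sym.bit ++ encodeTuple a.args ++ [Sym.semicolon]

/-- A list of facts and a tuple of constants, separated by a bar. -/
def encodeInput {n : ℕ} (l : List (Atom Const)) (t : Fin n → Const) : List Sym :=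
  l.flatMap encodeFact ++ Sym.bar :: encodeTuple t

/-- The instance formed by a list of facts without nulls. -/
def instOfList (l : List (Atom Const)) : Inst := (l.map (Atom.map Value.const)).toFinset

/-- The string `w` encodes the instance `I` and the tuple `t`: it lists the facts of `I` (in any
order) and then `t`. -/
def Encodes {n : ℕ} (w : List Sym) (I : Inst) (t : Fin n → Const) : Prop :=
  ∃ l : List (Atom Const), instOfList l = I ∧ w = encodeInput l t

/-- The decision problem, for a fixed setting and query: given a source instance and a tuple of
constants, is the tuple a supported certain answer? -/
def scertLanguage (S : Setting) (Q : Query) : Set (List Sym) :=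
  {w | ∃ (I : Inst) (t : Fin Q.arity → Const), S.IsSource I ∧ Encodes w I t ∧
    (fun i => Value.const (t i)) ∈ supportedCertain S I Q}

/-! ### Complexity classes -/

/-- An input over the alphabet `Γ` followed by a certificate over the alphabet `Δ`. -/
def encodePair {Γ Δ : Type} (x : List Γ × List Δ) : List (Γ ⊕ Δ) :=
  x.1.map Sum.inl ++ x.2.map Sum.inr

/-- The class NP: membership is witnessed by certificates of polynomial length, over some finite
alphabet, that a Turing machine verifies in polynomial time. -/
def InNP {Γ : Type} (L : Set (List Γ)) : Prop :=
  ∃ (Δ : Type) (_ : Fintype Δ) (V : List Γ × List Δ → Bool) (p : Polynomial ℕ),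
    Nonempty (Turing.TM2ComputableInPolyTime encodePair Computability.encodeBool V) ∧
    ∀ x : List Γ, x ∈ L ↔ ∃ w : List Δ, w.length ≤ p.eval x.length ∧ V (x, w) = true

/-- The class coNP: the languages whose complement is in NP. -/
def InCoNP {Γ : Type} (L : Set (List Γ)) : Prop := InNP Lᶜ

end DataExchange

/-! Chase and supported solutions. A run marks each pair of a TGD and a frontier tuple at most once,
so its guesses form a partial function that extends to an ex-choice γ. A halted run leaves no
trigger, hence its result satisfies the ground dependencies of γ. Each added fact is forced in every
instance that satisfies them, by induction along the run, and this is minimality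
(`supportedSolution_of_steps`). Conversely, given a supported solution J with ex-choice γ, let the
chase guess as γ prescribes. All added facts stay inside J. A longest run of this kind has no
trigger left, so its result satisfies the ground dependencies and equals J by minimality
(`SupportedSolution.exists_derivation`). EGDs pass to subinstances, so it suffices that they hold at
the end.

Length of runs. The rank of a position counts the sources of special edges on paths to it. It does
not decrease along edges, and weak acyclicity makes it increase strictly along special edges
(`rank_lt`). Hence a constant at a position of rank r appears after at most r + 1 rounds of
generation (`Derivation.mem_generated`). Each round enlarges the set of constants polynomially, the
number of rounds depends only on the setting, and a step of a run is determined by its TGD and its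
frontier tuple. This bounds the number of steps (`Derivation.length_le`).

Membership in coNP. That a tuple is not an answer is certified by the list of steps of a halting run
whose result rejects the tuple. The guessed constants may be arbitrarily long strings, but a
permutation of the constants that fixes those of the input, the dependencies and the query preserves
supported solutions (`SupportedSolution.ren`), and it can be chosen to make the remaining constants
short (`exists_perm_length_le`). Together with the bound on the steps this yields certificates of
polynomial length.

The verifier has to be a Turing machine. It is obtained from a first-order logic of words whose
quantifiers range over the splittings of a given word (`Form`). For a fixed formula, each quantifier
has only linearly many choices, so nested loops over finitely many stacks evaluate it in polynomial
time (`Form.run_prog`), and such stack programs compile to machines (`Cmd.computableInPolyTime`). It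
remains to express in this logic that a word is a valid input and that another one is a certificate
for it (`Def.isInput`, `Def.certificate`), and to show that certificates are correct
(`Setting.Certificate.exists_supportedSolution`, `Setting.exists_certificate`). -/

open Function

set_option linter.unusedSectionVars false

namespace DataExchange

/-! ### Structured programs over stacks -/

/-- Structured programs that operate on stacks over the alphabet `A`, indexed by `K`, with a
register of type `σ`. -/
inductive Cmd (K A σ : Type) : Type where
  | load (f : σ → σ)
  | push (k : K) (f : σ → A)
  | pop (k : K) (f : σ → Option A → σ)
  | seq (p q : Cmd K A σ)
  | ite (c : σ → Bool) (p q : Cmd K A σ)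
  | loop (c : σ → Bool) (p : Cmd K A σ)

namespace Cmd

variable {K A σ : Type}

/-- `Exec c v S t v' S'`: from the register `v` and the stacks `S`, the program `c` terminates
after `t` steps with the register `v'` and the stacks `S'`. -/
inductive Exec [DecidableEq K] :
    Cmd K A σ → σ → (K → List A) → ℕ → σ → (K → List A) → Prop
  | load (f : σ → σ) (v S) : Exec (.load f) v S 1 (f v) S
  | push (k f v S) : Exec (.push k f) v S 1 v (update S k (f v :: S k))
  | pop (k f v S) : Exec (.pop k f) v S 1 (f v (S k).head?) (update S k (S k).tail)
  | seq {p q v S t v' S' t' v'' S''} (h : Exec p v S t v' S') (h' : Exec q v' S' t' v'' S'') :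
      Exec (.seq p q) v S (t + t') v'' S''
  | ite_true {c p q v S t v' S'} (hc : c v = true) (h : Exec p v S t v' S') :
      Exec (.ite c p q) v S (1 + t) v' S'
  | ite_false {c p q v S t v' S'} (hc : c v = false) (h : Exec q v S t v' S') :
      Exec (.ite c p q) v S (1 + t) v' S'
  | loop_false {c p v S} (hc : c v = false) : Exec (.loop c p) v S 1 v S
  | loop_true {c p v S t v' S' t' v'' S''} (hc : c v = true) (h : Exec p v S t v' S')
      (h' : Exec (.loop c p) v' S' t' v'' S'') : Exec (.loop c p) v S (1 + t + t') v'' S''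

/-! ### Compilation to stack machines -/

/-- The control labels of a program. -/
@[reducible] def Lab : Cmd K A σ → Type
  | load _ => Unit
  | push _ _ => Unit
  | pop _ _ => Unit
  | seq p q => p.Lab ⊕ q.Lab
  | ite _ p q => Option (p.Lab ⊕ q.Lab)
  | loop _ p => Option p.Lab

/-- The label at which the execution of a program starts. -/
def entry : (c : Cmd K A σ) → c.Lab
  | load _ => ()
  | push _ _ => ()
  | pop _ _ => ()
  | seq p _ => Sum.inl p.entry
  | ite _ _ _ => none
  | loop _ _ => none

theorem finite_lab : (c : Cmd K A σ) → Finite c.Lab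
  | load _ => inferInstanceAs (Finite Unit)
  | push _ _ => inferInstanceAs (Finite Unit)
  | pop _ _ => inferInstanceAs (Finite Unit)
  | seq p q =>
    have := finite_lab p
    have := finite_lab q
    inferInstanceAs (Finite (p.Lab ⊕ q.Lab))
  | ite _ p q =>
    have := finite_lab p
    have := finite_lab q
    inferInstanceAs (Finite (Option (p.Lab ⊕ q.Lab)))
  | loop _ p =>
    have := finite_lab p
    inferInstanceAs (Finite (Option p.Lab))

/-- The alphabets of the stacks of the compiled machine: an output stack over `Bool` is added. -/
@[reducible] def Alph (K A : Type) : Option K → Type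
  | none => Bool
  | some _ => A

/-- The stacks of the compiled machine. -/
def liftStk (S : K → List A) : (k : Option K) → List (Alph K A k)
  | none => []
  | some k => S k

theorem update_liftStk [DecidableEq K] (S : K → List A) (k : K) (l : List A) :
    update (liftStk S) (some k) l = liftStk (update S k l) := by
  funext k'
  cases k' with
  | none => rfl
  | some k' =>
    by_cases h : k' = k
    · subst h
      simp [liftStk]
    · rw [update_of_ne (by simpa using h)]
      simp [liftStk, h]

/-- The statement at each label, with `e` embedding the labels and `ex` the exit label. -/
def code {Λ : Type} :
    (c : Cmd K A σ) → (c.Lab → Λ) → Λ → c.Lab → Turing.TM2.Stmt (Alph K A) Λ σ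
  | load f, _, ex, _ => .load f (.goto fun _ => ex)
  | push k f, _, ex, _ => .push (some k) f (.goto fun _ => ex)
  | pop k f, _, ex, _ => .pop (some k) f (.goto fun _ => ex)
  | seq p q, e, _, Sum.inl l => code p (e ∘ Sum.inl) (e (Sum.inr q.entry)) l
  | seq _ q, e, ex, Sum.inr l => code q (e ∘ Sum.inr) ex l
  | ite c p q, e, _, none =>
    .branch c (.goto fun _ => e (some (Sum.inl p.entry))) (.goto fun _ => e (some (Sum.inr q.entry)))
  | ite _ p _, e, ex, some (Sum.inl l) => code p (e ∘ some ∘ Sum.inl) ex l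
  | ite _ _ q, e, ex, some (Sum.inr l) => code q (e ∘ some ∘ Sum.inr) ex l
  | loop c p, e, ex, none => .branch c (.goto fun _ => e (some p.entry)) (.goto fun _ => ex)
  | loop _ p, e, _, some l => code p (e ∘ some) (e none) l

variable [DecidableEq K]

/-- The machine `M` gets from the configuration `a` to the configuration `b` in `t` steps. -/
def StepsTo {Λ : Type} (M : Λ → Turing.TM2.Stmt (Alph K A) Λ σ) (t : ℕ)
    (a b : Turing.TM2.Cfg (Alph K A) Λ σ) : Prop :=
  (flip bind (Turing.TM2.step M))^[t] (some a) = some b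

theorem StepsTo.trans {Λ : Type} {M : Λ → Turing.TM2.Stmt (Alph K A) Λ σ} {t t' : ℕ}
    {a b c : Turing.TM2.Cfg (Alph K A) Λ σ} (h : StepsTo M t a b) (h' : StepsTo M t' b c) :
    StepsTo M (t + t') a c := by
  unfold StepsTo at *
  rw [add_comm, iterate_add_apply, h, h']

theorem StepsTo.single {Λ : Type} {M : Λ → Turing.TM2.Stmt (Alph K A) Λ σ} (l : Λ) (v : σ)
    (S : ∀ k, List (Alph K A k)) : StepsTo M 1 ⟨some l, v, S⟩ (Turing.TM2.stepAux (M l) v S) := by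
  simp [StepsTo, flip]

/-- Each program step costs exactly one machine step, so the time is preserved without overhead. The
embedding of the labels and the exit label are universally quantified because both change when a
subprogram is entered. -/
theorem Exec.stepsTo {c : Cmd K A σ} {v : σ} {S : K → List A} {t : ℕ} {v' : σ} {S' : K → List A}
    (h : Exec c v S t v' S') {Λ : Type} (M : Λ → Turing.TM2.Stmt (Alph K A) Λ σ) :
    ∀ (e : c.Lab → Λ) (ex : Λ), (∀ l, M (e l) = code c e ex l) →
      StepsTo M t ⟨some (e c.entry), v, liftStk S⟩ ⟨some ex, v', liftStk S'⟩ := by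
  induction h with
  | load f v S =>
    intro e ex hM
    have := StepsTo.single (M := M) (e (entry (.load f))) v (liftStk S)
    rw [hM] at this
    simpa [code] using this
  | push k f v S =>
    intro e ex hM
    have := StepsTo.single (M := M) (e (entry (.push k f))) v (liftStk S)
    rw [hM] at this
    simp only [code, Turing.TM2.stepAux] at this
    rwa [← update_liftStk]
  | pop k f v S =>
    intro e ex hM
    have := StepsTo.single (M := M) (e (entry (.pop k f))) v (liftStk S)
    rw [hM] at this
    simp only [code, Turing.TM2.stepAux] at this
    rwa [← update_liftStk]
  | @seq p q v S t v' S' t' v'' S'' h h' ih ih' =>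
    intro e ex hM
    exact (ih (e ∘ Sum.inl) _ fun l => hM (Sum.inl l)).trans
      (ih' (e ∘ Sum.inr) _ fun l => hM (Sum.inr l))
  | @ite_true c p q v S t v' S' hc h ih =>
    intro e ex hM
    refine StepsTo.trans (b := ⟨some (e (some (Sum.inl p.entry))), v, liftStk S⟩) ?_
      (ih (e ∘ some ∘ Sum.inl) _ fun l => hM (some (Sum.inl l)))
    have := StepsTo.single (M := M) (e none) v (liftStk S)
    rw [hM none] at this
    simpa [code, hc, entry] using this
  | @ite_false c p q v S t v' S' hc h ih =>
    intro e ex hM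
    refine StepsTo.trans (b := ⟨some (e (some (Sum.inr q.entry))), v, liftStk S⟩) ?_
      (ih (e ∘ some ∘ Sum.inr) _ fun l => hM (some (Sum.inr l)))
    have := StepsTo.single (M := M) (e none) v (liftStk S)
    rw [hM none] at this
    simpa [code, hc, entry] using this
  | @loop_false c p v S hc =>
    intro e ex hM
    have := StepsTo.single (M := M) (e none) v (liftStk S)
    rw [hM none] at this
    simpa [code, hc, entry] using this
  | @loop_true c p v S t v' S' t' v'' S'' hc h h' ih ih' =>
    intro e ex hM
    refine StepsTo.trans (b := ⟨some (e none), v', liftStk S'⟩) ?_ (ih' e ex hM)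
    refine StepsTo.trans (b := ⟨some (e (some p.entry)), v, liftStk S⟩) ?_
      (ih (e ∘ some) _ fun l => hM (some l))
    have := StepsTo.single (M := M) (e none) v (liftStk S)
    rw [hM none] at this
    simpa [code, hc, entry] using this

/-- A function computed by a program in polynomial time is computed by a stack machine in
polynomial time. The input is on the stack `k₀`, and the output is read off the final register. -/
theorem computableInPolyTime [Finite K] [Finite A] [Finite σ] {α : Type} (ea : α → List A)
    (V : α → Bool) (c : Cmd K A σ) (k₀ : K) (init : σ) (out : σ → Bool) (p : Polynomial ℕ)
    (h : ∀ x, ∃ t v', t ≤ p.eval (ea x).length ∧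
      Exec c init (update (fun _ => []) k₀ (ea x)) t v' (fun _ => []) ∧ out v' = V x) :
    Nonempty (Turing.TM2ComputableInPolyTime ea Computability.encodeBool V) := by
  classical
  have := finite_lab c
  have := Fintype.ofFinite K
  have := Fintype.ofFinite A
  have := Fintype.ofFinite σ
  have := Fintype.ofFinite c.Lab
  -- The extra label `none` is the exit of the program: it writes the answer to the output stack and
  -- resets the register, as a halting configuration requires the initial register and empty stacks
  -- apart from the output.
  let M : Option c.Lab → Turing.TM2.Stmt (Alph K A) (Option c.Lab) σ := fun l =>
    match l with
    | none => .push none out (.load (fun _ => init) .halt)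
    | some l => code c some none l
  let tm : Turing.FinTM2 :=
    { K := Option K
      k₀ := some k₀
      k₁ := none
      Γ := Alph K A
      Λ := Option c.Lab
      main := some c.entry
      σ := σ
      initialState := init
      Γk₀Fin := inferInstanceAs (Fintype A)
      m := M }
  refine ⟨{ tm := tm, inputAlphabet := Equiv.refl A, outputAlphabet := Equiv.refl Bool,
            time := p + 1, outputsFun := fun x => ?_ }⟩
  choose t v' ht hex hout using h
  refine { steps := t x + 1, evals_in_steps := ?_, steps_le_m := by simp [ht x] }
  have h1 := (hex x).stepsTo M some none (fun l => rfl)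
  have h2 := StepsTo.single (M := M) none (v' x) (liftStk fun _ => [])
  have h3 := h1.trans h2
  have e1 : Turing.initList tm (List.map (Equiv.refl A).invFun (ea x)) =
      ⟨some (some c.entry), init, liftStk (update (fun _ => []) k₀ (ea x))⟩ := by
    unfold Turing.initList
    congr 1
    funext k
    cases k with
    | none => rfl
    | some k =>
      by_cases hk : k = k₀
      · subst hk
        simp only [tm, liftStk, update_self]
        simp
      · simp [tm, liftStk, hk]
  have e2 : Turing.haltList tm (List.map (Equiv.refl Bool).invFun
      (Computability.encodeBool (V x))) = Turing.TM2.stepAux (M none) (v' x) (liftStk fun _ => []) := by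
    unfold Turing.haltList
    simp only [M, Turing.TM2.stepAux, hout]
    congr 1
    funext k
    cases k with
    | none =>
      simp [tm, liftStk, Computability.encodeBool]
    | some k => simp [tm, liftStk]
  rw [e1]
  simp only [Option.map_some]
  rw [e2]
  exact h3

end Cmd
-- Executions with upper bounds on the running time
namespace Cmd

variable {K A : Type} [DecidableEq K]

/-- The program `c` runs within time `T`. -/
def Run {σ : Type} (c : Cmd K A σ) (v : σ) (S : K → List A) (T : ℕ) (v' : σ) (S' : K → List A) :
    Prop :=
  ∃ t ≤ T, Exec c v S t v' S'

section Run

variable {σ : Type} {c p q : Cmd K A σ} {v v' v'' : σ} {S S' S'' : K → List A} {T T' : ℕ}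

theorem Run.mono (h : Run c v S T v' S') (hT : T ≤ T') : Run c v S T' v' S' :=
  let ⟨t, ht, h⟩ := h
  ⟨t, ht.trans hT, h⟩

theorem Run.seq (h : Run p v S T v' S') (h' : Run q v' S' T' v'' S'') :
    Run (.seq p q) v S (T + T') v'' S'' :=
  let ⟨t, ht, h⟩ := h
  let ⟨t', ht', h'⟩ := h'
  ⟨t + t', by omega, .seq h h'⟩

theorem Run.load (f : σ → σ) : Run (.load f) v S 1 (f v) S := ⟨1, le_rfl, .load ..⟩

theorem Run.push (k : K) (f : σ → A) : Run (.push k f) v S 1 v (update S k (f v :: S k)) :=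
  ⟨1, le_rfl, .push ..⟩

theorem Run.pop (k : K) (f : σ → Option A → σ) :
    Run (.pop k f) v S 1 (f v (S k).head?) (update S k (S k).tail) :=
  ⟨1, le_rfl, .pop ..⟩

theorem Run.ite_true {c : σ → Bool} (hc : c v = true) (h : Run p v S T v' S') :
    Run (.ite c p q) v S (1 + T) v' S' :=
  let ⟨t, ht, h⟩ := h
  ⟨1 + t, by omega, .ite_true hc h⟩

theorem Run.ite_false {c : σ → Bool} (hc : c v = false) (h : Run q v S T v' S') :
    Run (.ite c p q) v S (1 + T) v' S' :=
  let ⟨t, ht, h⟩ := h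
  ⟨1 + t, by omega, .ite_false hc h⟩

theorem Run.loop_false {c : σ → Bool} (hc : c v = false) : Run (.loop c p) v S 1 v S :=
  ⟨1, le_rfl, .loop_false hc⟩

theorem Run.loop_true {c : σ → Bool} (hc : c v = true) (h : Run p v S T v' S')
    (h' : Run (.loop c p) v' S' T' v'' S'') : Run (.loop c p) v S (1 + T + T') v'' S'' :=
  let ⟨t, ht, h⟩ := h
  let ⟨t', ht', h'⟩ := h'
  ⟨1 + t + t', by omega, .loop_true hc h h'⟩

end Run

/-! ### Basic programs -/

/-- Registers: a flag and two cells for letters. -/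
abbrev Reg (A : Type) : Type := Bool × Option A × Option A

/-- Pop a letter into the first cell. -/
def popFst (a : K) : Cmd K A (Reg A) := .pop a fun v o => (v.1, o, v.2.2)

/-- Pop a letter into the second cell. -/
def popSnd (a : K) : Cmd K A (Reg A) := .pop a fun v o => (v.1, v.2.1, o)

/-- The first cell is occupied. -/
def fstSome (v : Reg A) : Bool := v.2.1.isSome

/-- Pop all letters of a stack, executing `p` for each of them. -/
def forEach (a : K) (p : Cmd K A (Reg A)) : Cmd K A (Reg A) :=
  .seq (popFst a) (.loop fstSome (.seq p (popFst a)))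

/-- The body `p` must preserve the register, neither read nor write the stack `a`, and act on the
others by `g`. The cost per letter is `T` plus one test and one pop; a first pop precedes the loop
and a last test ends it. -/
theorem run_forEach (a : K) (p : Cmd K A (Reg A)) (T : ℕ)
    (g : A → (K → List A) → (K → List A))
    (hp : ∀ x f r S, Run p (f, some x, r) S T (f, some x, r) (g x S))
    (hg : ∀ x S, g x S a = S a) (hg' : ∀ x S l, g x (update S a l) = update (g x S) a l)
    (v : Reg A) (S : K → List A) :
    Run (forEach a p) v S ((T + 2) * (S a).length + 2) (v.1, none, v.2.2)
      ((S a).foldl (fun S x => g x S) (update S a [])) := by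
  -- At the loop test, `o` is the letter already popped and `l` the rest of the stack; an empty cell
  -- means that the pop failed, which is possible only if nothing is left.
  have main : ∀ (l : List A) (o : Option A) (f : Bool) (r : Option A) (S : K → List A), S a = l →
      (o = none → l = []) →
      Run (.loop fstSome (.seq p (popFst a))) (f, o, r) S
        ((T + 2) * (o.toList ++ l).length + 1)
        (f, none, r) ((o.toList ++ l).foldl (fun S x => g x S) (update S a [])) := by
    intro l
    induction l with
    | nil =>
      rintro (_ | x) f r S hS ho
      · have h : Run (.loop fstSome (.seq p (popFst a))) (f, none, r) S 1 (f, none, r) S :=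
          Run.loop_false rfl
        have e : update S a [] = S := by rw [← hS, update_eq_self]
        simpa [e] using h
      · have h1 := (hp x f r S).seq (Run.pop a fun v o => (v.1, o, v.2.2))
        rw [hg, hS] at h1
        have h := Run.loop_true (c := fstSome) rfl h1 (Run.loop_false rfl)
        have h' := h.mono (T' := (T + 2) * ((some x).toList ++ []).length + 1) (by simp; omega)
        simpa [hg', popFst] using h'
    | cons y l ih =>
      rintro (_ | x) f r S hS ho
      · simp at ho
      · have h1 := (hp x f r S).seq (Run.pop a fun v o => (v.1, o, v.2.2))
        rw [hg, hS] at h1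
        have h2 := ih (some y) f r (update (g x S) a l) (by simp) (by simp)
        have h := Run.loop_true (c := fstSome) rfl h1 h2
        have h' := h.mono (T' := (T + 2) * ((some x).toList ++ y :: l).length + 1)
          (by simp; ring_nf; omega)
        simpa [hg', popFst] using h'
  have h1 : Run (popFst a) v S 1 (v.1, (S a).head?, v.2.2) (update S a (S a).tail) := Run.pop _ _
  have h2 := main (S a).tail (S a).head? v.1 v.2.2 (update S a (S a).tail) (by simp)
    (by simp +contextual)
  have e : (S a).head?.toList ++ (S a).tail = S a := by cases S a <;> simp
  rw [e] at h2
  have := h1.seq h2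
  rw [update_idem] at this
  exact this.mono (by omega)

/-- Empty a stack. -/
def clear (a : K) : Cmd K A (Reg A) := forEach a (.load id)

theorem run_clear (a : K) (v : Reg A) (S : K → List A) :
    Run (clear a) v S (3 * (S a).length + 2) (v.1, none, v.2.2) (update S a []) := by
  have h := run_forEach a (.load id) 1 (fun _ S => S) (fun x f r S => Run.load id) (by simp)
    (by simp) v S
  have e : ∀ (l : List A) (S : K → List A), l.foldl (fun S _ => S) S = S := by
    intro l S
    induction l <;> simp_all
  rwa [e] at h

variable [Inhabited A]

/-- Push the first cell. -/
def pushFst (b : K) : Cmd K A (Reg A) := .push b fun v => v.2.1.getD default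

/-- Move the letters of a stack to another stack; this reverses their order. -/
def move (a b : K) : Cmd K A (Reg A) := forEach a (pushFst b)

theorem run_move {a b : K} (hab : a ≠ b) (v : Reg A) (S : K → List A) :
    Run (move a b) v S (3 * (S a).length + 2) (v.1, none, v.2.2)
      (update (update S a []) b ((S a).reverse ++ S b)) := by
  have h := run_forEach a (pushFst b) 1 (fun x S => update S b (x :: S b))
    (fun x f r S => Run.push _ _) (by simp [hab])
    (by intro x S l; simp only [update_of_ne hab.symm]; exact update_comm hab ..) v S
  have e : ∀ (l : List A) (S : K → List A), l.foldl (fun S x => update S b (x :: S b)) S =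
      update S b (l.reverse ++ S b) := by
    intro l
    induction l with
    | nil => simp
    | cons x l ih => intro S; simp [ih]
  rw [e, update_of_ne hab.symm] at h
  exact h

/-- Move the letters of a stack to two other stacks. -/
def dup (a b c : K) : Cmd K A (Reg A) := forEach a (.seq (pushFst b) (pushFst c))

theorem run_dup {a b c : K} (hab : a ≠ b) (hac : a ≠ c) (hbc : b ≠ c) (v : Reg A)
    (S : K → List A) :
    Run (dup a b c) v S (4 * (S a).length + 2) (v.1, none, v.2.2)
      (update (update (update S a []) b ((S a).reverse ++ S b)) c ((S a).reverse ++ S c)) := by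
  have h := run_forEach a (.seq (pushFst b) (pushFst c)) 2
    (fun x S => update (update S b (x :: S b)) c (x :: S c))
    (fun x f r S => by
      have := (Run.push (v := ((f, some x, r) : Reg A)) (S := S) b
        fun v => v.2.1.getD default).seq (Run.push c fun v => v.2.1.getD default)
      simp only [update_of_ne hbc.symm] at this
      exact this) (by simp [hab, hac])
    (by
      intro x S l
      simp only [update_of_ne hab.symm, update_of_ne hac.symm]
      rw [update_comm hab, update_comm hac]) v S
  have e : ∀ (l : List A) (S : K → List A),
      l.foldl (fun S x => update (update S b (x :: S b)) c (x :: S c)) S =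
      update (update S b (l.reverse ++ S b)) c (l.reverse ++ S c) := by
    intro l
    induction l with
    | nil => simp
    | cons x l ih =>
      intro S
      rw [List.foldl_cons, ih]
      simp only [update_self, update_of_ne hbc, List.reverse_cons, List.append_assoc,
        List.singleton_append]
      rw [update_comm hbc.symm, update_idem, update_idem]
  rw [e, update_of_ne hab.symm, update_of_ne hac.symm] at h
  exact h

/-- Put a copy of the stack `a` on top of the stack `b`, using the empty stack `t`. -/
def copy (t a b : K) : Cmd K A (Reg A) := .seq (move a t) (dup t a b)

/-- Moving to `t` reverses the word and `dup` reverses it again, so both copies have the original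
order and `t` ends up empty. -/
theorem run_copy {t a b : K} (hta : t ≠ a) (htb : t ≠ b) (hab : a ≠ b) (v : Reg A)
    (S : K → List A) (ht : S t = []) :
    Run (copy t a b) v S (7 * (S a).length + 4) (v.1, none, v.2.2)
      (update S b (S a ++ S b)) := by
  have h := (run_move hta.symm v S).seq (run_dup hta htb hab _ _)
  simp only [update_self, ht, List.append_nil, List.reverse_reverse, List.length_reverse,
    update_of_ne hta.symm, update_of_ne hab.symm, update_of_ne htb.symm, update_idem] at h
  have e : update (update (update S a []) t []) a (S a) = S := by
    rw [update_comm hta, update_idem, update_eq_self, ← ht, update_eq_self]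
  rw [e] at h
  exact h.mono (by omega)

variable [DecidableEq A]

/-- Empty two stacks, and set the flag if they had the same content. -/
def compare (a b : K) : Cmd K A (Reg A) :=
  .seq (.load fun v => (true, v.2)) <| .seq (.seq (popFst a) (popSnd b)) <|
    .loop (fun v => v.2.1.isSome || v.2.2.isSome) <|
      .seq (.load fun v => (v.1 && v.2.1 == v.2.2, v.2)) (.seq (popFst a) (popSnd b))

/-- Popping continues until both stacks are exhausted, even after a mismatch, so both are empty at
the end. Words of different length are told apart because an empty cell differs from an occupied
one. -/
theorem run_compare {a b : K} (hab : a ≠ b) (v : Reg A) (S : K → List A) :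
    Run (compare a b) v S (4 * ((S a).length + (S b).length) + 4)
      (decide (S a = S b), none, none) (update (update S a []) b []) := by
  have hpop : ∀ (v : Reg A) (S : K → List A), Run (.seq (popFst a) (popSnd b)) v S 2
      (v.1, (S a).head?, (S b).head?) (update (update S a (S a).tail) b (S b).tail) := by
    intro v S
    have h := (Run.pop (v := v) (S := S) a fun v o => (v.1, o, v.2.2)).seq
      (Run.pop b fun v o => (v.1, v.2.1, o))
    rw [update_of_ne hab.symm] at h
    exact h
  -- Here `l` and `m` are the two remaining words including the letters held in the cells. Each
  -- round shortens at least one of them, so their total length bounds the number of rounds.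
  have main : ∀ (n : ℕ) (l m : List A) (f : Bool) (S : K → List A), l.length + m.length ≤ n →
      S a = l.tail → S b = m.tail →
      Run (.loop (fun v => v.2.1.isSome || v.2.2.isSome) <|
        .seq (.load fun v => (v.1 && v.2.1 == v.2.2, v.2)) (.seq (popFst a) (popSnd b)))
        (f, l.head?, m.head?) S (4 * n + 1) (f && decide (l = m), none, none)
        (update (update S a []) b []) := by
    intro n
    induction n with
    | zero =>
      intro l m f S hn ha hb
      obtain rfl : l = [] := List.length_eq_zero_iff.1 (by omega)
      obtain rfl : m = [] := List.length_eq_zero_iff.1 (by omega)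
      simp only [List.tail_nil] at ha hb
      have e : update (update S a []) b [] = S := by
        rw [← ha, update_eq_self, ha, ← hb, update_eq_self]
      rw [e]
      have h : Run (.loop (fun v => v.2.1.isSome || v.2.2.isSome) <|
        .seq (.load fun v => (v.1 && v.2.1 == v.2.2, v.2)) (.seq (popFst a) (popSnd b)))
        (f, none, none) S 1 (f, none, none) S := Run.loop_false rfl
      simpa using h
    | succ n ih =>
      intro l m f S hn ha hb
      by_cases hlm : l = [] ∧ m = []
      · obtain ⟨rfl, rfl⟩ := hlm
        exact (ih [] [] f S (by simp) ha hb).mono (by omega)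
      · have h1 := (Run.load (v := ((f, l.head?, m.head?) : Reg A)) (S := S)
          fun v => (v.1 && v.2.1 == v.2.2, v.2)).seq (hpop _ _)
        have h2 := ih l.tail m.tail (f && l.head? == m.head?)
          (update (update S a l.tail.tail) b m.tail.tail) (by
            cases l <;> cases m <;> simp_all; omega) (by simp [hab]) (by simp)
        simp only [ha, hb] at h1
        have h := Run.loop_true (c := fun v => v.2.1.isSome || v.2.2.isSome)
          (by cases l <;> cases m <;> simp_all) h1 h2
        have e : update (update (update (update S a l.tail.tail) b m.tail.tail) a []) b [] =
            update (update S a []) b [] := by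
          rw [update_comm hab, update_idem, update_comm hab.symm, update_idem]
        rw [e] at h
        have e' : (f && l.head? == m.head? && decide (l.tail = m.tail)) = (f && decide (l = m)) := by
          rw [Bool.eq_iff_iff]
          cases l <;> cases m <;> simp [and_assoc]
          exact fun _ _ => decide_eq_true_iff
        rw [e'] at h
        exact h.mono (by omega)
  have h := (Run.load (v := v) (S := S) fun v => (true, v.2)).seq
    ((hpop _ _).seq (main _ (S a) (S b) true _ le_rfl (by simp [hab]) (by simp)))
  have e : update (update (update (update S a (S a).tail) b (S b).tail) a []) b [] =
      update (update S a []) b [] := by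
    rw [update_comm hab, update_idem, update_comm hab.symm, update_idem]
  rw [e, Bool.true_and] at h
  exact h.mono (by omega)

end Cmd

/-! ### First-order logic over words -/

/-- Formulas over variables for words over `A`, in which bound variables are named by de Bruijn
levels. -/
inductive Form (A : Type) : Type where
  | cat (i j k : ℕ)
  | lit (i : ℕ) (b : A)
  | neg (φ : Form A)
  | and (φ ψ : Form A)
  | split (j : ℕ) (φ : Form A)

namespace Form

variable {A : Type}

/-- The semantics of formulas; `d` is the level of the next bound variable. The quantifier ranges
over the ways to split the word `e j` in two; the first part is reversed. -/
def Sem : Form A → ℕ → (ℕ → List A) → Prop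
  | cat i j k, _, e => e i = e j ++ e k
  | lit i b, _, e => e i = [b]
  | neg φ, d, e => ¬ φ.Sem d e
  | and φ ψ, d, e => φ.Sem d e ∧ ψ.Sem d e
  | split j φ, d, e =>
    ∃ u v, e j = u.reverse ++ v ∧ φ.Sem (d + 2) (update (update e d u) (d + 1) v)

/-- All variables are less than `N`, and quantifiers only mention variables in scope. -/
def Scoped (N : ℕ) : Form A → ℕ → Prop
  | cat i j k, _ => i < N ∧ j < N ∧ k < N
  | lit i _, _ => i < N
  | neg φ, d => φ.Scoped N d
  | and φ ψ, d => φ.Scoped N d ∧ ψ.Scoped N d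
  | split j φ, d => j < d ∧ d + 1 < N ∧ φ.Scoped N (d + 2)

/-- A polynomial bound on the time for the evaluation of a formula. -/
noncomputable def time : Form A → Polynomial ℕ
  | cat _ _ _ => 40 * Polynomial.X + 40
  | lit _ _ => 40 * Polynomial.X + 40
  | neg φ => φ.time + 1
  | and φ ψ => φ.time + ψ.time + 2
  | split _ φ => (Polynomial.X + 1) * (φ.time + 10) + 40 * Polynomial.X + 40

variable [Inhabited A] [DecidableEq A]

/-- The stacks used for the evaluation of formulas: three auxiliary stacks and `N` stacks for the
variables. -/
abbrev Stk (N : ℕ) : Type := Fin 3 ⊕ Fin N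

/-- The contents of the stacks. -/
def stk {N : ℕ} (x y z : List A) (e : ℕ → List A) : Stk N → List A :=
  Sum.elim ![x, y, z] fun i => e i

/-- The stack of a variable. -/
def var (N : ℕ) [NeZero N] (i : ℕ) : Stk N := Sum.inr (Fin.ofNat N i)

/-- The program that evaluates a formula; the result is the flag. -/
def prog (N : ℕ) [NeZero N] : Form A → ℕ → Cmd (Stk N) A (Cmd.Reg A)
  | cat i j k, _ =>
    .seq (.copy (.inl 0) (var N k) (.inl 1)) <| .seq (.copy (.inl 0) (var N j) (.inl 1)) <|
      .seq (.copy (.inl 0) (var N i) (.inl 2)) (.compare (.inl 1) (.inl 2))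
  | lit i b, _ =>
    .seq (.push (.inl 1) fun _ => b) <|
      .seq (.copy (.inl 0) (var N i) (.inl 2)) (.compare (.inl 1) (.inl 2))
  | neg φ, d => .seq (φ.prog N d) (.load fun v => (!v.1, v.2))
  | and φ ψ, d => .seq (φ.prog N d) (.ite (fun v => v.1) (ψ.prog N d) (.load id))
  | split j φ, d =>
    .seq (.copy (.inl 0) (var N j) (var N (d + 1))) <|
    .seq (.load fun v => (v.1, some default, none)) <|
    .seq (.loop Cmd.fstSome <| .seq (φ.prog N (d + 2)) <|
      .ite (fun v => v.1) (.load fun v => (v.1, none, none)) <|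
        .seq (Cmd.popFst (var N (d + 1))) <|
        .ite Cmd.fstSome (Cmd.pushFst (var N d)) (.load id)) <|
    .seq (.clear (var N d)) (.clear (var N (d + 1)))

/-! ### The basic programs on the stacks of a formula evaluation -/

section stk

variable {N : ℕ} [NeZero N] {x y z : List A} {e : ℕ → List A} {i : ℕ}

@[simp] theorem stk_zero : (stk x y z e : Stk N → List A) (.inl 0) = x := rfl
@[simp] theorem stk_one : (stk x y z e : Stk N → List A) (.inl 1) = y := rfl
@[simp] theorem stk_two : (stk x y z e : Stk N → List A) (.inl 2) = z := rfl

theorem stk_var (hi : i < N) : (stk x y z e) (var N i) = e i := by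
  simp [stk, var, Nat.mod_eq_of_lt hi]

@[simp] theorem update_stk_zero (l : List A) :
    update (stk x y z e : Stk N → List A) (.inl 0) l = stk l y z e := by
  funext k
  rcases k with k | k
  · fin_cases k <;> simp [stk]
  · simp [stk]

@[simp] theorem update_stk_one (l : List A) :
    update (stk x y z e : Stk N → List A) (.inl 1) l = stk x l z e := by
  funext k
  rcases k with k | k
  · fin_cases k <;> simp [stk]
  · simp [stk]

@[simp] theorem update_stk_two (l : List A) :
    update (stk x y z e : Stk N → List A) (.inl 2) l = stk x y l e := by
  funext k
  rcases k with k | k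
  · fin_cases k <;> simp [stk]
  · simp [stk]

theorem update_stk_var (hi : i < N) (l : List A) :
    update (stk x y z e) (var N i) l = stk x y z (update e i l) := by
  funext k
  rcases k with k | k
  · simp [stk, var]
  · by_cases hk : (k : ℕ) = i
    · obtain rfl : k = Fin.ofNat N i := by
        ext
        simp [hk, Nat.mod_eq_of_lt hi]
      simp [var, stk, Nat.mod_eq_of_lt hi]
    · have : k ≠ Fin.ofNat N i := by
        rintro rfl
        simp [Nat.mod_eq_of_lt hi] at hk
      simp only [var, stk, Sum.elim_inr, update_of_ne hk]
      rw [update_of_ne (by simpa using this)]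
      rfl

theorem var_ne_var {j : ℕ} (hi : i < N) (hj : j < N) (h : i ≠ j) : var N i ≠ var N j := by
  intro h'
  simp only [var, Sum.inr.injEq, Fin.ext_iff, Fin.val_ofNat, Nat.mod_eq_of_lt hi,
    Nat.mod_eq_of_lt hj] at h'
  exact h h'

theorem run_copy_one {n : ℕ} (hi : i < N) (he : (e i).length ≤ n) (v : Cmd.Reg A) :
    Cmd.Run (.copy (.inl 0) (var N i) (.inl 1)) v (stk [] y z e) (7 * n + 4)
      (v.1, none, v.2.2) (stk [] (e i ++ y) z e) := by
  have h := Cmd.run_copy (t := .inl 0) (a := var N i) (b := .inl 1) (by simp [var]) (by simp)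
    (by simp [var]) v (stk [] y z e) rfl
  simp only [stk_var hi, stk_one, update_stk_one] at h
  exact h.mono (by omega)

theorem run_copy_two {n : ℕ} (hi : i < N) (he : (e i).length ≤ n) (v : Cmd.Reg A) :
    Cmd.Run (.copy (.inl 0) (var N i) (.inl 2)) v (stk [] y z e) (7 * n + 4)
      (v.1, none, v.2.2) (stk [] y (e i ++ z) e) := by
  have h := Cmd.run_copy (t := .inl 0) (a := var N i) (b := .inl 2) (by simp [var]) (by simp)
    (by simp [var]) v (stk [] y z e) rfl
  simp only [stk_var hi, stk_two, update_stk_two] at h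
  exact h.mono (by omega)

theorem run_copy_var {j n : ℕ} (hi : i < N) (hj : j < N) (hij : i ≠ j) (he : (e i).length ≤ n)
    (v : Cmd.Reg A) :
    Cmd.Run (.copy (.inl 0) (var N i) (var N j)) v (stk [] y z e) (7 * n + 4)
      (v.1, none, v.2.2) (stk [] y z (update e j (e i ++ e j))) := by
  have h := Cmd.run_copy (t := .inl 0) (a := var N i) (b := var N j) (by simp [var])
    (by simp [var]) (var_ne_var hi hj hij) v (stk [] y z e) rfl
  simp only [stk_var hi, stk_var hj, update_stk_var hj] at h
  exact h.mono (by omega)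

theorem run_compare_stk {n : ℕ} (h : y.length + z.length ≤ n) (v : Cmd.Reg A) :
    Cmd.Run (.compare (.inl 1) (.inl 2)) v (stk x y z e : Stk N → List A) (4 * n + 4)
      (decide (y = z), none, none) (stk x [] [] e) := by
  have h' := Cmd.run_compare (a := .inl 1) (b := .inl 2) (by simp) v
    (stk x y z e : Stk N → List A)
  simp only [stk_one, stk_two, update_stk_one, update_stk_two] at h'
  exact h'.mono (by omega)

theorem run_clear_var {n : ℕ} (hi : i < N) (h : (e i).length ≤ n) (v : Cmd.Reg A) :
    Cmd.Run (.clear (var N i)) v (stk x y z e) (3 * n + 2)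
      (v.1, none, v.2.2) (stk x y z (update e i [])) := by
  have h' := Cmd.run_clear (var N i) v (stk x y z e)
  simp only [stk_var hi, update_stk_var hi] at h'
  exact h'.mono (by omega)

end stk

open Classical in
/-- The loop that evaluates a quantifier. -/
theorem run_split_loop {N : ℕ} [NeZero N] (n T : ℕ) (φ : Form A) (d : ℕ) (hd : d + 1 < N)
    (e : ℕ → List A)
    (ih : ∀ (u l : List A) (v : Cmd.Reg A), u.length + l.length ≤ n →
      ∃ r, Cmd.Run (φ.prog N (d + 2)) v (stk [] [] [] (update (update e d u) (d + 1) l)) T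
        (decide (φ.Sem (d + 2) (update (update e d u) (d + 1) l)), r)
        (stk [] [] [] (update (update e d u) (d + 1) l))) :
    ∀ (l u : List A) (f : Bool) (x : A) (o : Option A), u.length + l.length ≤ n →
    ∃ o' u' l', u'.length + l'.length ≤ n ∧
      Cmd.Run (.loop Cmd.fstSome <| .seq (φ.prog N (d + 2)) <|
          .ite (fun v => v.1) (.load fun v => (v.1, none, none)) <|
          .seq (Cmd.popFst (var N (d + 1))) <|
          .ite Cmd.fstSome (Cmd.pushFst (var N d)) (.load id))
        (f, some x, o) (stk [] [] [] (update (update e d u) (d + 1) l))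
        ((l.length + 1) * (T + 5) + 1)
        (decide (∃ p q, l = p ++ q ∧
          φ.Sem (d + 2) (update (update e d (p.reverse ++ u)) (d + 1) q)), none, o')
        (stk [] [] [] (update (update e d u') (d + 1) l')) := by
  intro l
  induction l with
  | nil =>
    intro u f x o hul
    obtain ⟨r, hr⟩ := ih u [] (f, some x, o) hul
    have key : (∃ p q, [] = p ++ q ∧
        φ.Sem (d + 2) (update (update e d (p.reverse ++ u)) (d + 1) q)) ↔
        φ.Sem (d + 2) (update (update e d u) (d + 1) []) := by
      constructor
      · rintro ⟨p, q, h, h'⟩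
        obtain ⟨rfl, rfl⟩ := List.append_eq_nil_iff.1 h.symm
        exact h'
      · exact fun h => ⟨[], [], rfl, h⟩
    simp only [key]
    by_cases hφ : φ.Sem (d + 2) (update (update e d u) (d + 1) [])
    · have h := Cmd.Run.loop_true (c := Cmd.fstSome) rfl
        (hr.seq <| Cmd.Run.ite_true (c := fun v => v.1)
          (q := .seq (Cmd.popFst (var N (d + 1))) <|
            .ite Cmd.fstSome (Cmd.pushFst (var N d)) (.load id)) (by simp [hφ]) <|
          Cmd.Run.load fun v : Cmd.Reg A => (v.1, none, none)) (Cmd.Run.loop_false rfl)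
      exact ⟨_, _, _, hul, h.mono (by simp; omega)⟩
    · have hpop : Cmd.Run (Cmd.popFst (var N (d + 1))) (false, r)
          (stk [] [] [] (update (update e d u) (d + 1) [])) 1 (false, none, r.2)
          (stk [] [] [] (update (update e d u) (d + 1) [])) := by
        have h := Cmd.Run.pop (v := ((false, r) : Cmd.Reg A))
          (S := stk [] [] [] (update (update e d u) (d + 1) [])) (var N (d + 1))
          fun v o => (v.1, o, v.2.2)
        simpa [stk_var hd, update_stk_var hd, Cmd.popFst] using h
      have h := Cmd.Run.loop_true (c := Cmd.fstSome) rfl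
        (hr.seq <| Cmd.Run.ite_false (c := fun v => v.1)
          (p := .load fun v : Cmd.Reg A => (v.1, none, none)) (by simp [hφ]) <| by
            simp only [hφ, decide_false]
            exact hpop.seq <| Cmd.Run.ite_false (c := Cmd.fstSome)
              (p := Cmd.pushFst (var N d)) rfl <| Cmd.Run.load id) (Cmd.Run.loop_false rfl)
      simp only [hφ, decide_false]
      exact ⟨_, _, _, hul, h.mono (by simp; omega)⟩
  | cons y l ihl =>
    intro u f x o hul
    obtain ⟨r, hr⟩ := ih u (y :: l) (f, some x, o) hul
    by_cases hφ : φ.Sem (d + 2) (update (update e d u) (d + 1) (y :: l))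
    · have h := Cmd.Run.loop_true (c := Cmd.fstSome) rfl
        (hr.seq <| Cmd.Run.ite_true (c := fun v => v.1)
          (q := .seq (Cmd.popFst (var N (d + 1))) <|
            .ite Cmd.fstSome (Cmd.pushFst (var N d)) (.load id)) (by simp [hφ]) <|
          Cmd.Run.load fun v : Cmd.Reg A => (v.1, none, none)) (Cmd.Run.loop_false rfl)
      have key : ∃ p q, y :: l = p ++ q ∧
          φ.Sem (d + 2) (update (update e d (p.reverse ++ u)) (d + 1) q) := ⟨[], _, rfl, hφ⟩
      simp only [hφ, decide_true] at h
      simp only [key, decide_true]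
      exact ⟨_, _, _, hul, h.mono (by ring_nf; omega)⟩
    · have hpop : Cmd.Run (Cmd.popFst (var N (d + 1))) (false, r)
          (stk [] [] [] (update (update e d u) (d + 1) (y :: l))) 1 (false, some y, r.2)
          (stk [] [] [] (update (update e d u) (d + 1) l)) := by
        have h := Cmd.Run.pop (v := ((false, r) : Cmd.Reg A))
          (S := stk [] [] [] (update (update e d u) (d + 1) (y :: l))) (var N (d + 1))
          fun v o => (v.1, o, v.2.2)
        simpa [stk_var hd, update_stk_var hd, Cmd.popFst] using h
      have hpush : Cmd.Run (Cmd.pushFst (var N d)) (false, some y, r.2)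
          (stk [] [] [] (update (update e d u) (d + 1) l)) 1 (false, some y, r.2)
          (stk [] [] [] (update (update e d (y :: u)) (d + 1) l)) := by
        have h := Cmd.Run.push (v := ((false, some y, r.2) : Cmd.Reg A))
          (S := stk [] [] [] (update (update e d u) (d + 1) l)) (var N d)
          fun v => v.2.1.getD default
        have hd' : d < N := by omega
        have e1 : update (update (update e d u) (d + 1) l) d (y :: u) =
            update (update e d (y :: u)) (d + 1) l := by
          rw [update_comm (by omega), update_idem, update_comm (by omega)]
        have e2 : update (update e d u) (d + 1) l d = u := by
          rw [update_of_ne (by omega), update_self]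
        rw [stk_var hd', update_stk_var hd', e2] at h
        exact e1 ▸ h
      obtain ⟨o', u', l', hul', h'⟩ := ihl (y :: u) false y r.2 (by simp at hul ⊢; omega)
      have h := Cmd.Run.loop_true (c := Cmd.fstSome) rfl
        (hr.seq <| Cmd.Run.ite_false (c := fun v => v.1)
          (p := .load fun v : Cmd.Reg A => (v.1, none, none)) (by simp [hφ]) <| by
            simp only [hφ, decide_false]
            exact hpop.seq <| Cmd.Run.ite_true (c := Cmd.fstSome) (q := .load id) rfl hpush) h'
      -- The splitting with empty first part was just refuted, so every remaining one has `y` in its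
      -- first part. Since that part is stored reversed, `y` goes on top of `u`.
      have key : (∃ p q, y :: l = p ++ q ∧
          φ.Sem (d + 2) (update (update e d (p.reverse ++ u)) (d + 1) q)) ↔
          ∃ p q, l = p ++ q ∧
          φ.Sem (d + 2) (update (update e d (p.reverse ++ y :: u)) (d + 1) q) := by
        constructor
        · rintro ⟨_ | ⟨z, p⟩, q, hp, hq⟩
          · subst hp
            exact absurd hq hφ
          · simp only [List.cons_append, List.cons.injEq] at hp
            obtain ⟨rfl, rfl⟩ := hp
            exact ⟨p, q, rfl, by simpa using hq⟩
        · rintro ⟨p, q, rfl, hq⟩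
          exact ⟨y :: p, q, rfl, by simpa using hq⟩
      simp only [key]
      exact ⟨_, _, _, hul', h.mono (by simp; ring_nf; omega)⟩

-- The invariant is that the stacks of all levels from `d` on are empty: they serve as scratch space
-- for the next quantifier and are cleared afterwards. A quantifier only splits a word in scope, so
-- all words stay within length `n`, and its loop runs at most `n + 1` times.
open Classical in
theorem run_prog {N : ℕ} [NeZero N] (n : ℕ) (φ : Form A) : ∀ (d : ℕ) (e : ℕ → List A)
    (v : Cmd.Reg A), φ.Scoped N d → (∀ i, d ≤ i → e i = []) → (∀ i, (e i).length ≤ n) →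
    ∃ r, Cmd.Run (φ.prog N d) v (stk [] [] [] e) (φ.time.eval n) (decide (φ.Sem d e), r)
      (stk [] [] [] e) := by
  induction φ with
  | cat i j k =>
    intro d e v hs _ hn
    obtain ⟨hi, hj, hk⟩ := hs
    -- The word `e k` is copied first and `e j` on top of it, so that the stack reads `e j ++ e k`.
    have h := (run_copy_one (y := []) (z := []) hk (hn k) v).seq <|
      (run_copy_one hj (hn j) _).seq <| (run_copy_two hi (hn i) _).seq <|
      run_compare_stk (n := 3 * n) (by have := hn i; have := hn j; have := hn k; simp; omega) _
    simp only [List.append_nil] at h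
    have key : (e j ++ e k = e i) ↔ (cat i j k).Sem d e := eq_comm
    rw [decide_eq_decide.2 key] at h
    exact ⟨_, h.mono (by simp [time]; omega)⟩
  | lit i b =>
    intro d e v hs _ hn
    have h1 := Cmd.Run.push (v := v) (S := stk [] [] [] e) (.inl 1 : Stk N) fun _ => b
    rw [stk_one, update_stk_one] at h1
    have h := h1.seq <| (run_copy_two hs (hn i) v).seq <|
      run_compare_stk (n := n + 1) (by have := hn i; simp; omega) _
    simp only [List.append_nil] at h
    have key : ([b] = e i) ↔ (lit i b).Sem d e := eq_comm
    rw [decide_eq_decide.2 key] at h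
    exact ⟨_, h.mono (by simp [time]; omega)⟩
  | neg φ ih =>
    intro d e v hs he hn
    obtain ⟨r, hr⟩ := ih d e v hs he hn
    have h := hr.seq (Cmd.Run.load fun v => (!v.1, v.2))
    refine ⟨r, ?_⟩
    have e1 : decide ((neg φ).Sem d e) = !decide (φ.Sem d e) := by
      by_cases h : φ.Sem d e <;> simp [Sem, h]
    rw [e1]
    simpa [time, prog] using h
  | and φ ψ ih ih' =>
    intro d e v hs he hn
    obtain ⟨r, hr⟩ := ih d e v hs.1 he hn
    by_cases hφ : φ.Sem d e
    · obtain ⟨r', hr'⟩ := ih' d e (true, r) hs.2 he hn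
      simp only [hφ, decide_true] at hr
      have h := hr.seq (Cmd.Run.ite_true (c := fun v => v.1) (q := .load id) rfl hr')
      simp only [Sem, hφ, true_and]
      exact ⟨r', h.mono (by simp [time]; try omega)⟩
    · simp only [hφ, decide_false] at hr
      have h := hr.seq (Cmd.Run.ite_false (c := fun v => v.1) (p := ψ.prog N d) rfl
        (Cmd.Run.load id))
      simp only [Sem, hφ, false_and, decide_false]
      exact ⟨_, h.mono (by simp [time])⟩
  | split j φ ih =>
    intro d e v hs he hn
    obtain ⟨hj, hd, hs⟩ := hs
    have hd' : d < N := by omega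
    have h1 := run_copy_var (y := []) (z := []) (show j < N by omega) hd
      (show j ≠ d + 1 by omega) (hn j) v
    rw [he (d + 1) (by omega), List.append_nil] at h1
    -- The induction hypothesis applies to every splitting reached by the loop: only the levels `d`
    -- and `d + 1` change, and their two words have total length at most `n`.
    obtain ⟨o', u', l', hul, h2⟩ := run_split_loop n (φ.time.eval n) φ d hd e (by
      intro u l v hul
      refine ih (d + 2) _ v hs (fun i hi => ?_) fun i => ?_
      · rw [update_of_ne (by omega), update_of_ne (by omega), he i (by omega)]
      · by_cases h : i = d + 1
        · subst h
          rw [update_self]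
          omega
        · rw [update_of_ne h]
          by_cases h : i = d
          · subst h
            rw [update_self]
            omega
          · rw [update_of_ne h]
            exact hn i) (e j) [] v.1 default none (by simpa using hn j)
    have e1 : update e d [] = e := by rw [← he d le_rfl, update_eq_self]
    have e2 : update e (d + 1) [] = e := by rw [← he (d + 1) (by omega), update_eq_self]
    rw [e1] at h2
    have h3 := run_clear_var (x := []) (y := []) (z := [])
      (e := update (update e d u') (d + 1) l') (n := n) hd' (by
        rw [update_of_ne (by omega), update_self]
        omega) (decide (∃ p q, e j = p ++ q ∧
          φ.Sem (d + 2) (update (update e d (p.reverse ++ [])) (d + 1) q)), none, o')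
    have e3 : update (update (update e d u') (d + 1) l') d [] = update e (d + 1) l' := by
      rw [update_comm (by omega), update_idem, e1]
    rw [e3] at h3
    have h4 := run_clear_var (x := []) (y := []) (z := [])
      (e := update e (d + 1) l') (n := n) hd (by
        rw [update_self]
        omega) (decide (∃ p q, e j = p ++ q ∧
          φ.Sem (d + 2) (update (update e d (p.reverse ++ [])) (d + 1) q)), none, o')
    rw [update_idem, e2] at h4
    have h := h1.seq <| (Cmd.Run.load fun v => (v.1, some default, none)).seq <| h2.seq <|
      h3.seq h4
    have key : (∃ p q, e j = p ++ q ∧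
        φ.Sem (d + 2) (update (update e d (p.reverse ++ [])) (d + 1) q)) ↔
        (split j φ).Sem d e := by
      simp only [Sem, List.append_nil]
      constructor
      · rintro ⟨p, q, h, h'⟩
        exact ⟨p.reverse, q, by simpa using h, h'⟩
      · rintro ⟨p, q, h, h'⟩
        exact ⟨p.reverse, q, h, by simpa using h'⟩
    rw [decide_eq_decide.2 key] at h
    refine ⟨_, h.mono ?_⟩
    have hj := Nat.mul_le_mul_right (φ.time.eval n + 5) (Nat.succ_le_succ (hn j))
    simp only [time, Polynomial.eval_add, Polynomial.eval_mul, Polynomial.eval_X,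
      Polynomial.eval_one, Polynomial.eval_ofNat]
    simp only [Nat.succ_eq_add_one] at hj
    ring_nf at hj ⊢
    omega

-- Subformulas may use different numbers of stacks; this allows a common one.
omit [Inhabited A] [DecidableEq A] in
theorem Scoped.mono {N M : ℕ} (h : N ≤ M) {φ : Form A} : ∀ {d : ℕ}, φ.Scoped N d → φ.Scoped M d := by
  induction φ with
  | cat i j k => exact fun ⟨h1, h2, h3⟩ => ⟨by omega, by omega, by omega⟩
  | lit i b => exact fun h1 => lt_of_lt_of_le h1 h
  | neg φ ih => exact ih
  | and φ ψ ih ih' => exact fun h => ⟨ih h.1, ih' h.2⟩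
  | split j φ ih => exact fun h => ⟨h.1, by have := h.2.1; omega, ih h.2.2⟩

/-! ### Evaluating a formula on an input that consists of two words -/

/-- The environment with two words. -/
def env₂ (x w : List A) : ℕ → List A := update (update (fun _ => []) 0 x) 1 w

/-- Distribute the letters of the input over two stacks, translating them by `r`. -/
def distribute (N : ℕ) (cls : A → Bool) (r : A → A) : Cmd (Stk N) A (Cmd.Reg A) :=
  .forEach (.inl 0) <| .ite (fun v => cls (v.2.1.getD default))
    (.push (.inl 1) fun v => r (v.2.1.getD default))
    (.push (.inl 2) fun v => r (v.2.1.getD default))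

/-- The first word consists of letters accepted by `cls` and the second of rejected ones, so a
single pass separates them. Both arrive reversed; the moves to the variable stacks undo this. -/
theorem run_distribute {N : ℕ} [NeZero N] (cls : A → Bool) (r : A → A) (x w : List A)
    (hx : ∀ a ∈ x, cls a = true) (hw : ∀ a ∈ w, cls a = false) (v : Cmd.Reg A) (e : ℕ → List A) :
    Cmd.Run (distribute N cls r) v (stk (x ++ w) [] [] e) (4 * (x.length + w.length) + 2)
      (v.1, none, v.2.2) (stk [] (x.map r).reverse (w.map r).reverse e) := by
  have h := Cmd.run_forEach (K := Stk N) (.inl 0) (.ite (fun v => cls (v.2.1.getD default))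
    (.push (.inl 1) fun v => r (v.2.1.getD default))
    (.push (.inl 2) fun v => r (v.2.1.getD default))) 2
    (fun a S => if cls a then update S (.inl 1) (r a :: S (.inl 1))
      else update S (.inl 2) (r a :: S (.inl 2)))
    (by
      intro a f o S
      by_cases ha : cls a
      · rw [if_pos ha]
        exact Cmd.Run.ite_true (by simpa using ha) (Cmd.Run.push ..)
      · rw [if_neg ha]
        exact Cmd.Run.ite_false (by simpa using ha) (Cmd.Run.push ..))
    (by intro a S; split <;> simp)
    (by
      intro a S l
      split
      · rw [update_comm (by simp), update_of_ne (by simp)]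
      · rw [update_comm (by simp), update_of_ne (by simp)])
    v (stk (x ++ w) [] [] e)
  have h1 : ∀ (x y z : List A), (∀ a ∈ x, cls a = true) →
      x.foldl (fun (S : Stk N → List A) a => if cls a then update S (.inl 1) (r a :: S (.inl 1))
        else update S (.inl 2) (r a :: S (.inl 2))) (stk [] y z e : Stk N → List A) =
      stk [] ((x.map r).reverse ++ y) z e := by
    intro x
    induction x with
    | nil => simp
    | cons a x ih =>
      intro y z hx
      rw [List.foldl_cons, if_pos (hx a (by simp)), stk_one, update_stk_one,
        ih _ _ fun b hb => hx b (by simp [hb])]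
      simp
  have h2 : ∀ (x y z : List A), (∀ a ∈ x, cls a = false) →
      x.foldl (fun (S : Stk N → List A) a => if cls a then update S (.inl 1) (r a :: S (.inl 1))
        else update S (.inl 2) (r a :: S (.inl 2))) (stk [] y z e : Stk N → List A) =
      stk [] y ((x.map r).reverse ++ z) e := by
    intro x
    induction x with
    | nil => simp
    | cons a x ih =>
      intro y z hx
      rw [List.foldl_cons, if_neg (by simp [hx a]), stk_two, update_stk_two,
        ih _ _ fun b hb => hx b (by simp [hb])]
      simp
  rw [stk_zero, update_stk_zero, List.foldl_append, h1 _ _ _ hx, h2 _ _ _ hw] at h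
  simpa [distribute] using h

theorem run_move_var {N : ℕ} [NeZero N] {y z : List A} {e : ℕ → List A} {i : ℕ} (hi : i < N)
    (he : e i = []) (v : Cmd.Reg A) :
    Cmd.Run (.move (.inl 1) (var N i)) v (stk [] y z e) (3 * y.length + 2)
      (v.1, none, v.2.2) (stk [] [] z (update e i y.reverse)) ∧
    Cmd.Run (.move (.inl 2) (var N i)) v (stk [] y z e) (3 * z.length + 2)
      (v.1, none, v.2.2) (stk [] y [] (update e i z.reverse)) := by
  constructor
  · have h := Cmd.run_move (a := .inl 1) (b := var N i) (by simp [var]) v (stk [] y z e)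
    simpa [update_stk_var hi, stk_var hi, he] using h
  · have h := Cmd.run_move (a := .inl 2) (b := var N i) (by simp [var]) v (stk [] y z e)
    simpa [update_stk_var hi, stk_var hi, he] using h

open Classical in
/-- The truth of a formula in two words is decided in polynomial time, where the input consists of
the two words. -/
theorem computableInPolyTime [Finite A] {α : Type} (ea : α → List A) (x w : α → List A)
    (hea : ∀ a, ea a = x a ++ w a) (cls : A → Bool) (r : A → A)
    (hx : ∀ a, ∀ b ∈ x a, cls b = true) (hw : ∀ a, ∀ b ∈ w a, cls b = false)
    (φ : Form A) (hφ : ∃ N, φ.Scoped N 2) :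
    Nonempty (Turing.TM2ComputableInPolyTime ea Computability.encodeBool
      fun a => decide (φ.Sem 2 (env₂ ((x a).map r) ((w a).map r)))) := by
  obtain ⟨N, hN⟩ := hφ
  -- At least two stacks are needed for the two input words.
  replace hN : φ.Scoped (N + 2) 2 := hN.mono (by omega)
  refine Cmd.computableInPolyTime (K := Stk (N + 2)) ea _
    (.seq (distribute (N + 2) cls r) <| .seq (.move (.inl 1) (var (N + 2) 0)) <|
      .seq (.move (.inl 2) (var (N + 2) 1)) <| .seq (φ.prog (N + 2) 2) <|
      .seq (.clear (var (N + 2) 0)) (.clear (var (N + 2) 1)))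
    (.inl 0) (false, none, none) (fun v => v.1)
    (φ.time + 20 * Polynomial.X + 20) fun a => ?_
  set n := (ea a).length with hn
  have hlen : (x a).length + (w a).length = n := by simp [hn, hea]
  have h1 := run_distribute (N := N + 2) cls r (x a) (w a) (hx a) (hw a) (false, none, none)
    fun _ => []
  have h2 := (run_move_var (N := N + 2) (y := ((x a).map r).reverse) (z := ((w a).map r).reverse)
    (e := fun _ => []) (i := 0) (by omega) rfl (false, none, none)).1
  have h3 := (run_move_var (N := N + 2) (y := []) (z := ((w a).map r).reverse)
    (e := update (fun _ => []) 0 ((x a).map r)) (i := 1) (by omega) (by simp)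
    (false, none, none)).2
  simp only [List.reverse_reverse] at h2 h3
  obtain ⟨o, h4⟩ := run_prog (N := N + 2) n φ 2 (env₂ ((x a).map r) ((w a).map r))
    (false, none, none) hN
    (fun i hi => by
      rw [env₂, update_of_ne (by omega), update_of_ne (by omega)])
    (fun i => by
      by_cases h : i = 1
      · subst h
        simp [env₂]
        omega
      · by_cases h' : i = 0
        · subst h'
          simp [env₂]
          omega
        · simp [env₂, h, h'])
  have h5 := run_clear_var (N := N + 2) (x := []) (y := []) (z := [])
    (e := env₂ ((x a).map r) ((w a).map r)) (n := n) (i := 0) (by omega) (by simp [env₂]; omega)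
    (decide (φ.Sem 2 (env₂ ((x a).map r) ((w a).map r))), o)
  have h6 := run_clear_var (N := N + 2) (x := []) (y := []) (z := [])
    (e := update (env₂ ((x a).map r) ((w a).map r)) 0 []) (n := n) (i := 1) (by omega)
    (by simp [env₂]; omega)
    (decide (φ.Sem 2 (env₂ ((x a).map r) ((w a).map r))), none, o.2)
  have e0 : update (fun _ => [] : Stk (N + 2) → List A) (.inl 0) (ea a) =
      stk (x a ++ w a) [] [] fun _ => [] := by
    rw [← update_stk_zero (N := N + 2) (x := []), hea]
    congr 1
    funext k
    rcases k with k | k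
    · fin_cases k <;> rfl
    · rfl
  -- After the last two clearings every stack is empty, as the compiled machine requires.
  have e1 : (stk [] [] [] (update (update (env₂ ((x a).map r) ((w a).map r)) 0 []) 1 []) :
      Stk (N + 2) → List A) = fun _ => [] := by
    funext k
    rcases k with k | k
    · fin_cases k <;> rfl
    · simp only [stk, Sum.elim_inr, env₂, update_apply]
      split_ifs <;> rfl
  obtain ⟨t, ht, h⟩ := h1.seq <| h2.seq <| h3.seq <| h4.seq <| h5.seq h6
  rw [← e0, e1] at h
  refine ⟨t, _, ?_, h, rfl⟩
  simp at ht ⊢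
  omega

end Form

/-! ### Definable predicates on words -/

/-- A predicate on tuples of words is definable if it is expressed by a formula, under every
assignment of levels to its arguments. -/
def Def {A ι : Type} (P : (ι → List A) → Prop) : Prop :=
  ∀ (n : ℕ) (ρ : ι → ℕ), (∀ i, ρ i < n) →
    ∃ φ : Form A, (∃ N, φ.Scoped N n) ∧ ∀ e : ℕ → List A, φ.Sem n e ↔ P fun i => e (ρ i)

namespace Def

variable {A ι κ : Type} {P Q : (ι → List A) → Prop}

theorem congr (h : Def P) (h' : ∀ e, P e ↔ Q e) : Def Q := by
  obtain rfl : P = Q := funext fun e => propext (h' e)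
  exact h

theorem reindex (h : Def P) (f : ι → κ) : Def fun e : κ → List A => P fun i => e (f i) :=
  fun n ρ hρ => h n (ρ ∘ f) fun i => hρ (f i)

theorem cat (i j k : ι) : Def fun e : ι → List A => e i = e j ++ e k := fun n ρ hρ =>
  ⟨.cat (ρ i) (ρ j) (ρ k), ⟨n, hρ i, hρ j, hρ k⟩, fun _ => Iff.rfl⟩

theorem lit (i : ι) (a : A) : Def fun e : ι → List A => e i = [a] := fun n ρ hρ =>
  ⟨.lit (ρ i) a, ⟨n, hρ i⟩, fun _ => Iff.rfl⟩

theorem not (h : Def P) : Def fun e => ¬ P e := fun n ρ hρ =>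
  let ⟨φ, hs, hφ⟩ := h n ρ hρ
  ⟨.neg φ, hs, fun e => not_congr (hφ e)⟩

theorem and (h : Def P) (h' : Def Q) : Def fun e => P e ∧ Q e := fun n ρ hρ =>
  let ⟨φ, ⟨N, hN⟩, hφ⟩ := h n ρ hρ
  let ⟨ψ, ⟨M, hM⟩, hψ⟩ := h' n ρ hρ
  ⟨.and φ ψ, ⟨max N M, hN.mono (le_max_left ..), hM.mono (le_max_right ..)⟩,
    fun e => and_congr (hφ e) (hψ e)⟩

theorem or (h : Def P) (h' : Def Q) : Def fun e => P e ∨ Q e :=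
  (h.not.and h'.not).not.congr fun e => by tauto

/-- The two new words get the levels `n` and `n + 1`. These differ from all levels in the range of
`ρ`, so the old words keep their values. -/
theorem split {P : (ι → List A) → List A → List A → Prop} (j : ι)
    (h : Def fun e : Option (Option ι) → List A =>
      P (fun i => e (some (some i))) (e (some none)) (e none)) :
    Def fun e : ι → List A => ∃ u v, e j = u.reverse ++ v ∧ P e u v := by
  intro n ρ hρ
  obtain ⟨φ, ⟨N, hN⟩, hφ⟩ := h (n + 2)
    (fun i => i.elim (n + 1) fun i => i.elim n ρ) (by
      rintro (_ | _ | i)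
      · simp
      · simp
      · exact (hρ i).trans (by omega))
  refine ⟨.split (ρ j) φ, ⟨max N (n + 2), hρ j, by omega, hN.mono (le_max_left ..)⟩, fun e => ?_⟩
  refine exists_congr fun u => exists_congr fun v => and_congr_right fun _ => ?_
  rw [hφ]
  have : (fun i => update (update e n u) (n + 1) v (ρ i)) = fun i => e (ρ i) := by
    funext i
    have := hρ i
    rw [update_of_ne (by omega), update_of_ne (by omega)]
  simp [this]

/-- The empty word is the only one that equals its own square. -/
theorem empty (i : ι) : Def fun e : ι → List A => e i = [] :=
  (cat i i i).congr fun e => by simp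

/-- Quantification over the factors of a word. -/
theorem exists_infix {P : (ι → List A) → List A → Prop} (j : ι)
    (h : Def fun e : Option ι → List A => P (fun i => e (some i)) (e none)) :
    Def fun e : ι → List A => ∃ u, u <:+: e j ∧ P e u := by
  -- Two splittings isolate the factor, but in reversed form. A third one, of the reversed factor
  -- with empty second part, reverses it back.
  refine (split (P := fun e _ v => ∃ u' v', v = u'.reverse ++ v' ∧
    ∃ u d, u' = u.reverse ++ d ∧ d = [] ∧ P e u) j <| split none <| split (some none) <|
    (empty none).and <| h.reindex fun i => i.elim (some none) fun i =>
      some (some (some (some (some (some i)))))).congr fun e => ?_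
  constructor
  · rintro ⟨a, v, h, u', v', rfl, u, d, rfl, rfl, hP⟩
    refine ⟨u, ?_, hP⟩
    rw [h]
    exact ⟨a.reverse, v', by simp⟩
  · rintro ⟨u, ⟨a, b, h⟩, hP⟩
    exact ⟨a.reverse, u ++ b, by simp [← h], u.reverse, b, by simp, u, [], by simp, rfl, hP⟩

/-- Both parts of a splitting are factors, so quantifying over factors and requiring the
concatenation avoids the reversal in the primitive quantifier. -/
theorem exists_split {P : (ι → List A) → List A → List A → Prop} (j : ι)
    (h : Def fun e : Option (Option ι) → List A =>
      P (fun i => e (some (some i))) (e (some none)) (e none)) :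
    Def fun e : ι → List A => ∃ u v, e j = u ++ v ∧ P e u v := by
  refine (exists_infix (P := fun e u => ∃ v, v <:+: e j ∧ e j = u ++ v ∧ P e u v) j <|
    exists_infix (some j) <| (cat (some (some j)) (some none) none).and h).congr fun e => ?_
  constructor
  · rintro ⟨u, _, v, _, h⟩
    exact ⟨u, v, h⟩
  · rintro ⟨u, v, h, hP⟩
    exact ⟨u, ⟨[], v, by simp [h]⟩, v, ⟨u, [], by simp [h]⟩, h, hP⟩

/-- A finite conjunction. The index `i` is there for the empty one: a formula needs a variable to
express truth. -/
theorem finset_forall {β : Type*} (s : Finset β) {P : β → (ι → List A) → Prop}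
    (h : ∀ b ∈ s, Def (P b)) (i : ι) : Def fun e => ∀ b ∈ s, P b e := by
  classical
  induction s using Finset.induction_on with
  | empty => exact ((empty i).or (empty i).not).congr fun e => by simp [em]
  | insert b s _ ih =>
    exact ((h b (by simp)).and (ih fun b hb => h b (by simp [hb]))).congr fun e => by simp

theorem finset_exists {β : Type*} (s : Finset β) {P : β → (ι → List A) → Prop}
    (h : ∀ b ∈ s, Def (P b)) (i : ι) : Def fun e => ∃ b ∈ s, P b e :=
  (finset_forall s (fun b hb => (h b hb).not) i).not.congr fun e => by simp

theorem fintype_forall {β : Type*} [Finite β] {P : β → (ι → List A) → Prop}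
    (h : ∀ b, Def (P b)) (i : ι) : Def fun e => ∀ b, P b e := by
  have := Fintype.ofFinite β
  exact (finset_forall Finset.univ (fun b _ => h b) i).congr fun e => by simp

/-- The word denoted by a sequence of variables and letters. -/
def _root_.DataExchange.pieces (L : List (ι ⊕ A)) (e : ι → List A) : List A :=
  L.flatMap (Sum.elim e fun a => [a])

/-- The first piece is split off and the rest handled by induction. The split adds indices to the
context, so the reindexing `f` has to vary in the induction. -/
theorem eq_pieces_comp (L : List (ι ⊕ A)) : ∀ {κ : Type} (f : ι → κ) (i : κ),
    Def fun e : κ → List A => e i = pieces L fun k => e (f k) := by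
  induction L with
  | nil => exact fun f i => (empty i).congr fun e => by simp [pieces]
  | cons a L ih =>
    intro κ f i
    have h' : Def fun e : Option (Option κ) → List A =>
        e (some none) = Sum.elim (fun k => e (some (some (f k)))) (fun a => [a]) a := by
      rcases a with k | a
      -- There is no primitive equality of two words; it is expressed as concatenation with an empty
      -- factor.
      · refine (exists_infix (P := fun e u => u = [] ∧ e (some none) = e (some (some (f k))) ++ u)
          (some none) ((empty none).and
          (cat (some (some none)) (some (some (some (f k)))) none))).congr fun e => ?_
        constructor
        · rintro ⟨_, _, rfl, h⟩
          simpa using h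
        · intro h
          exact ⟨[], List.nil_infix, rfl, by simpa using h⟩
      · exact lit _ _
    refine (exists_split (P := fun e u v => u = Sum.elim (fun k => e (f k)) (fun a => [a]) a ∧
      v = pieces L fun k => e (f k)) i
      (h'.and (ih (fun k => some (some (f k))) none))).congr fun e => ?_
    simp only [pieces, List.flatMap_cons]
    exact ⟨fun ⟨u, v, h, h1, h2⟩ => by rw [h, h1, h2], fun h => ⟨_, _, h, rfl, rfl⟩⟩

theorem eq_pieces (i : ι) (L : List (ι ⊕ A)) : Def fun e : ι → List A => e i = pieces L e :=
  eq_pieces_comp L id i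

theorem eq (i j : ι) : Def fun e : ι → List A => e i = e j :=
  (eq_pieces i [.inl j]).congr fun e => by simp [pieces]

theorem eq_word (i : ι) (w : List A) : Def fun e : ι → List A => e i = w :=
  (eq_pieces i (w.map .inr)).congr fun e => by simp [pieces, List.flatMap_map]

/-- All letters of a word belong to a given set. -/
theorem letters [Finite A] (i : ι) (s : Set A) : Def fun e : ι → List A => ∀ a ∈ e i, a ∈ s := by
  refine (fintype_forall (β := {a // a ∉ s}) (P := fun b e => ¬ ∃ u, u <:+: e i ∧ u = [b.1])
    (fun b => (exists_infix i (lit none b.1)).not) i).congr fun e => ?_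
  constructor
  · intro h a ha
    by_contra hs
    obtain ⟨l, r, h'⟩ := List.append_of_mem ha
    exact h ⟨a, hs⟩ ⟨[a], ⟨l, r, by simp [h']⟩, rfl⟩
  · rintro h ⟨b, hb⟩ ⟨_, ⟨l, r, h'⟩, rfl⟩
    exact hb (h b (by rw [← h']; simp))

end Def

/-- The predicate `P` on two words is decided in polynomial time. -/
theorem Def.computableInPolyTime {Γ Δ : Type} [Finite Γ] [Finite Δ] [Nonempty Γ]
    (r : Γ ⊕ Δ → Γ ⊕ Δ) {P : (Bool → List (Γ ⊕ Δ)) → Prop} (h : Def P)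
    (V : List Γ × List Δ → Bool)
    (hV : ∀ x w, V (x, w) = true ↔ P fun i => if i then x.map (fun a => r (.inl a))
      else w.map fun a => r (.inr a)) :
    Nonempty (Turing.TM2ComputableInPolyTime encodePair Computability.encodeBool V) := by
  classical
  have : Inhabited (Γ ⊕ Δ) := ⟨.inl (Classical.arbitrary Γ)⟩
  obtain ⟨φ, hs, hφ⟩ := h 2 (fun i => if i then 0 else 1) (by intro i; cases i <;> simp)
  have h' := φ.computableInPolyTime (α := List Γ × List Δ) encodePair (fun a => a.1.map .inl)
    (fun a => a.2.map .inr) (fun a => rfl) Sum.isLeft r (by simp) (by simp) hs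
  have e : (fun a : List Γ × List Δ => decide (φ.Sem 2 (Form.env₂ ((a.1.map Sum.inl).map r)
      ((a.2.map Sum.inr).map r)))) = V := by
    funext ⟨x, w⟩
    rw [Bool.eq_iff_iff, hV, decide_eq_true_iff, hφ]
    have : (fun i : Bool => Form.env₂ ((x.map Sum.inl).map r) ((w.map Sum.inr).map r)
        (if i = true then 0 else 1)) = fun i => if i = true then x.map (fun a => r (.inl a))
          else w.map fun a => r (.inr a) := by
      funext i
      cases i <;> simp [Form.env₂, Function.comp_def]
    rw [this]
  rwa [e] at h'


/-! ### Blocks -/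

/-- The letters of inputs and certificates; the letters in `T` name TGDs. -/
abbrev Ltr (T : Type) : Type := Sym ⊕ Sym ⊕ T

section Words

variable {T : Type}

/-- A symbol of the input alphabet. -/
def sym (s : Sym) : Ltr T := .inl s

/-- A letter that names a TGD. -/
def mark (ρ : T) : Ltr T := .inr (.inr ρ)

/-- The word for a constant. -/
def enc (c : Const) : List (Ltr T) := c.map fun b => sym (.bit b)

theorem enc_injective : Injective (enc : Const → List (Ltr T)) :=
  List.map_injective_iff.2 fun a b h => by simpa [sym] using h

/-- The word ends at the end of a block. -/
def AtBoundary (u : List (Ltr T)) : Prop := u = [] ∨ ∃ v, u = v ++ [sym .semicolon]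

/-- The block `s` occurs in the word `u`. -/
def Occ (s u : List (Ltr T)) : Prop := ∃ p r, u = p ++ (s ++ r) ∧ AtBoundary p

/-- The word for a tuple of constants. -/
def encTuple (l : List Const) : List (Ltr T) := l.flatMap fun c => sym .comma :: enc c

end Words

variable {T ι κ : Type}

theorem Def.atBoundary (i : ι) : Def fun e : ι → List (Ltr T) => AtBoundary (e i) :=
  ((Def.empty i).or (Def.exists_split (P := fun _ _ v => v = [sym .semicolon]) i
    (Def.lit none _))).congr fun e => by simp [AtBoundary]

theorem Def.occ (i : ι) (L : List (ι ⊕ Ltr T)) :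
    Def fun e : ι → List (Ltr T) => Occ (pieces L e) (e i) := by
  refine (Def.exists_split (P := fun e p q => AtBoundary p ∧ ∃ s r, q = s ++ r ∧ s = pieces L e) i
    ((Def.atBoundary _).and <| Def.exists_split none <|
      Def.eq_pieces_comp L (fun i => some (some (some (some i)))) (some none))).congr fun e => ?_
  constructor
  · rintro ⟨p, q, h, hb, s, r, rfl, rfl⟩
    exact ⟨p, r, h, hb⟩
  · rintro ⟨p, r, h, hb⟩
    exact ⟨p, _, h, hb, _, r, rfl, rfl⟩

theorem mem_range_enc (u : List (Ltr T)) :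
    (∀ a ∈ u, a ∈ Set.range fun b => (sym (.bit b) : Ltr T)) ↔ ∃ c : Const, u = enc c := by
  constructor
  · intro h
    induction u with
    | nil => exact ⟨[], rfl⟩
    | cons a u ih =>
      obtain ⟨c, hc⟩ := ih fun b hb => h b (by simp [hb])
      obtain ⟨b, hb⟩ := h a (by simp)
      exact ⟨b :: c, by simp [enc, hc, ← hb]⟩
  · rintro ⟨c, rfl⟩ a ha
    obtain ⟨b, _, rfl⟩ := List.mem_map.1 ha
    exact ⟨b, rfl⟩

theorem Def.exists_eq_enc [Finite T] (i : ι) :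
    Def fun e : ι → List (Ltr T) => ∃ c : Const, e i = enc c :=
  (Def.letters i _).congr fun e => mem_range_enc (e i)

/-! ### Definability with constants as parameters -/

/-- The constant `a` occurs in one of the words `x` and `w`. -/
def Dom (x w : List (Ltr T)) (a : Const) : Prop := enc a <:+: x ∨ enc a <:+: w

/-- A predicate on words and constants is definable if it is expressed by a definable predicate on
words, where the constants are encoded as words. -/
def DefC (P : (ι → List (Ltr T)) → (κ → Const) → Prop) : Prop :=
  ∃ Q : (ι ⊕ κ → List (Ltr T)) → Prop, Def Q ∧
    ∀ e c, Q (Sum.elim e fun k => enc (c k)) ↔ P e c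

namespace DefC

variable {P Q : (ι → List (Ltr T)) → (κ → Const) → Prop}

theorem congr (h : DefC P) (h' : ∀ e c, P e c ↔ Q e c) : DefC Q := by
  obtain rfl : P = Q := funext fun e => funext fun c => propext (h' e c)
  exact h

theorem ofDef {P : (ι ⊕ κ → List (Ltr T)) → Prop} (h : Def P) :
    DefC fun e (c : κ → Const) => P (Sum.elim e fun k => enc (c k)) :=
  ⟨P, h, fun _ _ => Iff.rfl⟩

/-- Without constant parameters the second half of the index type is empty, and any index may be
used to fill it. -/
theorem toDef [Nonempty ι] {P : (ι → List (Ltr T)) → Prop}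
    (h : DefC fun e (_ : Empty → Const) => P e) : Def P := by
  obtain ⟨Q, hQ, h⟩ := h
  let i := Classical.arbitrary ι
  refine (hQ.reindex (Sum.elim id fun _ => i)).congr fun e => ?_
  refine Iff.trans ?_ (h e nofun)
  have : (fun k : ι ⊕ Empty => e (Sum.elim id (fun _ => i) k)) =
      Sum.elim e fun k : Empty => enc ((nofun : Empty → Const) k) := by
    funext k
    rcases k with k | k
    · rfl
    · exact k.elim
  rw [this]

theorem not (h : DefC P) : DefC fun e c => ¬ P e c :=
  let ⟨_, hQ, h⟩ := h
  ⟨_, hQ.not, fun e c => not_congr (h e c)⟩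

theorem and (h : DefC P) (h' : DefC Q) : DefC fun e c => P e c ∧ Q e c :=
  let ⟨_, hQ, h⟩ := h
  let ⟨_, hQ', h'⟩ := h'
  ⟨_, hQ.and hQ', fun e c => and_congr (h e c) (h' e c)⟩

theorem or (h : DefC P) (h' : DefC Q) : DefC fun e c => P e c ∨ Q e c :=
  (h.not.and h'.not).not.congr fun e c => by tauto

theorem imp (h : DefC P) (h' : DefC Q) : DefC fun e c => P e c → Q e c :=
  (h.and h'.not).not.congr fun e c => by tauto

/-- A proposition that does not depend on the words is either true or false once and for all, so a
tautology or a contradiction expresses it. This covers all facts about the fixed setting and the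
fixed query. -/
theorem prop [Nonempty ι] (p : Prop) :
    DefC fun (_ : ι → List (Ltr T)) (_ : κ → Const) => p := by
  have h : DefC fun (e : ι → List (Ltr T)) (_ : κ → Const) =>
      e (Classical.arbitrary ι) = [] := ofDef (Def.empty (.inl _))
  by_cases hp : p
  · exact (h.or h.not).congr fun e c => by simp [hp, em]
  · exact (h.and h.not).congr fun e c => by simp [hp]

theorem reindex {ι' κ' : Type} (h : DefC P) (f : ι → ι') (g : κ → κ') :
    DefC fun (e : ι' → List (Ltr T)) (c : κ' → Const) => P (fun i => e (f i)) fun k => c (g k) := by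
  obtain ⟨R, hR, h⟩ := h
  refine ⟨_, hR.reindex (Sum.map f g), fun e c => ?_⟩
  refine Iff.trans ?_ (h _ _)
  have : (fun i => (Sum.elim e fun k => enc (c k)) (Sum.map f g i)) =
      Sum.elim (fun i => e (f i)) fun k => enc (c (g k)) := by
    funext i
    rcases i with i | i <;> rfl
  rw [this]

theorem finset_forall [Nonempty ι] {β : Type*} (s : Finset β)
    {P : β → (ι → List (Ltr T)) → (κ → Const) → Prop} (h : ∀ b ∈ s, DefC (P b)) :
    DefC fun e c => ∀ b ∈ s, P b e c := by
  classical
  induction s using Finset.induction_on with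
  | empty => exact (prop True).congr fun e c => by simp
  | insert b s _ ih =>
    exact ((h b (by simp)).and (ih fun b hb => h b (by simp [hb]))).congr fun e c => by simp

theorem list_forall [Nonempty ι] {β : Type*} (s : List β)
    {P : β → (ι → List (Ltr T)) → (κ → Const) → Prop} (h : ∀ b ∈ s, DefC (P b)) :
    DefC fun e c => ∀ b ∈ s, P b e c := by
  classical
  exact (finset_forall s.toFinset fun b hb => h b (by simpa using hb)).congr fun e c => by simp

theorem list_exists [Nonempty ι] {β : Type*} (s : List β)
    {P : β → (ι → List (Ltr T)) → (κ → Const) → Prop} (h : ∀ b ∈ s, DefC (P b)) :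
    DefC fun e c => ∃ b ∈ s, P b e c :=
  (list_forall s fun b hb => (h b hb).not).not.congr fun e c => by simp

theorem fintype_forall [Nonempty ι] {β : Type*} [Finite β]
    {P : β → (ι → List (Ltr T)) → (κ → Const) → Prop} (h : ∀ b, DefC (P b)) :
    DefC fun e c => ∀ b, P b e c := by
  have := Fintype.ofFinite β
  exact (finset_forall Finset.univ fun b _ => h b).congr fun e c => by simp

theorem fintype_exists [Nonempty ι] {β : Type*} [Finite β]
    {P : β → (ι → List (Ltr T)) → (κ → Const) → Prop} (h : ∀ b, DefC (P b)) :
    DefC fun e c => ∃ b, P b e c :=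
  (fintype_forall fun b => (h b).not).not.congr fun e c => by simp

theorem exists_split {P : (ι → List (Ltr T)) → (κ → Const) → List (Ltr T) → List (Ltr T) → Prop}
    (j : ι) (h : DefC fun (e : Option (Option ι) → List (Ltr T)) c =>
      P (fun i => e (some (some i))) c (e (some none)) (e none)) :
    DefC fun e c => ∃ u v, e j = u ++ v ∧ P e c u v := by
  obtain ⟨Q, hQ, h⟩ := h
  let f : Option (Option ι) ⊕ κ → Option (Option (ι ⊕ κ)) :=
    Sum.elim (Option.map (Option.map .inl)) fun k => some (some (.inr k))
  refine ⟨fun e => ∃ u v, e (.inl j) = u ++ v ∧ Q fun i =>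
    (fun k => Option.elim k v fun k => Option.elim k u e) (f i), ?_, fun e c => ?_⟩
  · refine Def.exists_split (.inl j) ((hQ.reindex f).congr fun e => ?_)
    have : (fun i => e (f i)) = fun i => (fun k => Option.elim k (e none) fun k =>
        Option.elim k (e (some none)) fun i => e (some (some i))) (f i) := by
      funext i
      rcases f i with _ | _ | _ <;> rfl
    rw [this]
  · refine exists_congr fun u => exists_congr fun v => and_congr_right fun _ => ?_
    refine Iff.trans ?_ (h (fun k => Option.elim k v fun k => Option.elim k u e) c)
    have : (fun i => (fun k => Option.elim k v fun k => Option.elim k u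
        (Sum.elim e fun k => enc (c k))) (f i)) =
        Sum.elim (fun k => Option.elim k v fun k => Option.elim k u e) fun k => enc (c k) := by
      funext i
      rcases i with (_ | _ | i) | i <;> rfl
    rw [this]

/-- Only constants whose encoding is a factor of one of the two words are considered. This is
quantification over factors, restricted to the definable set of bit words. -/
theorem exists_const [Finite T] {P : (ι → List (Ltr T)) → (κ → Const) → Const → Prop} (i j : ι)
    (h : DefC fun (e : ι → List (Ltr T)) (c : Option κ → Const) =>
      P e (fun k => c (some k)) (c none)) :
    DefC fun e c => ∃ a, Dom (e i) (e j) a ∧ P e c a := by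
  obtain ⟨Q, hQ, h⟩ := h
  let f : ι ⊕ Option κ → Option (ι ⊕ κ) := Sum.elim (fun i => some (.inl i)) (Option.map .inr)
  let R : (ι ⊕ κ → List (Ltr T)) → List (Ltr T) → Prop := fun e u =>
    (∃ a : Const, u = enc a) ∧ Q fun i => (fun k => Option.elim k u e) (f i)
  have hR : Def fun e : Option (ι ⊕ κ) → List (Ltr T) => R (fun i => e (some i)) (e none) := by
    refine (Def.exists_eq_enc none).and ((hQ.reindex f).congr fun e => ?_)
    have : (fun i => e (f i)) = fun i => (fun k => Option.elim k (e none)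
        fun i => e (some i)) (f i) := by
      funext i
      rcases f i with _ | _ <;> rfl
    rw [this]
  refine ⟨_, (Def.exists_infix (.inl i) hR).or (Def.exists_infix (.inl j) hR), fun e c => ?_⟩
  have key : ∀ a, R (Sum.elim e fun k => enc (c k)) (enc a) ↔ P e c a := by
    intro a
    refine Iff.trans ?_ (h e fun k => Option.elim k a c)
    have : (fun i => (fun k => Option.elim k (enc a) (Sum.elim e fun k => enc (c k))) (f i)) =
        Sum.elim e fun k : Option κ => enc (Option.elim k a c) := by
      funext i
      rcases i with i | _ | i <;> rfl
    simp only [R, this]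
    exact ⟨fun h => h.2, fun h => ⟨⟨a, rfl⟩, h⟩⟩
  constructor
  · rintro (⟨u, hu, hR⟩ | ⟨u, hu, hR⟩)
    · obtain ⟨a, rfl⟩ := hR.1
      exact ⟨a, .inl hu, (key a).1 hR⟩
    · obtain ⟨a, rfl⟩ := hR.1
      exact ⟨a, .inr hu, (key a).1 hR⟩
  · rintro ⟨a, ha | ha, hP⟩
    · exact .inl ⟨_, ha, (key a).2 hP⟩
    · exact .inr ⟨_, ha, (key a).2 hP⟩

theorem eq (k l : κ) : DefC fun (_ : ι → List (Ltr T)) (c : κ → Const) => c k = c l :=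
  (ofDef (P := fun e : ι ⊕ κ → List (Ltr T) => e (Sum.inr k) = e (Sum.inr l)) (Def.eq (Sum.inr k) (Sum.inr l))).congr fun _ _ =>
    (enc_injective (T := T)).eq_iff

theorem eq_const (k : κ) (a : Const) :
    DefC fun (_ : ι → List (Ltr T)) (c : κ → Const) => c k = a :=
  (ofDef (P := fun e : ι ⊕ κ → List (Ltr T) => e (Sum.inr k) = enc a) (Def.eq_word (Sum.inr k) (enc a))).congr fun _ _ =>
    (enc_injective (T := T)).eq_iff

/-- An assignment is an infinite object; fixing the value `[]` outside the finite list `vs` turns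
the quantifier into finitely many quantifiers over constants. -/
theorem exists_assign [Finite T]
    {P : (ι → List (Ltr T)) → (κ → Const) → (Var → Const) → Prop} (i j : ι)
    (vs : List Var) (h : DefC fun (e : ι → List (Ltr T)) (c : κ ⊕ Var → Const) =>
      P e (fun k => c (.inl k)) fun v => c (.inr v)) :
    DefC fun e c => ∃ ν : Var → Const, (∀ v, Dom (e i) (e j) (ν v)) ∧ (∀ v ∉ vs, ν v = []) ∧
      P e c ν := by
  -- For the induction on `vs`, the values outside the list are taken from parameters, so that one
  -- variable at a time can be moved from the parameters to the quantified part.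
  have aux : DefC fun (e : ι → List (Ltr T)) (c : κ ⊕ Var → Const) =>
      ∃ ν : Var → Const, (∀ v ∈ vs, Dom (e i) (e j) (ν v)) ∧ (∀ v ∉ vs, ν v = c (.inr v)) ∧
        P e (fun k => c (.inl k)) ν := by
    induction vs with
    | nil =>
      refine h.congr fun e c => ?_
      constructor
      · exact fun h => ⟨_, by simp, by simp, h⟩
      · rintro ⟨ν, -, hν, h⟩
        obtain rfl : ν = fun v => c (.inr v) := funext fun v => hν v (by simp)
        exact h
    | cons v vs ih =>
      have h1 := ih.reindex id (Sum.elim (fun k => some (.inl k))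
        fun v' => if v' = v then none else some (.inr v') : κ ⊕ Var → Option (κ ⊕ Var))
      refine (exists_const (P := fun e (c : κ ⊕ Var → Const) a => ∃ ν : Var → Const,
        (∀ v ∈ vs, Dom (e i) (e j) (ν v)) ∧ (∀ v' ∉ vs, ν v' = if v' = v then a else c (.inr v')) ∧
        P e (fun k => c (.inl k)) ν) i j (h1.congr fun e c => ?_)).congr fun e c => ?_
      · refine exists_congr fun ν => and_congr_right fun _ => and_congr_left fun _ => ?_
        refine forall_congr' fun v' => imp_congr_right fun _ => ?_
        simp only [Sum.elim_inr]
        split_ifs <;> rfl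
      · constructor
        · rintro ⟨a, ha, ν, h1, h2, h3⟩
          refine ⟨ν, fun v' hv' => ?_, fun v' hv' => ?_, h3⟩
          · by_cases hv : v' ∈ vs
            · exact h1 v' hv
            · obtain rfl : v' = v := by simpa [hv] using hv'
              rw [h2 _ hv, if_pos rfl]
              exact ha
          · simp only [List.mem_cons, not_or] at hv'
            rw [h2 v' hv'.2, if_neg hv'.1]
        · rintro ⟨ν, h1, h2, h3⟩
          refine ⟨ν v, h1 v (by simp), ν, fun v' hv' => h1 v' (by simp [hv']), fun v' hv' => ?_, h3⟩
          split_ifs with hv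
          · rw [hv]
          · exact h2 v' (by simp [hv, hv'])
  -- All parameters are now identified with a single constant, which is then required to be `[]`;
  -- this constant lies in every domain because the empty word is a factor of every word.
  have h2 := aux.reindex id (Sum.elim some fun _ => none : κ ⊕ Var → Option κ)
  refine (exists_const (P := fun e (c : κ → Const) a => a = [] ∧ ∃ ν : Var → Const,
    (∀ v ∈ vs, Dom (e i) (e j) (ν v)) ∧ (∀ v ∉ vs, ν v = a) ∧ P e c ν) i j
    ((eq_const none []).and h2)).congr fun e c => ?_
  have hd : Dom (e i) (e j) [] := .inl List.nil_infix
  constructor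
  · rintro ⟨_, _, rfl, ν, h1, h2, h3⟩
    refine ⟨ν, fun v => ?_, h2, h3⟩
    by_cases hv : v ∈ vs
    · exact h1 v hv
    · rw [h2 v hv]
      exact hd
  · rintro ⟨ν, h1, h2, h3⟩
    exact ⟨[], hd, rfl, ν, fun v _ => h1 v, h2, h3⟩

theorem forall_assign [Finite T]
    {P : (ι → List (Ltr T)) → (κ → Const) → (Var → Const) → Prop} (i j : ι)
    (vs : List Var) (h : DefC fun (e : ι → List (Ltr T)) (c : κ ⊕ Var → Const) =>
      P e (fun k => c (.inl k)) fun v => c (.inr v)) :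
    DefC fun e c => ∀ ν : Var → Const, (∀ v, Dom (e i) (e j) (ν v)) → (∀ v ∉ vs, ν v = []) →
      P e c ν :=
  (exists_assign (P := fun e c ν => ¬ P e c ν) i j vs h.not).not.congr fun e c => by simp

end DefC

/-! ### Ground dependencies -/

theorem HomInto.congr {ν ν' : Var → Value} {A : List (Atom Term)} {K : Inst}
    (h : HomInto ν A K) (hν : ∀ v ∈ varsOf A, ν v = ν' v) : HomInto ν' A K := by
  intro a ha
  have : a.map (Term.eval ν') = a.map (Term.eval ν) := by
    unfold Atom.map
    congr 1
    funext i
    cases hi : a.args i with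
    | const c => rfl
    | var v => exact (hν v ⟨a, ha, i, hi⟩).symm
  rw [this]
  exact h a ha

theorem HomInto.mono {ν : Var → Value} {A : List (Atom Term)} {K K' : Inst}
    (h : HomInto ν A K) (hK : K ⊆ K') : HomInto ν A K' := fun a ha => hK (h a ha)

theorem homInto_ground (ν : Var → Const) (ν' : Var → Value) (A : List (Atom Term)) (K : Inst) :
    HomInto ν' (A.map (Atom.map (TGD.groundTerm ν))) K ↔ HomInto (constVal ν) A K := by
  have : ∀ a : Atom Term, (a.map (TGD.groundTerm ν)).map (Term.eval ν') =
      a.map (Term.eval (constVal ν)) := by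
    intro a
    unfold Atom.map
    congr 1
    funext i
    dsimp only
    cases a.args i <;> rfl
  simp [HomInto, this]

/-- A ground TGD has no variables, so the assignments in the definition of satisfaction play no
role. -/
theorem sat_ground (ρ : TGD) (ν : Var → Const) (K : Inst) :
    (ρ.ground ν).Sat K ↔
      (HomInto (constVal ν) ρ.body K → HomInto (constVal ν) ρ.head K) := by
  simp only [TGD.Sat, TGD.ground, homInto_ground]
  exact ⟨fun h hb => (h (constVal ν) hb).elim fun _ h => h.2,
    fun h ν' hb => ⟨ν', fun _ _ => rfl, h hb⟩⟩

theorem EGD.Sat.anti {η : EGD} {K K' : Inst} (h : η.Sat K') (hK : K ⊆ K') : η.Sat K :=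
  fun ν hν => h ν (hν.mono hK)

/-- A violated EGD stays violated when facts are added. -/
theorem SatEGDs.anti {S : Setting} {K K' : Inst} (h : SatEGDs S K') (hK : K ⊆ K') :
    SatEGDs S K := fun η hη => (h η hη).anti hK

theorem HomInto.inter_over {ν : Var → Value} {A : List (Atom Term)} {I J : Inst} {S S' : Schema}
    (h : HomInto ν A (I ∪ J)) (hI : I.Over S) (hA : ∀ a ∈ A, a.rel ∈ S') (hd : Disjoint S S') :
    HomInto ν A J := by
  intro a ha
  rcases Finset.mem_union.1 (h a ha) with h | h
  · exact absurd (hA a ha) (Finset.disjoint_left.1 hd (hI _ h))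
  · exact h

namespace Setting

variable {S : Setting}

theorem body_of_mem_tTGDs {ρ : TGD} (h : ρ ∈ S.tTGDs) : ∀ a ∈ ρ.body, a.rel ∈ S.trg :=
  (S.t_over _ h).1

theorem head_of_mem {ρ : TGD} (h : ρ ∈ S.allTGDs) : ∀ a ∈ ρ.head, a.rel ∈ S.trg := by
  rcases h with h | h
  · exact S.st_head ρ h
  · exact (S.t_over _ h).2

end Setting

variable {S : Setting} {I J : Inst}

theorem satEGDs_union (hI : I.Over S.src) : SatEGDs S (I ∪ J) ↔ SatEGDs S J :=
  ⟨fun h => h.anti Finset.subset_union_right,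
    fun h η hη ν hν => h η hη ν (hν.inter_over hI (S.t_over _ hη) S.disjoint)⟩

/-- The schemas are disjoint: source facts can match neither the heads nor the bodies of target
dependencies. Both kinds of TGDs can therefore be treated alike, with bodies in `I ∪ J` and heads in
`J`. -/
theorem satChoice_iff {γ : ExChoice} (hI : I.Over S.src) :
    SatChoice S γ I J ↔ (∀ ρ ∈ S.allTGDs, ∀ ν, Coherent γ ρ ν →
      HomInto (constVal ν) ρ.body (I ∪ J) → HomInto (constVal ν) ρ.head J) ∧ SatEGDs S J := by
  constructor
  · rintro ⟨h1, h2⟩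
    refine ⟨?_, fun η hη => h2 _ (.inl ⟨η, hη, rfl⟩)⟩
    rintro ρ (hρ | hρ) ν hν hb
    · have := h1 _ (.inr ⟨ρ, ⟨ρ, hρ, rfl⟩, ν, hν, rfl⟩)
      exact ((sat_ground ρ ν _).1 this hb).inter_over hI (S.st_head ρ hρ) S.disjoint
    · have := h2 _ (.inr ⟨ρ, hρ, ν, hν, rfl⟩)
      exact (sat_ground ρ ν _).1 this
        (hb.inter_over hI (Setting.body_of_mem_tTGDs hρ) S.disjoint)
  · rintro ⟨h1, h2⟩
    constructor
    · rintro d (⟨η, ⟨ρ, _, h⟩, _⟩ | ⟨ρ, ⟨ρ', hρ, h⟩, ν, hν, rfl⟩)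
      · cases h
      · cases h
        exact (sat_ground ρ ν _).2 fun hb =>
          (h1 ρ (.inl hρ) ν hν hb).mono Finset.subset_union_right
    · rintro d (⟨η, hη, rfl⟩ | ⟨ρ, hρ, ν, hν, rfl⟩)
      · exact h2 η hη
      · exact (sat_ground ρ ν _).2 fun hb =>
          h1 ρ (.inr hρ) ν hν (hb.mono Finset.subset_union_right)

/-! ### Derivations -/

/-- The facts that a TGD adds. -/
def headFacts (ρ : TGD) (ν : Var → Const) : Inst :=
  (ρ.head.map (Atom.map (Term.eval (constVal ν)))).toFinset

theorem headFacts_subset {ρ : TGD} {ν : Var → Const} :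
    headFacts ρ ν ⊆ J ↔ HomInto (constVal ν) ρ.head J := by
  simp [headFacts, HomInto, Finset.subset_iff]

theorem mem_headFacts {ρ : TGD} {ν : Var → Const} {b : Fact} :
    b ∈ headFacts ρ ν ↔ ∃ a ∈ ρ.head, a.map (Term.eval (constVal ν)) = b := by
  simp [headFacts]

theorem rel_of_mem_headFacts {ρ : TGD} (hρ : ρ ∈ S.allTGDs) {ν : Var → Const} {b : Fact}
    (h : b ∈ headFacts ρ ν) : b.rel ∈ S.trg := by
  obtain ⟨a, ha, rfl⟩ := mem_headFacts.1 h
  exact Setting.head_of_mem hρ a ha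

/-- The head of a TGD only depends on the values of the frontier and the existential variables. -/
theorem HomInto.head_congr {ρ : TGD} {ν ν' : Var → Const} (h : HomInto (constVal ν) ρ.head J)
    (hf : ∀ v ∈ ρ.frontier, ν v = ν' v) (he : ∀ v ∈ ρ.exvars, ν v = ν' v) :
    HomInto (constVal ν') ρ.head J := by
  refine h.congr fun v hv => congrArg Value.const ?_
  by_cases hb : v ∈ varsOf ρ.body
  · exact hf v ⟨hb, hv⟩
  · exact he v ⟨hv, hb⟩

/-- A set of steps, graded such that the body of each step is derived by steps of smaller grade,
that is functional, saturated and consistent with the EGDs yields a supported solution. -/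
theorem supportedSolution_of_steps (hI : I.Over S.src) (St : ℕ → TGD → (Var → Const) → Prop)
    (h_mem : ∀ n ρ ν, St n ρ ν → ρ ∈ S.allTGDs)
    (h_body : ∀ n ρ ν, St n ρ ν → ∀ a ∈ ρ.body, a.map (Term.eval (constVal ν)) ∈ I ∨
      ∃ m < n, ∃ ρ' ν', St m ρ' ν' ∧ a.map (Term.eval (constVal ν)) ∈ headFacts ρ' ν')
    (h_fun : ∀ n m ρ ν ν', St n ρ ν → St m ρ ν' → (∀ v ∈ ρ.frontier, ν v = ν' v) →
      ∀ v ∈ ρ.exvars, ν v = ν' v)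
    (h_sat : ∀ ρ ∈ S.allTGDs, ∀ ν, HomInto (constVal ν) ρ.body (I ∪ J) →
      ∃ n ν', St n ρ ν' ∧ ∀ v ∈ ρ.frontier, ν v = ν' v)
    (hJ : ∀ b, b ∈ J ↔ ∃ n ρ ν, St n ρ ν ∧ b ∈ headFacts ρ ν)
    (h_egd : SatEGDs S J) : SupportedSolution S I J := by
  classical
  -- The ex-choice repeats the values of some step with the given frontier tuple; where there is
  -- none, `[]` is an irrelevant default. By `h_fun` the step selected does not matter.
  let γ : ExChoice := fun ρ y z =>
    if h : ∃ n ν, St n ρ ν ∧ ∀ v : ρ.frontier, ν v = y v then h.choose_spec.choose z else []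
  have hγ : ∀ n ρ ν, St n ρ ν → Coherent γ ρ ν := by
    intro n ρ ν hν z
    have h : ∃ n ν', St n ρ ν' ∧ ∀ v : ρ.frontier, ν' v = ν v := ⟨n, ν, hν, fun _ => rfl⟩
    have h' := h.choose_spec.choose_spec
    simp only [γ]
    rw [dif_pos h]
    exact h_fun _ _ ρ _ _ hν h'.1 (fun v hv => (h'.2 ⟨v, hv⟩).symm) z z.2
  refine ⟨fun b hb => ?_, γ, (satChoice_iff hI).2 ⟨fun ρ hρ ν hν hb => ?_, h_egd⟩, ?_⟩
  · obtain ⟨n, ρ, ν, hν, hb⟩ := (hJ b).1 hb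
    exact rel_of_mem_headFacts (h_mem _ _ _ hν) hb
  · obtain ⟨n, ν', hν', hf⟩ := h_sat ρ hρ ν hb
    have h1 : HomInto (constVal ν') ρ.head J :=
      headFacts_subset.1 fun b hb => (hJ b).2 ⟨n, ρ, ν', hν', hb⟩
    refine h1.head_congr (fun v hv => (hf v hv).symm) fun v hv => ?_
    rw [hγ _ _ _ hν' ⟨v, hv⟩, hν ⟨v, hv⟩]
    have : (fun y : ρ.frontier => ν' y) = fun y : ρ.frontier => ν y :=
      funext fun y => (hf y y.2).symm
    rw [this]
  · rintro ⟨J', -, hJ', hsat⟩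
    rw [satChoice_iff hI] at hsat
    refine hJ'.2 fun b hb => ?_
    -- Minimality: by induction on the grade, any `J'` that satisfies the ground dependencies has
    -- the body of each step, hence also its head.
    have main : ∀ n ρ ν, St n ρ ν → headFacts ρ ν ⊆ J' := by
      intro n
      induction n using Nat.strong_induction_on with
      | _ n ih =>
        intro ρ ν hν
        refine headFacts_subset.2 (hsat.1 ρ (h_mem _ _ _ hν) ν (hγ _ _ _ hν) fun a ha => ?_)
        rcases h_body n ρ ν hν a ha with h | ⟨m, hm, ρ', ν', h, h'⟩
        · exact Finset.mem_union_left _ h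
        · exact Finset.mem_union_right _ (ih m hm ρ' ν' h h')
    obtain ⟨n, ρ, ν, hν, hb⟩ := (hJ b).1 hb
    exact main n ρ ν hν hb

/-- A chase step: a TGD and an assignment for its variables. -/
abbrev Step : Type := TGD × (Var → Const)

/-- The TGD and the frontier tuple that are marked by a chase step. -/
def Step.mark (x : Step) : (ρ : TGD) × (ρ.frontier → Const) := ⟨x.1, fun y => x.2 y⟩

theorem Step.mark_eq {ρ : TGD} {ν ν' : Var → Const} :
    Step.mark (ρ, ν) = Step.mark (ρ, ν') ↔ ∀ v ∈ ρ.frontier, ν v = ν' v := by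
  simp [Step.mark, funext_iff]

/-- The instance obtained from `I` by a sequence of chase steps, the last step first. -/
def chaseInst (I : Inst) : List Step → Inst
  | [] => I
  | x :: L => chaseInst I L ∪ headFacts x.1 x.2

theorem mem_chaseInst {L : List Step} {b : Fact} :
    b ∈ chaseInst I L ↔ b ∈ I ∨ ∃ x ∈ L, b ∈ headFacts x.1 x.2 := by
  induction L with
  | nil => simp [chaseInst]
  | cons x L ih =>
    simp only [chaseInst, Finset.mem_union, ih, List.exists_mem_cons_iff, or_assoc]
    exact or_congr_right or_comm

/-- A sequence of chase steps on `I`, the last step first. -/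
inductive Derivation (S : Setting) (I : Inst) : List Step → Prop
  | nil : Derivation S I []
  | cons {x L} (h : Derivation S I L) (hρ : x.1 ∈ S.allTGDs)
      (hb : HomInto (constVal x.2) x.1.body (chaseInst I L)) (hm : x.mark ∉ L.map Step.mark) :
      Derivation S I (x :: L)

/-- The state of the chase after a sequence of steps. -/
def chaseState (I : Inst) (L : List Step) : ChaseState := ⟨chaseInst I L, {m | m ∈ L.map Step.mark}⟩

/-- Derivations drop the EGD tests and the states, and keep only the list of steps; all counting is
done on these lists. -/
theorem ChaseRun.exists_derivation {n : ℕ} {s : ChaseState} (h : ChaseRun S I n s) :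
    ∃ L, Derivation S I L ∧ L.length = n ∧ s = chaseState I L := by
  induction h with
  | start => exact ⟨[], .nil, rfl, by simp [chaseState, chaseInst]⟩
  | @step n s s' _ hs ih =>
    obtain ⟨L, hL, hn, rfl⟩ := ih
    obtain ⟨-, ρ, ν, ⟨hρ, hb, hm⟩, h1, h2⟩ := hs
    refine ⟨(ρ, ν) :: L, .cons hL hρ hb hm, by simp [hn], ?_⟩
    cases s'
    simp only at h1 h2
    subst h1 h2
    simp only [chaseState, chaseInst, headFacts, ChaseState.mk.injEq, true_and]
    ext m
    simp [Step.mark]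

/-- A chase step is allowed only when the EGDs hold. As they hold in the last instance, they hold in
all the smaller ones before it. -/
theorem Derivation.chaseRun {L : List Step} (h : Derivation S I L)
    (hE : SatEGDs S (chaseInst I L)) : ChaseRun S I L.length (chaseState I L) := by
  induction h with
  | nil =>
    have : chaseState I [] = ⟨I, ∅⟩ := by simp [chaseState, chaseInst]
    rw [this]
    exact .start
  | @cons x L _ hρ hb hm ih =>
    have hE' := hE.anti (K := chaseInst I L) Finset.subset_union_left
    refine .step (ih hE') ⟨hE', x.1, x.2, ⟨hρ, hb, hm⟩, rfl, ?_⟩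
    ext m
    simp [chaseState, Step.mark]

theorem Derivation.mem_allTGDs {L : List Step} (h : Derivation S I L) :
    ∀ x ∈ L, x.1 ∈ S.allTGDs := by
  induction h with
  | nil => simp
  | cons _ hρ _ _ ih => simpa using ⟨hρ, fun a b => ih (a, b)⟩

theorem Derivation.nodup {L : List Step} (h : Derivation S I L) : (L.map Step.mark).Nodup := by
  induction h with
  | nil => simp
  | cons _ _ _ hm ih => exact List.nodup_cons.2 ⟨hm, ih⟩

theorem Derivation.body {L : List Step} (h : Derivation S I L) {L₁ L₂ : List Step} {x : Step}
    (hL : L = L₁ ++ x :: L₂) : HomInto (constVal x.2) x.1.body (chaseInst I L₂) := by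
  induction h generalizing L₁ with
  | nil => simp at hL
  | cons _ _ hb _ ih =>
    cases L₁ with
    | nil =>
      obtain ⟨rfl, rfl⟩ := by simpa using hL
      exact hb
    | cons y L₁ =>
      obtain ⟨rfl, rfl⟩ := by simpa using hL
      exact ih rfl

/-- The steps are graded by the number of steps before them. Marks are distinct, which makes the
guesses functional, and the absence of triggers gives saturation. -/
theorem supportedSolution_of_chaseProduces (hI : S.IsSource I) (h : ChaseProduces S I J) :
    SupportedSolution S I J := by
  obtain ⟨n, s, hrun, hE, hT, rfl⟩ := h
  obtain ⟨L, hL, -, rfl⟩ := hrun.exists_derivation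
  have hJ : ∀ b, b ∈ (chaseState I L).inst.filter (fun a => a.rel ∉ S.src) ↔
      ∃ x ∈ L, b ∈ headFacts x.1 x.2 := by
    intro b
    rw [Finset.mem_filter]
    refine Iff.trans (and_congr_left fun _ => mem_chaseInst) ?_
    constructor
    · rintro ⟨h | h, hb⟩
      · exact absurd (hI.1 b h) hb
      · exact h
    · rintro ⟨x, hx, hb⟩
      exact ⟨.inr ⟨x, hx, hb⟩, Finset.disjoint_right.1 S.disjoint
        (rel_of_mem_headFacts (hL.mem_allTGDs x hx) hb)⟩
  refine supportedSolution_of_steps hI.1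
    (fun n ρ ν => ∃ L₁ L₂, L = L₁ ++ (ρ, ν) :: L₂ ∧ L₂.length = n) ?_ ?_ ?_ ?_ ?_ ?_
  · rintro n ρ ν ⟨L₁, L₂, rfl, -⟩
    exact hL.mem_allTGDs (ρ, ν) (by simp)
  · rintro n ρ ν ⟨L₁, L₂, h, rfl⟩ a ha
    rcases mem_chaseInst.1 (hL.body h a ha) with h' | ⟨⟨ρ', ν'⟩, hx, h'⟩
    · exact .inl h'
    · obtain ⟨L₃, L₄, rfl⟩ := List.append_of_mem hx
      exact .inr ⟨L₄.length, by simp; omega, ρ', ν',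
        ⟨L₁ ++ (ρ, ν) :: L₃, L₄, by simp [h], rfl⟩, h'⟩
  · rintro n m ρ ν ν' ⟨L₁, L₂, h, -⟩ ⟨L₃, L₄, h', -⟩ hf v _
    have h1 : (ρ, ν) ∈ L := by simp [h]
    have h2 : (ρ, ν') ∈ L := by simp [h']
    have := List.inj_on_of_nodup_map hL.nodup h1 h2 (Step.mark_eq.2 hf)
    simp only [Prod.mk.injEq, true_and] at this
    rw [this]
  · intro ρ hρ ν hb
    by_contra hcon
    refine hT ⟨ρ, ν, hρ, hb.mono ?_, fun hm => hcon ?_⟩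
    · refine Finset.union_subset (fun b hb => mem_chaseInst.2 (.inl hb)) (Finset.filter_subset _ _)
    · obtain ⟨⟨ρ', ν'⟩, hx, h⟩ := List.mem_map.1 hm
      obtain rfl : ρ' = ρ := congrArg Sigma.fst h
      obtain ⟨L₁, L₂, rfl⟩ := List.append_of_mem hx
      exact ⟨L₂.length, ν', ⟨L₁, L₂, rfl, rfl⟩, Step.mark_eq.1 h.symm⟩
  · intro b
    rw [hJ]
    constructor
    · rintro ⟨⟨ρ, ν⟩, hx, hb⟩
      obtain ⟨L₁, L₂, rfl⟩ := List.append_of_mem hx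
      exact ⟨_, ρ, ν, ⟨L₁, L₂, rfl, rfl⟩, hb⟩
    · rintro ⟨n, ρ, ν, ⟨L₁, L₂, rfl, -⟩, hb⟩
      exact ⟨(ρ, ν), by simp, hb⟩
  · exact hE.anti (Finset.filter_subset _ _)

/-- If the derivations on `I` are bounded in length, then every supported solution is produced by
the chase, with a derivation. -/
theorem SupportedSolution.exists_derivation (hI : S.IsSource I) {N : ℕ}
    (hN : ∀ L, Derivation S I L → L.length ≤ N) (h : SupportedSolution S I J) :
    ∃ L, Derivation S I L ∧ SatEGDs S (chaseInst I L) ∧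
      (¬ ∃ (ρ : TGD) (ν : Var → Const), Trigger S (chaseState I L) ρ ν) ∧
      chaseInst I L = I ∪ J := by
  classical
  obtain ⟨hJ, γ, hsat, hmin⟩ := h
  have hsat' := (satChoice_iff hI.1).1 hsat
  -- The lengths of derivations that guess according to `γ` and add only facts of `J`. The empty
  -- derivation is one of them and `N` bounds them all, so a longest one exists.
  let P : ℕ → Prop := fun n => ∃ L : List Step, Derivation S I L ∧
    (∀ x ∈ L, Coherent γ x.1 x.2 ∧ headFacts x.1 x.2 ⊆ J) ∧ L.length = n
  have hP : P (Nat.findGreatest P N) :=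
    Nat.findGreatest_spec (Nat.zero_le N) ⟨[], .nil, by simp, rfl⟩
  obtain ⟨L, hL, hγ, hlen⟩ := hP
  have hsub : chaseInst I L ⊆ I ∪ J := by
    intro b hb
    rcases mem_chaseInst.1 hb with h | ⟨x, hx, h⟩
    · exact Finset.mem_union_left _ h
    · exact Finset.mem_union_right _ ((hγ x hx).2 h)
  have hE : SatEGDs S (chaseInst I L) := ((satEGDs_union hI.1).2 hsat'.2).anti hsub
  have hT : ¬ ∃ (ρ : TGD) (ν : Var → Const), Trigger S (chaseState I L) ρ ν := by
    rintro ⟨ρ, ν, hρ, hb, hm⟩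
    -- A remaining trigger is redirected to the values prescribed by `γ`. The existential variables
    -- do not occur in the body, so the trigger and its mark are unaffected; the resulting step
    -- contradicts maximality.
    let ν' : Var → Const := fun v => if h : v ∈ ρ.exvars then γ ρ (fun y => ν y) ⟨v, h⟩ else ν v
    have hbody : ∀ v ∈ varsOf ρ.body, ν' v = ν v := fun v hv => dif_neg fun h => h.2 hv
    have hfr : (fun y : ρ.frontier => ν' y) = fun y : ρ.frontier => ν y :=
      funext fun y => hbody y y.2.1
    have hco : Coherent γ ρ ν' := fun z => by
      rw [hfr]
      exact dif_pos z.2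
    have hb' : HomInto (constVal ν') ρ.body (chaseInst I L) :=
      hb.congr fun v hv => congrArg Value.const (hbody v hv).symm
    have hm' : Step.mark (ρ, ν') = Step.mark (ρ, ν) := Step.mark_eq.2 fun v hv => hbody v hv.1
    have hd : Derivation S I ((ρ, ν') :: L) := .cons hL hρ hb' (by rw [hm']; exact hm)
    have : P (L.length + 1) := by
      refine ⟨_, hd, ?_, rfl⟩
      intro x hx
      rcases List.mem_cons.1 hx with rfl | hx
      · exact ⟨hco, headFacts_subset.2 (hsat'.1 ρ hρ ν' hco (hb'.mono hsub))⟩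
      · exact hγ x hx
    have := Nat.le_findGreatest (by simpa using hN _ hd) this
    rw [← hlen] at this
    omega
  refine ⟨L, hL, hE, hT, hsub.antisymm ?_⟩
  -- The target part of the result is contained in `J` and satisfies the same ground dependencies,
  -- because each coherent ground body it contains has already been marked by a step coherent with
  -- `γ`. Minimality of `J` forces equality.
  let J₀ := (chaseInst I L).filter fun a => a.rel ∉ S.src
  have hJ₀J : J₀ ⊆ J := by
    intro b hb
    obtain ⟨h, h'⟩ := Finset.mem_filter.1 hb
    rcases Finset.mem_union.1 (hsub h) with h | h
    · exact absurd (hI.1 b h) h'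
    · exact h
  have hI₀ : I ∪ J₀ ⊆ chaseInst I L :=
    Finset.union_subset (fun b hb => mem_chaseInst.2 (.inl hb)) (Finset.filter_subset _ _)
  have hsat₀ : SatChoice S γ I J₀ := by
    refine (satChoice_iff hI.1).2 ⟨fun ρ hρ ν hν hb => ?_, hsat'.2.anti hJ₀J⟩
    have hm : Step.mark (ρ, ν) ∈ L.map Step.mark := by
      by_contra hm
      exact hT ⟨ρ, ν, hρ, hb.mono hI₀, hm⟩
    obtain ⟨⟨ρ', ν'⟩, hx, h⟩ := List.mem_map.1 hm
    obtain rfl : ρ' = ρ := congrArg Sigma.fst h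
    have hf := Step.mark_eq.1 h
    have h1 : HomInto (constVal ν') ρ'.head J₀ := by
      refine headFacts_subset.1 fun b hb => Finset.mem_filter.2
        ⟨mem_chaseInst.2 (.inr ⟨_, hx, hb⟩), Finset.disjoint_right.1 S.disjoint
          (rel_of_mem_headFacts hρ hb)⟩
    refine h1.head_congr hf fun v hv => ?_
    have h2 := (hγ _ hx).1 ⟨v, hv⟩
    simp only at h2
    rw [h2, hν ⟨v, hv⟩]
    have : (fun y : ρ'.frontier => ν' y) = fun y : ρ'.frontier => ν y :=
      funext fun y => hf y y.2
    rw [this]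
  have hJ₀ : J₀ = J := by
    by_contra hne
    exact hmin ⟨J₀, fun b hb => hJ b (hJ₀J hb), hJ₀J.ssubset_of_ne hne, hsat₀⟩
  rw [← hJ₀]
  exact hI₀

theorem chaseProduces_iff (hI : S.IsSource I) {N : ℕ}
    (hN : ∀ L, Derivation S I L → L.length ≤ N) :
    ChaseProduces S I J ↔ SupportedSolution S I J := by
  refine ⟨supportedSolution_of_chaseProduces hI, fun h => ?_⟩
  obtain ⟨L, hL, hE, hT, heq⟩ := h.exists_derivation hI hN
  refine ⟨_, _, hL.chaseRun hE, hE, hT, ?_⟩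
  ext b
  simp only [chaseState, heq, Finset.mem_filter, Finset.mem_union]
  constructor
  · exact fun hb => ⟨.inr hb, Finset.disjoint_right.1 S.disjoint (h.1 b hb)⟩
  · rintro ⟨hb | hb, hb'⟩
    · exact absurd (hI.1 b hb) hb'
    · exact hb


/-! ### Finiteness -/

/-- The variables of a conjunction of atoms, as a list. -/
def varList (A : List (Atom Term)) : List Var :=
  A.flatMap fun a => (List.ofFn a.args).filterMap fun
    | .const _ => none
    | .var v => some v

theorem mem_varList {A : List (Atom Term)} {v : Var} : v ∈ varList A ↔ v ∈ varsOf A := by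
  simp only [varList, List.mem_flatMap, List.mem_filterMap, List.mem_ofFn, varsOf, Atom.vars,
    Set.mem_ofPred_eq]
  refine exists_congr fun a => and_congr_right fun _ => ?_
  constructor
  · rintro ⟨t, ⟨i, rfl⟩, h⟩
    refine ⟨i, ?_⟩
    cases hi : a.args i <;> simp_all
  · rintro ⟨i, hi⟩
    exact ⟨_, ⟨i, rfl⟩, by simp [hi]⟩

/-- The constants of a conjunction of atoms, as a list. -/
def constList (A : List (Atom Term)) : List Const :=
  A.flatMap fun a => (List.ofFn a.args).filterMap fun
    | .const c => some c
    | .var _ => none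

theorem mem_constList {A : List (Atom Term)} {c : Const} :
    c ∈ constList A ↔ ∃ a ∈ A, ∃ i, a.args i = .const c := by
  simp only [constList, List.mem_flatMap, List.mem_filterMap, List.mem_ofFn]
  refine exists_congr fun a => and_congr_right fun _ => ?_
  constructor
  · rintro ⟨t, ⟨i, rfl⟩, h⟩
    refine ⟨i, ?_⟩
    cases hi : a.args i <;> simp_all
  · rintro ⟨i, hi⟩
    exact ⟨_, ⟨i, rfl⟩, by simp [hi]⟩

theorem Setting.finite_allTGDs (S : Setting) : S.allTGDs.Finite := by
  have h : S.tTGDs.Finite :=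
    Set.Finite.preimage (f := Dependency.tgd) (fun _ _ _ _ h => by cases h; rfl)
      S.tDeps.finite_toSet
  exact S.stDeps.finite_toSet.union h

/-- All TGDs of a setting, as a finite set. -/
noncomputable def Setting.tgds (S : Setting) : Finset TGD := S.finite_allTGDs.toFinset

theorem Setting.mem_tgds {S : Setting} {ρ : TGD} : ρ ∈ S.tgds ↔ ρ ∈ S.allTGDs :=
  Set.Finite.mem_toFinset _

/-- The constants of an instance. -/
def Inst.consts (I : Inst) : Finset Const :=
  I.biUnion fun a => Finset.univ.biUnion fun i => match a.args i with
    | .const c => {c}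
    | .null _ => ∅

theorem Inst.mem_consts {I : Inst} {c : Const} : c ∈ I.consts ↔ Value.const c ∈ I.adom := by
  simp only [Inst.consts, Finset.mem_biUnion, Finset.mem_univ, true_and, Inst.adom,
    Set.mem_ofPred_eq]
  refine exists_congr fun a => and_congr_right fun _ => exists_congr fun i => ?_
  cases a.args i <;> simp [eq_comm]

theorem Inst.card_consts_le {I : Inst} {n : ℕ} (h : ∀ a ∈ I, a.rel.arity ≤ n) :
    I.consts.card ≤ I.card * n := by
  refine Finset.card_biUnion_le_card_mul _ _ _ fun a ha => ?_
  refine (Finset.card_biUnion_le_card_mul _ _ 1 fun i _ => ?_).trans ?_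
  · cases a.args i <;> simp
  · simpa using h a ha

/-! ### Ranks of positions -/

/-- The edges of the dependency graph. -/
def Edge (D : Set TGD) (π π' : Position) : Prop := NormalEdge D π π' ∨ SpecialEdge D π π'

/-- The sources of the special edges on paths to a position. -/
def specialPreds (D : Set TGD) (π : Position) : Set Position :=
  {a | ∃ b, SpecialEdge D a b ∧ Relation.ReflTransGen (Edge D) b π}

/-- The rank of a position. -/
noncomputable def rank (D : Set TGD) (π : Position) : ℕ := (specialPreds D π).ncard

section rank

variable {D : Set TGD} {π π' : Position}

theorem finite_positions (A : List (Atom Term)) : {π : Position | ∃ v, OccursAt v A π}.Finite := by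
  refine (A.finite_toSet.biUnion (t := fun a => Set.range fun i : Fin a.rel.arity =>
    (⟨a.rel, i⟩ : Position)) fun a _ => Set.finite_range _).subset ?_
  rintro π ⟨v, a, ha, i, rfl, -⟩
  exact Set.mem_biUnion ha ⟨i, rfl⟩

theorem finite_bodyPositions (hD : D.Finite) :
    {π : Position | ∃ ρ ∈ D, ∃ v, OccursAt v ρ.body π}.Finite :=
  (hD.biUnion fun ρ _ => finite_positions ρ.body).subset fun _ ⟨_, hρ, h⟩ =>
    Set.mem_biUnion hρ h

theorem specialPreds_subset : specialPreds D π ⊆ {π : Position | ∃ ρ ∈ D, ∃ v, OccursAt v ρ.body π} :=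
  fun _ ⟨_, ⟨ρ, hρ, x, _, hx, _⟩, _⟩ => ⟨ρ, hρ, x, hx⟩

theorem specialPreds_mono (h : Edge D π π') : specialPreds D π ⊆ specialPreds D π' :=
  fun _ ⟨b, hb, hp⟩ => ⟨b, hb, hp.tail h⟩

/-- Special edges start at positions of variables in bodies of `D`, of which there are finitely
many; this gives one bound for all positions. -/
theorem rank_le (hD : D.Finite) :
    rank D π ≤ {π : Position | ∃ ρ ∈ D, ∃ v, OccursAt v ρ.body π}.ncard :=
  Set.ncard_le_ncard specialPreds_subset (finite_bodyPositions hD)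

theorem rank_mono (hD : D.Finite) (h : Edge D π π') : rank D π ≤ rank D π' :=
  Set.ncard_le_ncard (specialPreds_mono h) ((finite_bodyPositions hD).subset specialPreds_subset)

/-- The source `π` of the special edge counts for `π'`. If it also counted for `π`, a path would
lead from the end of a special edge at `π` back to `π`, which is a forbidden cycle. -/
theorem rank_lt (hD : D.Finite) (hw : WeaklyAcyclic D) (h : SpecialEdge D π π') :
    rank D π < rank D π' := by
  refine Set.ncard_lt_ncard ⟨specialPreds_mono (.inr h), fun hsub => ?_⟩
    ((finite_bodyPositions hD).subset specialPreds_subset)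
  obtain ⟨b, hb, hp⟩ := hsub (show π ∈ specialPreds D π' from ⟨π', h, .refl⟩)
  exact hw ⟨π, b, hb, hp⟩

end rank

/-! ### The length of derivations -/

/-- The steps that have all frontier values in `U`. -/
noncomputable def stepsOver (L : List Step) (U : Finset Const) : Finset Step :=
  open Classical in L.toFinset.filter fun x => ∀ v ∈ x.1.frontier, x.2 v ∈ U

/-- The values of the variables in the head of a step. -/
def headConsts (x : Step) : Finset Const := (varList x.1.head).toFinset.image x.2

/-- The constants that are generated from `U` in `r` rounds. -/
noncomputable def generated (L : List Step) (U : Finset Const) : ℕ → Finset Const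
  | 0 => U
  | r + 1 => generated L U r ∪ (stepsOver L (generated L U r)).biUnion headConsts

theorem mem_stepsOver {L : List Step} {U : Finset Const} {x : Step} :
    x ∈ stepsOver L U ↔ x ∈ L ∧ ∀ v ∈ x.1.frontier, x.2 v ∈ U := by
  simp [stepsOver]

theorem mem_headConsts {x : Step} {v : Var} (hv : v ∈ x.1.exvars) : x.2 v ∈ headConsts x :=
  Finset.mem_image_of_mem _ (by simpa [mem_varList] using hv.1)

theorem generated_mono (L : List Step) (U : Finset Const) : Monotone (generated L U) :=
  monotone_nat_of_le_succ fun _ => Finset.subset_union_left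

theorem mem_generated_succ {L : List Step} {U : Finset Const} {r : ℕ} {x : Step} (hx : x ∈ L)
    (hf : ∀ v ∈ x.1.frontier, x.2 v ∈ generated L U r) {v : Var} (hv : v ∈ x.1.exvars) :
    x.2 v ∈ generated L U (r + 1) :=
  Finset.mem_union_right _ (Finset.mem_biUnion.2 ⟨x, mem_stepsOver.2 ⟨hx, hf⟩, mem_headConsts hv⟩)

/-- The variables in the bodies of the TGDs of a setting. -/
noncomputable def Setting.bodyVars (S : Setting) : Finset Var :=
  S.tgds.biUnion fun ρ => (varList ρ.body).toFinset

/-- A bound on the number of variables in the heads of the TGDs of a setting. -/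
noncomputable def Setting.headSize (S : Setting) : ℕ :=
  S.tgds.sup fun ρ => (varList ρ.head).length

/-- The constants in the heads of the TGDs of a setting. -/
noncomputable def Setting.headConsts (S : Setting) : Finset Const :=
  S.tgds.biUnion fun ρ => (constList ρ.head).toFinset

theorem Setting.mem_headConsts {S : Setting} {ρ : TGD} (hρ : ρ ∈ S.allTGDs) {a : Atom Term}
    (ha : a ∈ ρ.head) {i : Fin a.rel.arity} {c : Const} (h : a.args i = .const c) :
    c ∈ S.headConsts :=
  Finset.mem_biUnion.2 ⟨ρ, Setting.mem_tgds.2 hρ, by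
    rw [List.mem_toFinset, mem_constList]
    exact ⟨a, ha, i, h⟩⟩

variable {S : Setting} {I : Inst} {L : List Step}

/-- Marks do not repeat, so a step is determined by its TGD and its frontier tuple. The tuple is
coded as a partial map from the body variables to `U`, hence the base `U.card + 1`. -/
theorem card_stepsOver_le (hL : Derivation S I L) (U : Finset Const) :
    (stepsOver L U).card ≤ S.tgds.card * (U.card + 1) ^ S.bodyVars.card := by
  classical
  let f : Step → TGD × (S.bodyVars → Option U) := fun x => (x.1, fun v =>
    if h : (v : Var) ∈ x.1.frontier ∧ x.2 v ∈ U then some ⟨x.2 v, h.2⟩ else none)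
  have h : (stepsOver L U).card ≤
      (S.tgds ×ˢ (Finset.univ : Finset (S.bodyVars → Option U))).card := by
    refine Finset.card_le_card_of_injOn f (fun x hx => ?_) ?_
    · have := hL.mem_allTGDs x (mem_stepsOver.1 hx).1
      simpa [f] using Setting.mem_tgds.2 this
    · rintro ⟨ρ, ν⟩ hx ⟨ρ', ν'⟩ hx' h
      obtain ⟨hx, hU⟩ := mem_stepsOver.1 hx
      obtain ⟨hx', hU'⟩ := mem_stepsOver.1 hx'
      obtain rfl : ρ = ρ' := congrArg Prod.fst h
      refine List.inj_on_of_nodup_map hL.nodup hx hx' (Step.mark_eq.2 fun v hv => ?_)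
      have hv' : v ∈ S.bodyVars := Finset.mem_biUnion.2
        ⟨ρ, Setting.mem_tgds.2 (hL.mem_allTGDs _ hx), by simpa [mem_varList] using hv.1⟩
      have := congrFun (congrArg Prod.snd h) ⟨v, hv'⟩
      simp only [f] at this
      rw [dif_pos ⟨hv, hU v hv⟩, dif_pos ⟨hv, hU' v hv⟩] at this
      simpa using this
  simpa using h

theorem card_generated_succ_le (hL : Derivation S I L) (U : Finset Const) (r : ℕ) :
    (generated L U (r + 1)).card ≤ (generated L U r).card +
      S.tgds.card * ((generated L U r).card + 1) ^ S.bodyVars.card * S.headSize := by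
  refine (Finset.card_union_le _ _).trans (Nat.add_le_add_left ?_ _)
  refine (Finset.card_biUnion_le_card_mul _ _ S.headSize fun x hx => ?_).trans
    (Nat.mul_le_mul_right _ (card_stepsOver_le hL _))
  have hρ := hL.mem_allTGDs x (mem_stepsOver.1 hx).1
  refine Finset.card_image_le.trans ((List.toFinset_card_le _).trans ?_)
  exact Finset.le_sup (f := fun ρ : TGD => (varList ρ.head).length) (Setting.mem_tgds.2 hρ)

/-- The base constants of a derivation. -/
noncomputable def baseConsts (S : Setting) (I : Inst) : Finset Const := I.consts ∪ S.headConsts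

theorem HomInto.const_of_mem_varsOf {ν : Var → Const} {A : List (Atom Term)} {K : Inst}
    (h : HomInto (constVal ν) A K) {v : Var} (hv : v ∈ varsOf A) : Value.const (ν v) ∈ K.adom := by
  obtain ⟨a, ha, i, hi⟩ := hv
  exact ⟨_, h a ha, i, by simp [Atom.map, hi, Term.eval, constVal]⟩

/-- The chase adds only target facts, so the bodies of source-to-target TGDs are always matched in
`I` itself. -/
theorem Derivation.stDeps_frontier (hL : Derivation S I L) {ρ : TGD}
    {ν : Var → Const} (hb : HomInto (constVal ν) ρ.body (chaseInst I L)) (hρ : ρ ∈ S.stDeps) :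
    ∀ v ∈ varsOf ρ.body, ν v ∈ I.consts := by
  have hb' : HomInto (constVal ν) ρ.body I := by
    intro a ha
    rcases mem_chaseInst.1 (hb a ha) with h | ⟨x, hx, h⟩
    · exact h
    · exact absurd (rel_of_mem_headFacts (hL.mem_allTGDs x hx) h)
        (Finset.disjoint_left.1 S.disjoint (S.st_body ρ hρ a ha))
  exact fun v hv => Inst.mem_consts.2 (hb'.const_of_mem_varsOf hv)

/-- The value at each position of a target fact is generated in a number of rounds that is bounded
by the rank of the position. -/
theorem Derivation.mem_generated (hw : S.IsWeaklyAcyclic) (hI : S.IsSource I)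
    (hL : Derivation S I L) {L' : List Step} (hL' : ∃ L₁, L' = L₁ ++ L) :
    ∀ b ∈ chaseInst I L, b.rel ∈ S.trg → ∀ i, ∃ c ∈ generated L' (baseConsts S I)
      (rank S.tTGDs ⟨b.rel, i⟩ + 1), b.args i = Value.const c := by
  have hfin : S.tTGDs.Finite := S.finite_allTGDs.subset fun ρ hρ => .inr hρ
  induction hL with
  | nil =>
    intro b hb hr
    exact absurd hr (Finset.disjoint_left.1 S.disjoint (hI.1 b hb))
  | @cons x L hL hρ hb hm ih =>
    obtain ⟨L₁, hL₁⟩ := hL'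
    specialize ih ⟨L₁ ++ [x], by simp [hL₁]⟩
    have hx : x ∈ L' := by simp [hL₁]
    intro b hbK hr
    rcases Finset.mem_union.1 hbK with h | h
    · exact ih b h hr
    obtain ⟨a, ha, rfl⟩ := mem_headFacts.1 h
    intro i
    simp only [Atom.map] at i ⊢
    set r := rank S.tTGDs ⟨a.rel, i⟩ with hrank
    cases hi : a.args i with
    | const c =>
      refine ⟨c, generated_mono _ _ (Nat.zero_le _) ?_, rfl⟩
      exact Finset.mem_union_right _ (Setting.mem_headConsts hρ ha hi)
    | var v =>
      refine ⟨x.2 v, ?_, rfl⟩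
      have hvh : v ∈ varsOf x.1.head := ⟨a, ha, i, hi⟩
      have occ : OccursAt v x.1.head ⟨a.rel, i⟩ := ⟨a, ha, i, rfl, hi⟩
      rcases hρ with hρ | hρ
      · have hst := hL.stDeps_frontier hb hρ
        have hU : ∀ v ∈ varsOf x.1.body, x.2 v ∈ generated L' (baseConsts S I) 0 :=
          fun v hv => Finset.mem_union_left _ (hst v hv)
        by_cases hvb : v ∈ varsOf x.1.body
        · exact generated_mono _ _ (Nat.zero_le _) (hU v hvb)
        -- For a source-to-target TGD the frontier is available in round 0, so its existential
        -- values appear in round 1, whatever the rank.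
        · exact generated_mono _ _ (show 1 ≤ r + 1 by omega)
            (mem_generated_succ hx (fun v hv => hU v hv.1) ⟨hvh, hvb⟩)
      · have key : ∀ y ∈ varsOf x.1.body, ∃ π, OccursAt y x.1.body π ∧
            x.2 y ∈ generated L' (baseConsts S I) (rank S.tTGDs π + 1) := by
          rintro y ⟨a', ha', j, hj⟩
          obtain ⟨c, hc, h⟩ := ih _ (hb a' ha') (Setting.body_of_mem_tTGDs hρ a' ha') j
          simp only [Atom.map, hj, Term.eval, constVal, Value.const.injEq] at h
          exact ⟨⟨a'.rel, j⟩, ⟨a', ha', j, rfl, hj⟩, by rw [h]; exact hc⟩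
        by_cases hvb : v ∈ varsOf x.1.body
        · obtain ⟨π, hπ, h⟩ := key v hvb
          have := rank_mono hfin (.inl ⟨x.1, hρ, v, ⟨hvb, hvh⟩, hπ, occ⟩)
          exact generated_mono _ _ (by omega) h
        · refine mem_generated_succ hx (fun y hy => ?_) ⟨hvh, hvb⟩
          obtain ⟨π, hπ, h⟩ := key y hy.1
          -- A special edge leads from the body position of the frontier variable to the position at
          -- hand, so the frontier value has appeared by round `r` and the existential value follows
          -- in round `r + 1`.
          have := rank_lt hfin hw ⟨x.1, hρ, y, hy, hπ, v, ⟨hvh, hvb⟩, occ⟩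
          exact generated_mono _ _ (by omega) h

/-- A bound on the number of constants generated in `r` rounds, in the number of facts. -/
noncomputable def Setting.genPoly (S : Setting) : ℕ → Polynomial ℕ
  | 0 => Polynomial.X * Polynomial.C (S.src.sup RelSym.arity) + Polynomial.C S.headConsts.card
  | r + 1 => S.genPoly r + Polynomial.C S.tgds.card * (S.genPoly r + 1) ^ S.bodyVars.card *
      Polynomial.C S.headSize

/-- A bound on the ranks of the positions. -/
noncomputable def Setting.maxRank (S : Setting) : ℕ :=
  {π : Position | ∃ ρ ∈ S.tTGDs, ∃ v, OccursAt v ρ.body π}.ncard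

/-- A bound on the length of derivations, in the number of facts. -/
noncomputable def Setting.chasePoly (S : Setting) : Polynomial ℕ :=
  Polynomial.C S.tgds.card * (S.genPoly (S.maxRank + 1) + 1) ^ S.bodyVars.card

theorem card_generated_le (hI : S.IsSource I) (hL : Derivation S I L) (r : ℕ) :
    (generated L (baseConsts S I) r).card ≤ (S.genPoly r).eval I.card := by
  induction r with
  | zero =>
    refine (Finset.card_union_le _ _).trans ?_
    have := Inst.card_consts_le (I := I) (n := S.src.sup RelSym.arity)
      fun a ha => Finset.le_sup (hI.1 a ha)
    simpa [Setting.genPoly] using this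
  | succ r ih =>
    refine (card_generated_succ_le hL _ r).trans ?_
    simp only [Setting.genPoly, Polynomial.eval_add, Polynomial.eval_mul, Polynomial.eval_C,
      Polynomial.eval_pow, Polynomial.eval_one]
    gcongr

/-- Ranks are at most `S.maxRank`, so all frontier values appear within `S.maxRank + 1` rounds. The
length is then at most the number of distinct steps over this polynomially large set. -/
theorem Derivation.length_le (hw : S.IsWeaklyAcyclic) (hI : S.IsSource I)
    (hL : Derivation S I L) : L.length ≤ S.chasePoly.eval I.card := by
  classical
  have hfin : S.tTGDs.Finite := S.finite_allTGDs.subset fun ρ hρ => .inr hρ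
  have hnd : L.Nodup := List.Nodup.of_map _ hL.nodup
  have h1 : L.toFinset ⊆ stepsOver L (generated L (baseConsts S I) (S.maxRank + 1)) := by
    intro x hx
    rw [List.mem_toFinset] at hx
    refine mem_stepsOver.2 ⟨hx, fun v hv => ?_⟩
    obtain ⟨L₁, L₂, h⟩ := List.append_of_mem hx
    have hb : HomInto (constVal x.2) x.1.body (chaseInst I L) := by
      refine (hL.body h).mono fun b hb => ?_
      rcases mem_chaseInst.1 hb with h' | ⟨y, hy, h'⟩
      · exact mem_chaseInst.2 (.inl h')
      · exact mem_chaseInst.2 (.inr ⟨y, by simp [h, hy], h'⟩)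
    rcases hL.mem_allTGDs x hx with hρ | hρ
    · exact generated_mono _ _ (Nat.zero_le _)
        (Finset.mem_union_left _ (hL.stDeps_frontier hb hρ v hv.1))
    · obtain ⟨a, ha, i, hi⟩ := hv.1
      obtain ⟨c, hc, h⟩ := hL.mem_generated hw hI ⟨[], rfl⟩ _ (hb a ha)
        (Setting.body_of_mem_tTGDs hρ a ha) i
      simp only [Atom.map, hi, Term.eval, constVal, Value.const.injEq] at h
      rw [h]
      exact generated_mono _ _ (Nat.succ_le_succ (rank_le hfin)) hc
  rw [← List.toFinset_card_of_nodup hnd]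
  refine (Finset.card_le_card h1).trans ((card_stepsOver_le hL _).trans ?_)
  simp only [Setting.chasePoly, Polynomial.eval_add, Polynomial.eval_mul, Polynomial.eval_C,
    Polynomial.eval_pow, Polynomial.eval_one]
  gcongr
  exact card_generated_le hI hL _


/-! ### Certificates -/

/-- The value of a term under an assignment of constants. -/
def Term.evalC (ν : Var → Const) : Term → Const
  | .const c => c
  | .var v => ν v

/-- The ground version of an atom. -/
def Atom.gr (ν : Var → Const) (a : Atom Term) : Atom Const := a.map (Term.evalC ν)

section Words

variable {T : Type}

/-- The word for a fact, without the semicolon. -/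
def factBody (b : Atom Const) : List (Ltr T) := enc b.rel.name ++ encTuple (List.ofFn b.args)

end Words

/-- The variables of a TGD. -/
def TGD.vars (ρ : TGD) : List Var := varList ρ.body ++ varList ρ.head

namespace Setting

variable (S : Setting)

/-- The TGDs of a setting, as a type. -/
abbrev Rule : Type := {ρ : TGD // ρ ∈ S.tgds}

variable {S}

/-- The word for a chase step, without the semicolon. -/
def stepBody (ρ : S.Rule) (ν : Var → Const) : List (Ltr S.Rule) :=
  mark ρ :: encTuple (ρ.1.vars.map ν)

/-- An assignment to the variables in `vs` of constants that occur in `x` or `w`. -/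
def Assign (x w : List (Ltr S.Rule)) (vs : List Var) (ν : Var → Const) : Prop :=
  (∀ v, Dom x w (ν v)) ∧ ∀ v ∉ vs, ν v = []

/-- The step occurs in the word `p`, which is a prefix of the certificate `w` for the input `x`. -/
def HasStep (x w p : List (Ltr S.Rule)) (ρ : S.Rule) (ν : Var → Const) : Prop :=
  Assign x w ρ.1.vars ν ∧ Occ (stepBody ρ ν ++ [sym .semicolon]) p

/-- The fact belongs to the input. -/
def InSrc (x : List (Ltr S.Rule)) (b : Atom Const) : Prop := Occ (factBody b ++ [sym .semicolon]) x

/-- The fact is added by a step in `p`. -/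
def InHeads (x w p : List (Ltr S.Rule)) (b : Atom Const) : Prop :=
  ∃ (ρ : S.Rule) (ν : Var → Const), HasStep x w p ρ ν ∧ ∃ a ∈ ρ.1.head, a.gr ν = b

/-- The constant occurs in a fact that is added by a step. -/
def InAdom (x w : List (Ltr S.Rule)) (c : Const) : Prop :=
  ∃ (ρ : S.Rule) (ν : Var → Const), HasStep x w w ρ ν ∧ ∃ a ∈ ρ.1.head, ∃ i,
    (a.args i).evalC ν = c

/-- Satisfaction of a formula in the set of facts that are added by the steps. -/
def HoldsIn (x w : List (Ltr S.Rule)) : Formula → (Var → Const) → Prop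
  | .atom a, ν => InHeads x w w (a.gr ν)
  | .eq s t, ν => s.evalC ν = t.evalC ν
  | .neg φ, ν => ¬ HoldsIn x w φ ν
  | .and φ ψ, ν => HoldsIn x w φ ν ∧ HoldsIn x w ψ ν
  | .ex v φ, ν => ∃ c, Dom x w c ∧ InAdom x w c ∧ HoldsIn x w φ (update ν v c)

/-- The body of each step is available before the step. -/
def Founded (x w : List (Ltr S.Rule)) : Prop :=
  ∀ p r, w = p ++ r → AtBoundary p → ∀ (ρ : S.Rule) (ν : Var → Const), Assign x w ρ.1.vars ν →
    (∃ s t, r = s ++ t ∧ s = stepBody ρ ν ++ [sym .semicolon]) →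
      ∀ a ∈ ρ.1.body, InSrc x (a.gr ν) ∨ InHeads x w p (a.gr ν)

/-- Steps with the same frontier tuple have the same values for the existential variables. -/
def Functional (x w : List (Ltr S.Rule)) : Prop :=
  ∀ (ρ : S.Rule) (ν : Var → Const), Assign x w ρ.1.vars ν → ∀ ν' : Var → Const,
    Assign x w ρ.1.vars ν' → Occ (stepBody ρ ν ++ [sym .semicolon]) w →
      Occ (stepBody ρ ν' ++ [sym .semicolon]) w →
      (∀ v ∈ ρ.1.vars, v ∈ ρ.1.frontier → ν v = ν' v) →
        ∀ v ∈ ρ.1.vars, v ∈ ρ.1.exvars → ν v = ν' v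

/-- The facts that are added satisfy an EGD. -/
def SatEGD (x w : List (Ltr S.Rule)) : Dependency → Prop
  | .tgd _ => True
  | .egd η => ∀ ν : Var → Const, Assign x w (varList η.body) ν →
      (∀ a ∈ η.body, InHeads x w w (a.gr ν)) → ν η.lhs = ν η.rhs

/-- There is a step for each TGD and each homomorphism from its body. -/
def Saturated (x w : List (Ltr S.Rule)) : Prop :=
  ∀ (ρ : S.Rule) (ν : Var → Const), Assign x w (varList ρ.1.body) ν →
    (∀ a ∈ ρ.1.body, InSrc x (a.gr ν) ∨ InHeads x w w (a.gr ν)) →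
      ∃ ν' : Var → Const, Assign x w ρ.1.vars ν' ∧ Occ (stepBody ρ ν' ++ [sym .semicolon]) w ∧
        ∀ v ∈ ρ.1.vars, v ∈ ρ.1.frontier → ν v = ν' v

/-- The tuple of the input is not an answer to the query. -/
def NotAnswer (Q : Query) (x w : List (Ltr S.Rule)) : Prop :=
  ∀ ν : Var → Const, Assign x w (List.ofFn Q.vars) ν →
    (∃ p r, x = p ++ r ∧ r = sym .bar :: encTuple (List.ofFn fun i => ν (Q.vars i))) →
      ¬ ((∀ i, InAdom x w (ν (Q.vars i))) ∧ HoldsIn x w Q.formula ν)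

/-- The word `w` certifies that the tuple of the input `x` is not a supported certain answer. -/
def Certificate (Q : Query) (x w : List (Ltr S.Rule)) : Prop :=
  (∀ c ∈ S.headConsts, enc c <:+: w) ∧ Founded x w ∧ Functional x w ∧
    (∀ d ∈ S.tDeps, SatEGD x w d) ∧ Saturated x w ∧ NotAnswer Q x w

/-- The word is the word for a tuple of `n` constants. -/
def IsTuple (n : ℕ) (u : List (Ltr S.Rule)) : Prop :=
  ∃ t : Fin n → Const, u = encTuple (List.ofFn t)

/-- The word `x` is an input, given by a list of facts over the source schema and an `n`-tuple. -/
def IsInput (n : ℕ) (x : List (Ltr S.Rule)) : Prop :=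
  ∃ p r, x = p ++ r ∧ AtBoundary p ∧
    (∃ s t, r = s ++ t ∧ s = [sym .bar] ∧ IsTuple n t) ∧
    ¬ ∃ u v, p = u ++ v ∧ AtBoundary u ∧ ∃ b c, v = b ++ c ∧
      (∃ s t, c = s ++ t ∧ s = [sym .semicolon]) ∧ (∀ a ∈ b, a ∈ {a | a ≠ sym .semicolon}) ∧
      ¬ ∃ R ∈ S.src, ∃ s t, b = s ++ t ∧ s = enc R.name ∧ IsTuple R.arity t

end Setting

/-! ### Definability of certificates -/

namespace DefC

open Setting

variable {T ι κ : Type} [Nonempty ι]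

theorem term_eq (s t : Term) (f g : Var → κ) : DefC fun (_ : ι → List (Ltr T)) (c : κ → Const) =>
    s.evalC (fun v => c (f v)) = t.evalC fun v => c (g v) := by
  rcases s with a | v <;> rcases t with b | w
  · exact prop (a = b)
  · exact (eq_const (g w) a).congr fun e c => eq_comm
  · exact eq_const (f v) b
  · exact eq (f v) (g w)

theorem gr_eq (a b : Atom Term) (f g : Var → κ) :
    DefC fun (_ : ι → List (Ltr T)) (c : κ → Const) =>
      a.gr (fun v => c (f v)) = b.gr fun v => c (g v) := by
  obtain ⟨R, s⟩ := a
  obtain ⟨R', t⟩ := b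
  by_cases h : R = R'
  · subst h
    refine (fintype_forall fun i => term_eq (s i) (t i) f g).congr fun e c => ?_
    simp [Atom.gr, Atom.map, funext_iff]
  · exact (prop False).congr fun e c => by simp [Atom.gr, Atom.map, h]

/-- The word for a tuple of terms, as a sequence of variables and letters. -/
def _root_.DataExchange.termPieces (ι : Type) (f : Var → κ) (l : List Term) :
    List ((ι ⊕ κ) ⊕ Ltr T) :=
  l.flatMap fun t => .inr (sym .comma) :: match t with
    | .const c => (enc c).map .inr
    | .var v => [.inl (.inr (f v))]

omit [Nonempty ι] in
theorem _root_.DataExchange.pieces_termPieces (f : Var → κ) (l : List Term)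
    (e : ι → List (Ltr T)) (c : κ → Const) :
    pieces (termPieces ι f l) (Sum.elim e fun k => enc (c k)) =
      encTuple (l.map (Term.evalC fun v => c (f v))) := by
  simp only [termPieces, pieces, encTuple, List.flatMap_assoc, List.flatMap_map]
  congr 1
  funext t
  cases t <;> simp [Term.evalC, List.flatMap_map]

omit [Nonempty ι] in
theorem _root_.DataExchange.pieces_append {L L' : List (ι ⊕ T)} {e : ι → List T} :
    pieces (L ++ L') e = pieces L e ++ pieces L' e := by
  simp [pieces]

omit [Nonempty ι] in
theorem _root_.DataExchange.pieces_word {u : List T} {e : ι → List T} :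
    pieces (u.map .inr) e = u := by
  simp [pieces, List.flatMap_map]

/-- The pieces of a block that consists of a word and a tuple of terms. -/
def _root_.DataExchange.blockPieces (ι : Type) (u : List (Ltr T)) (f : Var → κ) (l : List Term)
    (v : List (Ltr T)) : List ((ι ⊕ κ) ⊕ Ltr T) :=
  u.map .inr ++ (termPieces ι f l ++ v.map .inr)

omit [Nonempty ι] in
theorem _root_.DataExchange.pieces_blockPieces (u v : List (Ltr T)) (f : Var → κ) (l : List Term)
    (e : ι → List (Ltr T)) (c : κ → Const) :
    pieces (blockPieces ι u f l v) (Sum.elim e fun k => enc (c k)) =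
      u ++ (encTuple (l.map (Term.evalC fun v => c (f v))) ++ v) := by
  rw [blockPieces, pieces_append, pieces_append, pieces_word, pieces_word, pieces_termPieces]

theorem occ_block (i : ι) (u v : List (Ltr T)) (f : Var → κ) (l : List Term) :
    DefC fun e (c : κ → Const) =>
      Occ (u ++ (encTuple (l.map (Term.evalC fun v => c (f v))) ++ v)) (e i) :=
  (ofDef (Def.occ (Sum.inl i) (blockPieces ι u f l v))).congr fun e c => by
    rw [pieces_blockPieces]
    rfl

theorem eq_block (i : ι) (u v : List (Ltr T)) (f : Var → κ) (l : List Term) :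
    DefC fun e (c : κ → Const) =>
      e i = u ++ (encTuple (l.map (Term.evalC fun v => c (f v))) ++ v) :=
  (ofDef (Def.eq_pieces (Sum.inl i) (blockPieces ι u f l v))).congr fun e c => by
    rw [pieces_blockPieces]
    rfl

theorem word {P : (ι → List (Ltr T)) → Prop} (h : Def P) :
    DefC fun e (_ : κ → Const) => P e :=
  ofDef (h.reindex Sum.inl)

variable {S : Setting}

theorem occ_step (i : ι) (ρ : S.Rule) (f : Var → κ) : DefC fun e (c : κ → Const) =>
    Occ (stepBody ρ (fun v => c (f v)) ++ [sym .semicolon]) (e i) :=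
  (occ_block i [mark ρ] [sym .semicolon] f (ρ.1.vars.map .var)).congr fun e c => by
    simp [stepBody, Function.comp_def, Term.evalC]

theorem eq_step (i : ι) (ρ : S.Rule) (f : Var → κ) : DefC fun e (c : κ → Const) =>
    e i = stepBody ρ (fun v => c (f v)) ++ [sym .semicolon] :=
  (eq_block i [mark ρ] [sym .semicolon] f (ρ.1.vars.map .var)).congr fun e c => by
    simp [stepBody, Function.comp_def, Term.evalC]

theorem inSrc (i : ι) (a : Atom Term) (f : Var → κ) :
    DefC fun (e : ι → List (Ltr S.Rule)) (c : κ → Const) => InSrc (e i) (a.gr fun v => c (f v)) :=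
  (occ_block i (enc a.rel.name) [sym .semicolon] f (List.ofFn a.args)).congr fun e c => by
    simp [InSrc, factBody, Atom.gr, Atom.map, List.map_ofFn, Function.comp_def]

theorem exists_assign' {P : (ι → List (Ltr S.Rule)) → (κ → Const) → (Var → Const) → Prop}
    (i j : ι) (vs : List Var) (h : DefC fun (e : ι → List (Ltr S.Rule)) (c : κ ⊕ Var → Const) =>
      P e (fun k => c (.inl k)) fun v => c (.inr v)) :
    DefC fun e c => ∃ ν : Var → Const, Assign (e i) (e j) vs ν ∧ P e c ν :=
  (exists_assign i j vs h).congr fun e c => by simp only [Assign, and_assoc]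

theorem forall_assign' {P : (ι → List (Ltr S.Rule)) → (κ → Const) → (Var → Const) → Prop}
    (i j : ι) (vs : List Var) (h : DefC fun (e : ι → List (Ltr S.Rule)) (c : κ ⊕ Var → Const) =>
      P e (fun k => c (.inl k)) fun v => c (.inr v)) :
    DefC fun e c => ∀ ν : Var → Const, Assign (e i) (e j) vs ν → P e c ν :=
  (forall_assign i j vs h).congr fun e c => by simp only [Assign, and_imp]

theorem inHeads (i j k : ι) (a : Atom Term) (f : Var → κ) :
    DefC fun (e : ι → List (Ltr S.Rule)) (c : κ → Const) =>
      InHeads (e i) (e j) (e k) (a.gr fun v => c (f v)) := by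
  refine (fintype_exists (β := S.Rule) fun ρ => exists_assign' i j ρ.1.vars
    (P := fun e c ν => Occ (stepBody ρ ν ++ [sym .semicolon]) (e k) ∧ ∃ b ∈ ρ.1.head,
      b.gr ν = a.gr fun v => c (f v)) <| (occ_step k ρ Sum.inr).and <|
    list_exists _ fun b _ => gr_eq b a Sum.inr fun v => Sum.inl (f v)).congr fun e c => ?_
  simp only [InHeads, HasStep, and_assoc]

theorem inAdom (i j : ι) (k : κ) : DefC fun (e : ι → List (Ltr S.Rule)) (c : κ → Const) =>
    InAdom (e i) (e j) (c k) := by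
  refine (fintype_exists (β := S.Rule) fun ρ => exists_assign' i j ρ.1.vars
    (P := fun e c ν => Occ (stepBody ρ ν ++ [sym .semicolon]) (e j) ∧ ∃ b ∈ ρ.1.head,
      ∃ i, (b.args i).evalC ν = c k) <| (occ_step j ρ Sum.inr).and <|
    list_exists _ fun b _ => fintype_exists fun i =>
      (term_eq (b.args i) (.var 0) Sum.inr fun _ => Sum.inl k)).congr fun e c => ?_
  simp only [InAdom, HasStep, and_assoc]

/-- The map `f` from variables to constant parameters varies because a quantifier adds a parameter
and redirects its variable to it. -/
theorem holdsIn (i j : ι) (φ : Formula) : ∀ {κ : Type} (f : Var → κ),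
    DefC fun (e : ι → List (Ltr S.Rule)) (c : κ → Const) =>
      HoldsIn (e i) (e j) φ fun v => c (f v) := by
  induction φ with
  | atom a => exact fun f => inHeads i j j a f
  | eq s t => exact fun f => term_eq s t f f
  | neg φ ih => exact fun f => (ih f).not
  | and φ ψ ih ih' => exact fun f => (ih f).and (ih' f)
  | ex v φ ih =>
    intro κ f
    refine (exists_const (P := fun e c a => InAdom (e i) (e j) a ∧
      HoldsIn (e i) (e j) φ (update (fun v => c (f v)) v a)) i j ((inAdom i j none).and
      ((ih (κ := Option κ) fun v' => if v' = v then none else some (f v')).congr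
        fun e c => ?_))).congr fun e c => Iff.rfl
    have : (fun v' => c (if v' = v then none else some (f v'))) =
        update (fun v => c (some (f v))) v (c none) := by
      funext v'
      by_cases h : v' = v
      · subst h
        simp
      · simp [h]
    rw [this]

theorem forall_split {P : (ι → List (Ltr T)) → (κ → Const) → List (Ltr T) → List (Ltr T) → Prop}
    (j : ι) (h : DefC fun (e : Option (Option ι) → List (Ltr T)) c =>
      P (fun i => e (some (some i))) c (e (some none)) (e none)) :
    DefC fun e c => ∀ u v, e j = u ++ v → P e c u v :=
  (exists_split (P := fun e c u v => ¬ P e c u v) j h.not).not.congr fun e c => by simp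

theorem founded (i j : ι) : DefC fun (e : ι → List (Ltr S.Rule)) (_ : κ → Const) =>
    Founded (e i) (e j) := by
  refine forall_split j <| (word (Def.atBoundary (some none))).imp <|
    fintype_forall fun ρ => forall_assign' (some (some i)) (some (some j)) ρ.1.vars
      (P := fun e c ν => (∃ s t, e none = s ++ t ∧ s = stepBody ρ ν ++ [sym .semicolon]) →
        ∀ a ∈ ρ.1.body, InSrc (e (some (some i))) (a.gr ν) ∨
          InHeads (e (some (some i))) (e (some (some j))) (e (some none)) (a.gr ν)) <|
    (exists_split none (eq_step (some none) ρ Sum.inr)).imp <|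
    list_forall _ fun a _ => (inSrc _ a Sum.inr).or (inHeads _ _ _ a Sum.inr)

theorem forall_vars_eq (l : List Var) (p : Var → Prop) (f g : Var → κ) :
    DefC fun (_ : ι → List (Ltr T)) (c : κ → Const) => ∀ v ∈ l, p v → c (f v) = c (g v) :=
  list_forall l fun v _ => (prop (p v)).imp (eq (f v) (g v))

theorem functional (i j : ι) : DefC fun (e : ι → List (Ltr S.Rule)) (_ : κ → Const) =>
    Functional (e i) (e j) := by
  refine fintype_forall fun ρ => forall_assign' i j ρ.1.vars ?_
  refine forall_assign' i j ρ.1.vars ?_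
  exact (occ_step j ρ fun v => Sum.inl (Sum.inr v)).imp <| (occ_step j ρ Sum.inr).imp <|
    (forall_vars_eq ρ.1.vars (· ∈ ρ.1.frontier) (fun v => Sum.inl (Sum.inr v)) Sum.inr).imp <|
    forall_vars_eq ρ.1.vars (· ∈ ρ.1.exvars) (fun v => Sum.inl (Sum.inr v)) Sum.inr

theorem satEGD (i j : ι) (d : Dependency) :
    DefC fun (e : ι → List (Ltr S.Rule)) (_ : κ → Const) => SatEGD (e i) (e j) d := by
  cases d with
  | tgd ρ => exact prop True
  | egd η =>
    exact forall_assign' i j (varList η.body) (P := fun e c ν =>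
      (∀ a ∈ η.body, InHeads (e i) (e j) (e j) (a.gr ν)) → ν η.lhs = ν η.rhs) <|
      (list_forall _ fun a _ => inHeads i j j a Sum.inr).imp (eq _ _)

theorem saturated (i j : ι) : DefC fun (e : ι → List (Ltr S.Rule)) (_ : κ → Const) =>
    Saturated (e i) (e j) := by
  refine fintype_forall fun ρ => forall_assign' i j (varList ρ.1.body) (P := fun e c ν =>
    (∀ a ∈ ρ.1.body, InSrc (e i) (a.gr ν) ∨ InHeads (e i) (e j) (e j) (a.gr ν)) →
      ∃ ν' : Var → Const, Assign (e i) (e j) ρ.1.vars ν' ∧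
        Occ (stepBody ρ ν' ++ [sym .semicolon]) (e j) ∧
        ∀ v ∈ ρ.1.vars, v ∈ ρ.1.frontier → ν v = ν' v) <|
    (list_forall _ fun a _ => (inSrc i a Sum.inr).or (inHeads i j j a Sum.inr)).imp <|
    exists_assign' i j ρ.1.vars (P := fun e (c : κ ⊕ Var → Const) ν' =>
      Occ (stepBody ρ ν' ++ [sym .semicolon]) (e j) ∧
        ∀ v ∈ ρ.1.vars, v ∈ ρ.1.frontier → c (Sum.inr v) = ν' v) <|
    (occ_step j ρ Sum.inr).and <|
    forall_vars_eq ρ.1.vars (· ∈ ρ.1.frontier) (fun v => Sum.inl (Sum.inr v)) Sum.inr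

theorem notAnswer (Q : Query) (i j : ι) :
    DefC fun (e : ι → List (Ltr S.Rule)) (_ : κ → Const) => NotAnswer Q (e i) (e j) := by
  refine forall_assign' i j (List.ofFn Q.vars) (P := fun e c ν =>
    (∃ p r, e i = p ++ r ∧ r = sym .bar :: encTuple (List.ofFn fun i => ν (Q.vars i))) →
      ¬ ((∀ k, InAdom (e i) (e j) (ν (Q.vars k))) ∧ HoldsIn (e i) (e j) Q.formula ν)) <|
    (exists_split i <| (eq_block none [sym .bar] [] Sum.inr
      (List.ofFn fun k => .var (Q.vars k))).congr fun e c => ?_).imp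
    ((fintype_forall fun k => inAdom i j _).and (holdsIn i j _ Sum.inr)).not
  simp [List.map_ofFn, Function.comp_def, Term.evalC]

end DefC

open Setting

variable {S : Setting} {ι : Type}

theorem Def.certificate [Nonempty ι] (Q : Query) (i j : ι) :
    Def fun e : ι → List (Ltr S.Rule) => Certificate Q (e i) (e j) :=
  DefC.toDef <| (DefC.finset_forall _ fun c _ => DefC.word <|
    (Def.exists_infix (P := fun _ u => u = enc c) j (Def.eq_word none _)).congr
      fun e => by simp).and <|
    (DefC.founded i j).and <| (DefC.functional i j).and <|
    (DefC.finset_forall _ fun d _ => DefC.satEGD i j d).and <|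
    (DefC.saturated i j).and (DefC.notAnswer Q i j)

/-- The components of the tuple are the values of the variables below `n`; each of them occurs as a
factor of the word, so the bounded quantifiers reach it. -/
theorem Def.isTuple [Nonempty ι] (n : ℕ) (i : ι) :
    Def fun e : ι → List (Ltr S.Rule) => IsTuple n (e i) := by
  refine DefC.toDef ((DefC.exists_assign' i i (List.range n) (P := fun e _ ν =>
    e i = encTuple (List.ofFn fun k : Fin n => ν k)) <|
    (DefC.eq_block i [] [] Sum.inr (List.ofFn fun k : Fin n => .var k)).congr
      fun e c => ?_).congr fun e c => ?_)
  · simp [List.map_ofFn, Function.comp_def, Term.evalC]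
  · constructor
    · rintro ⟨ν, -, h⟩
      exact ⟨_, h⟩
    · rintro ⟨t, h⟩
      refine ⟨fun v => if hv : v < n then t ⟨v, hv⟩ else [], ⟨fun v => ?_, fun v hv => ?_⟩, ?_⟩
      · by_cases hv : v < n
        · simp only [hv, dif_pos]
          refine .inl ?_
          rw [h]
          obtain ⟨l, r, hl⟩ := List.append_of_mem (List.mem_ofFn.2 ⟨⟨v, hv⟩, rfl⟩ :
            t ⟨v, hv⟩ ∈ List.ofFn t)
          rw [hl]
          exact ⟨encTuple l ++ [sym .comma], encTuple r, by simp [encTuple]⟩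
        · simp only [hv]
          exact .inl List.nil_infix
      · exact dif_neg (by simpa using hv)
      · rw [h]
        simp

theorem Def.isInput [Nonempty ι] (n : ℕ) (i : ι) :
    Def fun e : ι → List (Ltr S.Rule) => IsInput n (e i) := by
  refine Def.exists_split i <| (Def.atBoundary (some none)).and <|
    (Def.exists_split none <| (Def.lit (some none) _).and (Def.isTuple n none)).and <|
    Def.not <| Def.exists_split (some none) <| (Def.atBoundary (some none)).and <|
    Def.exists_split none <| (Def.exists_split none <| Def.lit (some none) _).and <|
    (Def.letters (some none) _).and <| Def.not <| Def.finset_exists _ (fun R _ =>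
      Def.exists_split (some none) <| (Def.eq_word (some none) _).and
        (Def.isTuple R.arity none)) none


/-! ### Parsing -/

theorem append_cons_inj_of_notMem_left {α : Type*} {a : α} {u v x y : List α} (hu : a ∉ u)
    (hv : a ∉ v) (h : u ++ a :: x = v ++ a :: y) : u = v ∧ x = y := by
  induction u generalizing v with
  | nil =>
    cases v with
    | nil => exact ⟨rfl, by simpa using h⟩
    | cons b v => exact absurd (by simp_all) hv
  | cons b u ih =>
    cases v with
    | nil => exact absurd (by simp_all) hu
    | cons c v =>
      simp only [List.cons_append, List.cons.injEq] at h
      obtain ⟨rfl, rfl⟩ := ih (fun h => hu (by simp [h])) (fun h => hv (by simp [h])) h.2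
      exact ⟨by rw [h.1], rfl⟩

section Words

variable {T : Type}

/-- The word that consists of a sequence of blocks, each followed by a semicolon. -/
def blocks (bs : List (List (Ltr T))) : List (Ltr T) := bs.flatMap (· ++ [sym .semicolon])

theorem blocks_append (bs bs' : List (List (Ltr T))) : blocks (bs ++ bs') = blocks bs ++ blocks bs' := by
  simp [blocks]

theorem blocks_cons (b : List (Ltr T)) (bs : List (List (Ltr T))) :
    blocks (b :: bs) = b ++ sym .semicolon :: blocks bs := by
  simp [blocks]

theorem sym_mem_enc {s : Sym} {c : Const} : (sym s : Ltr T) ∈ enc c → ∃ b, s = .bit b := by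
  simp only [enc, List.mem_map, sym, Sum.inl.injEq]
  rintro ⟨b, _, rfl⟩
  exact ⟨b, rfl⟩

theorem sym_mem_encTuple {s : Sym} {l : List Const} :
    (sym s : Ltr T) ∈ encTuple l → s = .comma ∨ ∃ b, s = .bit b := by
  simp only [encTuple, List.mem_flatMap, List.mem_cons]
  rintro ⟨c, _, h | h⟩
  · exact .inl (by simpa [sym] using h)
  · exact .inr (sym_mem_enc h)

theorem sym_mem_factBody {s : Sym} {b : Atom Const} :
    (sym s : Ltr T) ∈ factBody b → s = .comma ∨ ∃ b, s = .bit b := by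
  simp only [factBody, List.mem_append]
  rintro (h | h)
  · exact .inr (sym_mem_enc h)
  · exact sym_mem_encTuple h

theorem AtBoundary.blocks (bs : List (List (Ltr T))) : AtBoundary (blocks bs) := by
  rcases List.eq_nil_or_concat bs with rfl | ⟨bs', b, rfl⟩
  · exact .inl rfl
  · exact .inr ⟨DataExchange.blocks bs' ++ b, by simp [DataExchange.blocks]⟩

theorem AtBoundary.exists_block {p : List (Ltr T)} (hp : AtBoundary p) (h : p ≠ []) :
    ∃ b q, p = b ++ sym .semicolon :: q ∧ sym .semicolon ∉ b ∧ AtBoundary q := by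
  obtain ⟨v, rfl⟩ := hp.resolve_left h
  obtain ⟨b, q, hq, hb⟩ := List.eq_append_cons_of_mem
    (show sym .semicolon ∈ v ++ [(sym .semicolon : Ltr T)] by simp)
  refine ⟨b, q, hq, hb, ?_⟩
  rcases List.eq_nil_or_concat q with rfl | ⟨q', a, rfl⟩
  · exact .inl rfl
  · refine .inr ⟨q', ?_⟩
    have h' : v ++ [sym .semicolon] = (b ++ sym .semicolon :: q') ++ [a] := by simpa using hq
    rw [List.concat_eq_append, (List.append_inj' h' rfl).2]

theorem AtBoundary.exists_blocks {p : List (Ltr T)} (hp : AtBoundary p) :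
    ∃ bs, (∀ b ∈ bs, sym .semicolon ∉ b) ∧ p = DataExchange.blocks bs := by
  by_cases h : p = []
  · exact ⟨[], by simp, by simp [h, DataExchange.blocks]⟩
  · obtain ⟨b, q, rfl, hb, hq⟩ := hp.exists_block h
    obtain ⟨bs, hbs, rfl⟩ := hq.exists_blocks
    exact ⟨b :: bs, by simpa using ⟨hb, hbs⟩, by rw [blocks_cons]⟩
termination_by p.length
decreasing_by
  subst_vars
  simp
  omega

/-- A block that occurs in a sequence of blocks is one of them. -/
theorem blocks_eq_append {bs : List (List (Ltr T))} {t p v r : List (Ltr T)}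
    (hbs : ∀ b ∈ bs, sym .semicolon ∉ b) (ht : sym .semicolon ∉ t) (hv : sym .semicolon ∉ v)
    (hp : AtBoundary p) (h : blocks bs ++ t = p ++ (v ++ sym .semicolon :: r)) :
    ∃ bs₁ bs₂, bs = bs₁ ++ v :: bs₂ ∧ p = blocks bs₁ ∧ r = blocks bs₂ ++ t := by
  induction bs generalizing p with
  | nil => exact absurd (show sym .semicolon ∈ t by simp [blocks] at h; simp [h]) ht
  | cons b bs ih =>
    rw [blocks_cons, List.append_assoc, List.cons_append] at h
    by_cases hp' : p = []
    · subst hp'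
      obtain ⟨rfl, rfl⟩ := append_cons_inj_of_notMem_left (hbs b (by simp)) hv h
      exact ⟨[], bs, rfl, rfl, rfl⟩
    · obtain ⟨b', q, rfl, hb', hq⟩ := hp.exists_block hp'
      rw [List.append_assoc, List.cons_append] at h
      obtain ⟨rfl, h'⟩ := append_cons_inj_of_notMem_left (hbs b (by simp)) hb' h
      obtain ⟨bs₁, bs₂, rfl, rfl, rfl⟩ := ih (fun b hb => hbs b (by simp [hb])) hq h'
      exact ⟨b :: bs₁, bs₂, rfl, by rw [blocks_cons], rfl⟩

/-- Encoded constants contain no comma, so the commas mark the ends of the components. -/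
theorem enc_append_encTuple_inj {c c' : Const} {l l' : List Const}
    (h : enc c ++ encTuple l = (enc c' ++ encTuple l' : List (Ltr T))) : c = c' ∧ l = l' := by
  have hn : ∀ c : Const, sym .comma ∉ (enc c : List (Ltr T)) := fun c hc => by
    simpa using sym_mem_enc hc
  induction l generalizing c c' l' with
  | nil =>
    cases l' with
    | nil => exact ⟨enc_injective (by simpa [encTuple] using h), rfl⟩
    | cons d' l' =>
      refine absurd ?_ (hn c)
      simp only [encTuple, List.flatMap_nil, List.append_nil] at h
      simp [h]
  | cons d l ih =>
    cases l' with
    | nil =>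
      refine absurd ?_ (hn c')
      simp only [encTuple, List.flatMap_nil, List.append_nil] at h
      simp [← h]
    | cons d' l' =>
      obtain ⟨h1, h2⟩ := append_cons_inj_of_notMem_left (hn c) (hn c') h
      obtain ⟨rfl, rfl⟩ := ih h2
      exact ⟨enc_injective h1, rfl⟩

theorem encTuple_injective : Injective (encTuple : List Const → List (Ltr T)) := by
  rintro (_ | ⟨c, l⟩) (_ | ⟨c', l'⟩) h
  · rfl
  · simp [encTuple] at h
  · simp [encTuple] at h
  · obtain ⟨rfl, rfl⟩ := enc_append_encTuple_inj (List.cons_inj_right _ |>.1 h)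
    rfl

/-- The part before the first comma is the relation name, and the number of components gives the
arity. -/
theorem factBody_injective : Injective (factBody : Atom Const → List (Ltr T)) := by
  rintro ⟨⟨R, n⟩, s⟩ ⟨⟨R', n'⟩, s'⟩ h
  obtain ⟨h1, h2⟩ := enc_append_encTuple_inj h
  obtain rfl : R = R' := h1
  have h3 : (⟨n, s⟩ : (n : ℕ) × (Fin n → Const)) = ⟨n', s'⟩ := List.ofFn_inj'.1 h2
  cases h3
  rfl

/-- The word for a list of facts and a tuple. -/
def inputWord {n : ℕ} (l : List (Atom Const)) (t : Fin n → Const) : List (Ltr T) :=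
  blocks (l.map factBody) ++ sym .bar :: encTuple (List.ofFn t)

theorem map_encodeInput {n : ℕ} (l : List (Atom Const)) (t : Fin n → Const) :
    (encodeInput l t).map sym = (inputWord l t : List (Ltr T)) := by
  simp [encodeInput, inputWord, blocks, encodeFact, encodeTuple, factBody, encTuple, enc,
    List.map_flatMap, List.flatMap_map, Function.comp_def]

theorem semicolon_notMem_encTuple (l : List Const) : (sym .semicolon : Ltr T) ∉ encTuple l :=
  fun h => by simpa using sym_mem_encTuple h

theorem semicolon_notMem_factBody (b : Atom Const) : (sym .semicolon : Ltr T) ∉ factBody b :=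
  fun h => by simpa using sym_mem_factBody h

/-- The bar occurs exactly once in an input, so it determines where the tuple begins. -/
theorem inputWord_eq_append {n : ℕ} {l : List (Atom Const)} {t : Fin n → Const}
    {p : List (Ltr T)} {u : List Const}
    (h : inputWord l t = p ++ sym .bar :: encTuple u) : List.ofFn t = u := by
  have hn : ∀ l : List Const, (sym .bar : Ltr T) ∉ encTuple l := fun l h => by
    simpa using sym_mem_encTuple h
  refine encTuple_injective ((List.append_cons_inj_of_notMem ?_ (hn _)).1 h).2.2
  simp only [blocks, List.mem_flatMap, List.mem_map, List.mem_append, List.mem_singleton]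
  rintro ⟨_, ⟨b, _, rfl⟩, hb | hb⟩
  · simpa using sym_mem_factBody hb
  · simp [sym] at hb

variable {S : Setting}

/-- The semicolons determine the blocks, so an occurrence that starts at a boundary is one of the
listed facts and not an accidental factor. -/
theorem Setting.inSrc_iff {n : ℕ} {l : List (Atom Const)} {t : Fin n → Const} {b : Atom Const} :
    S.InSrc (inputWord l t) b ↔ b ∈ l := by
  constructor
  · rintro ⟨p, r, h, hp⟩
    rw [List.append_assoc] at h
    obtain ⟨bs₁, bs₂, h, -⟩ := blocks_eq_append (by simp [semicolon_notMem_factBody])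
      (fun h => (List.mem_cons.1 h).elim (by simp [sym]) (semicolon_notMem_encTuple _))
      (semicolon_notMem_factBody b) hp h
    have : factBody b ∈ l.map (factBody (T := S.Rule)) := by simp [h]
    obtain ⟨b', hb', h⟩ := List.mem_map.1 this
    rwa [← factBody_injective h]
  · intro h
    obtain ⟨l₁, l₂, rfl⟩ := List.append_of_mem h
    refine ⟨blocks (l₁.map factBody), blocks (l₂.map factBody) ++ sym .bar :: encTuple (List.ofFn t),
      ?_, .blocks _⟩
    simp [inputWord, blocks]

/-- Being a list of facts cannot be said by quantifying over lists. Instead, the part before the bar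
ends at a boundary, and no block in it fails to encode a source fact. -/
theorem Setting.isInput_iff {n : ℕ} {x : List (Ltr S.Rule)} :
    S.IsInput n x ↔ ∃ (l : List (Atom Const)) (t : Fin n → Const), (∀ b ∈ l, b.rel ∈ S.src) ∧
      x = inputWord l t := by
  constructor
  · rintro ⟨p, r, rfl, hp, ⟨s, t', rfl, rfl, t, rfl⟩, h⟩
    obtain ⟨bs, hbs, rfl⟩ := hp.exists_blocks
    have key : ∀ b ∈ bs, ∃ a : Atom Const, a.rel ∈ S.src ∧ factBody a = b := by
      intro b hb
      by_contra hb'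
      obtain ⟨bs₁, bs₂, rfl⟩ := List.append_of_mem hb
      refine h ⟨blocks bs₁, blocks (b :: bs₂), blocks_append _ _, .blocks _, b,
        sym .semicolon :: blocks bs₂, blocks_cons _ _, ⟨_, _, rfl, rfl⟩, fun a ha h' => ?_, ?_⟩
      · exact hbs b hb (h' ▸ ha)
      · rintro ⟨R, hR, _, _, rfl, rfl, s, rfl⟩
        exact hb' ⟨⟨R, s⟩, hR, rfl⟩
    have : Inhabited (Atom Const) := ⟨⟨⟨[], 0⟩, nofun⟩⟩
    choose! f hf using key
    refine ⟨bs.map f, t, by simpa using fun b hb => (hf b hb).1, ?_⟩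
    have : (bs.map f).map factBody = bs := by
      rw [List.map_map]
      exact (List.map_congr_left fun b hb => (hf b hb).2).trans (List.map_id _)
    simp [inputWord, this]
  · rintro ⟨l, t, hl, rfl⟩
    refine ⟨blocks (l.map factBody), _, rfl, .blocks _, ⟨_, _, rfl, rfl, t, rfl⟩, ?_⟩
    rintro ⟨u, v, h, hu, b, c, rfl, ⟨s, r, rfl, rfl⟩, hb, h'⟩
    obtain ⟨bs₁, bs₂, h, -⟩ := blocks_eq_append (t := []) (by simp [semicolon_notMem_factBody])
      List.not_mem_nil (fun h => hb _ h rfl) hu ((List.append_nil _).trans h)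
    have : b ∈ l.map factBody := by simp [h]
    obtain ⟨a, ha, rfl⟩ := List.mem_map.1 this
    exact h' ⟨a.rel, hl a ha, _, _, rfl, rfl, a.args, rfl⟩

end Words

/-! ### Soundness of certificates -/

theorem Atom.ext_args {τ : Type} {R : RelSym} {s t : Fin R.arity → τ} (h : ∀ i, s i = t i) :
    (⟨R, s⟩ : Atom τ) = ⟨R, t⟩ := by rw [funext h]

theorem Atom.map_injective {τ τ' : Type} {f : τ → τ'} (hf : Injective f) :
    Injective (Atom.map f) := by
  rintro ⟨R, s⟩ ⟨R', t⟩ h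
  obtain rfl : R = R' := congrArg Atom.rel h
  simp only [Atom.map, Atom.mk.injEq, heq_eq_eq, true_and] at h
  exact Atom.ext_args fun i => hf (congrFun h i)

theorem Value.const_injective : Injective Value.const := fun _ _ h => by cases h; rfl

theorem constFact_injective : Injective (Atom.map Value.const) :=
  Atom.map_injective Value.const_injective

theorem Term.eval_constVal (ν : Var → Const) (s : Term) :
    s.eval (constVal ν) = .const (s.evalC ν) := by
  cases s <;> rfl

theorem Atom.map_eval_constVal (ν : Var → Const) (a : Atom Term) :
    a.map (Term.eval (constVal ν)) = (a.gr ν).map Value.const :=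
  Atom.ext_args fun i => Term.eval_constVal ν (a.args i)

theorem Atom.gr_congr {ν ν' : Var → Const} {a : Atom Term} (h : ∀ v ∈ a.vars, ν v = ν' v) :
    a.gr ν = a.gr ν' := by
  refine Atom.ext_args fun i => ?_
  cases hi : a.args i with
  | const c => rfl
  | var v => exact h v ⟨i, hi⟩

theorem mem_instOfList {l : List (Atom Const)} {b : Atom Const} :
    b.map Value.const ∈ instOfList l ↔ b ∈ l := by
  rw [instOfList, List.mem_toFinset, List.mem_map_of_injective constFact_injective]

theorem exists_of_mem_instOfList {l : List (Atom Const)} {b : Fact} (h : b ∈ instOfList l) :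
    ∃ b' ∈ l, b'.map Value.const = b := by
  simpa [instOfList] using h

theorem Setting.isSource_instOfList {S : Setting} {l : List (Atom Const)} :
    S.IsSource (instOfList l) ↔ ∀ b ∈ l, b.rel ∈ S.src := by
  constructor
  · exact fun h b hb => h.1 _ (mem_instOfList.2 hb)
  · refine fun h => ⟨fun b hb => ?_, fun u ⟨b, hb, i, hu⟩ => ?_⟩ <;>
      obtain ⟨b', hb', rfl⟩ := exists_of_mem_instOfList hb
    · exact h b' hb'
    · exact ⟨_, hu.symm⟩

theorem TGD.frontier_subset_vars {ρ : TGD} {v : Var} (h : v ∈ ρ.frontier) : v ∈ ρ.vars :=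
  List.mem_append_left _ (mem_varList.2 h.1)

theorem TGD.exvars_subset_vars {ρ : TGD} {v : Var} (h : v ∈ ρ.exvars) : v ∈ ρ.vars :=
  List.mem_append_right _ (mem_varList.2 h.1)

theorem Formula.holds_congr {J : Inst} (φ : Formula) {ν ν' : Var → Value}
    (h : ∀ v ∈ φ.freeVars, ν v = ν' v) : φ.Holds J ν ↔ φ.Holds J ν' := by
  have hterm : ∀ s : Term, (∀ v, s = .var v → ν v = ν' v) → s.eval ν = s.eval ν' := by
    rintro (c | v) hs
    · rfl
    · exact hs v rfl
  induction φ generalizing ν ν' with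
  | atom a =>
    have : a.map (Term.eval ν) = a.map (Term.eval ν') :=
      Atom.ext_args fun i => hterm _ fun v hv => h v ⟨i, hv⟩
    simp only [Formula.Holds, this]
  | eq s t =>
    simp only [Formula.Holds, hterm s fun v hv => h v (.inl hv), hterm t fun v hv => h v (.inr hv)]
  | neg φ ih => exact not_congr (ih h hterm)
  | and φ ψ ih ih' =>
    exact and_congr (ih (fun v hv => h v (.inl hv)) hterm) (ih' (fun v hv => h v (.inr hv)) hterm)
  | ex v φ ih =>
    refine exists_congr fun u => and_congr_right fun _ => ?_
    have h' : ∀ v' ∈ φ.freeVars, update ν v u v' = update ν' v u v' := by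
      intro v' hv'
      by_cases hv : v' = v
      · subst hv
        simp
      · simpa [hv] using h v' ⟨hv', hv⟩
    refine ih h' ?_
    rintro (c | v') hs
    · rfl
    · exact hs v' rfl

theorem enc_infix_encTuple {T : Type} {c : Const} {l : List Const} (h : c ∈ l) :
    enc c <:+: (encTuple l : List (Ltr T)) := by
  obtain ⟨l₁, l₂, rfl⟩ := List.append_of_mem h
  exact ⟨encTuple l₁ ++ [sym .comma], encTuple l₂, by simp [encTuple]⟩

theorem enc_infix_of_mem {T : Type} {n : ℕ} {l : List (Atom Const)} {t : Fin n → Const}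
    {b : Atom Const} (hb : b ∈ l) (i : Fin b.rel.arity) :
    enc (b.args i) <:+: (inputWord l t : List (Ltr T)) := by
  refine (enc_infix_encTuple (List.mem_ofFn.2 ⟨i, rfl⟩)).trans ?_
  obtain ⟨l₁, l₂, rfl⟩ := List.append_of_mem hb
  exact ⟨blocks (l₁.map factBody) ++ enc b.rel.name, sym .semicolon :: blocks (l₂.map factBody) ++
    sym .bar :: encTuple (List.ofFn t), by simp [inputWord, blocks, factBody]⟩

theorem enc_infix_inputWord {T : Type} {n : ℕ} {l : List (Atom Const)} {t : Fin n → Const}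
    (i : Fin n) : enc (t i) <:+: (inputWord l t : List (Ltr T)) := by
  refine (enc_infix_encTuple (List.mem_ofFn.2 ⟨i, rfl⟩)).trans ?_
  exact ⟨blocks (l.map factBody) ++ [sym .bar], [], by simp [inputWord]⟩

theorem finite_dom {T : Type} (x w : List (Ltr T)) : {c | Dom x w c}.Finite := by
  have h : ∀ x : List (Ltr T), {c : Const | enc c <:+: x}.Finite := fun x => by
    have hx : {u | u <:+: x}.Finite := (List.finite_toSet x.sublists).subset fun u (hu : u <:+: x) =>
      List.mem_sublists.2 hu.sublist
    exact Set.Finite.preimage (f := enc) enc_injective.injOn hx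
  exact (h x).union (h w)

/-! ### The instance represented by a certificate -/

namespace Setting

variable {S : Setting} {x w : List (Ltr S.Rule)}

/-- An entry of an added fact is either a value of the assignment of a step or a constant of a head.
The certificate lists the latter precisely so that they lie within the range of the quantifiers. -/
theorem InAdom.dom (hw : ∀ c ∈ S.headConsts, enc c <:+: w) {c : Const} (h : InAdom x w c) :
    Dom x w c := by
  obtain ⟨ρ, ν, hν, a, ha, i, rfl⟩ := h
  cases hi : a.args i with
  | const c => exact .inr (hw c (mem_headConsts (mem_tgds.1 ρ.2) ha hi))
  | var v => exact hν.1.1 v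

theorem inAdom_iff {c : Const} :
    InAdom x w c ↔ ∃ b, InHeads x w w b ∧ ∃ i, b.args i = c := by
  constructor
  · rintro ⟨ρ, ν, hν, a, ha, i, rfl⟩
    exact ⟨_, ⟨ρ, ν, hν, a, ha, rfl⟩, i, rfl⟩
  · rintro ⟨_, ⟨ρ, ν, hν, a, ha, rfl⟩, i, rfl⟩
    exact ⟨ρ, ν, hν, a, ha, i, rfl⟩

theorem finite_inHeads (hw : ∀ c ∈ S.headConsts, enc c <:+: w) : {b | InHeads x w w b}.Finite := by
  have hfin : (⋃ ρ : S.Rule, ⋃ a ∈ {a | a ∈ ρ.1.head},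
      (fun s : Fin a.rel.arity → Const => (⟨a.rel, s⟩ : Atom Const)) ''
        {s | ∀ i, s i ∈ {c | Dom x w c}}).Finite :=
    Set.finite_iUnion fun ρ => (List.finite_toSet _).biUnion fun a _ =>
      (Set.Finite.pi' fun _ => finite_dom x w).image _
  refine hfin.subset fun b hb => ?_
  have hb' := hb
  obtain ⟨ρ, ν, hν, a, ha, rfl⟩ := hb
  simp only [Set.mem_iUnion]
  exact ⟨ρ, a, ha, _, fun i => InAdom.dom hw (inAdom_iff.2 ⟨_, hb', i, rfl⟩), rfl⟩

/-- The facts of `J` are those that are added by the steps in `w`. -/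
def Represents (x w : List (Ltr S.Rule)) (J : Inst) : Prop :=
  (∀ c ∈ S.headConsts, enc c <:+: w) ∧
    ∀ b, b ∈ J ↔ ∃ b', InHeads x w w b' ∧ b'.map Value.const = b

theorem Represents.mem_iff {J : Inst} (h : Represents x w J) {b : Atom Const} :
    b.map Value.const ∈ J ↔ InHeads x w w b := by
  rw [h.2]
  constructor
  · rintro ⟨b', hb', h⟩
    rwa [← constFact_injective h]
  · exact fun hb => ⟨b, hb, rfl⟩

theorem Represents.mem_adom {J : Inst} (h : Represents x w J) {u : Value} :
    u ∈ J.adom ↔ ∃ c, InAdom x w c ∧ u = .const c := by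
  constructor
  · rintro ⟨b, hb, i, rfl⟩
    obtain ⟨b', hb', rfl⟩ := (h.2 b).1 hb
    exact ⟨_, inAdom_iff.2 ⟨b', hb', i, rfl⟩, rfl⟩
  · rintro ⟨c, hc, rfl⟩
    obtain ⟨b, hb, i, rfl⟩ := inAdom_iff.1 hc
    exact ⟨_, h.mem_iff.2 hb, i, rfl⟩

/-- The active domain consists of constants that occur in the two words, so the bounded quantifiers
lose nothing. -/
theorem Represents.holds_iff {J : Inst} (h : Represents x w J) (φ : Formula) (ν : Var → Const) :
    φ.Holds J (constVal ν) ↔ HoldsIn x w φ ν := by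
  induction φ generalizing ν with
  | atom a => rw [Formula.Holds, Atom.map_eval_constVal, h.mem_iff, HoldsIn]
  | eq s t =>
    rw [Formula.Holds, Term.eval_constVal, Term.eval_constVal, Value.const_injective.eq_iff, HoldsIn]
  | neg φ ih => exact not_congr (ih ν)
  | and φ ψ ih ih' => exact and_congr (ih ν) (ih' ν)
  | ex v φ ih =>
    have key : ∀ c, update (constVal ν) v (.const c) = constVal (update ν v c) := by
      intro c
      funext v'
      by_cases hv : v' = v
      · subst hv
        simp [constVal]
      · simp [constVal, hv]
    constructor
    · rintro ⟨u, hu, hφ⟩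
      obtain ⟨c, hc, rfl⟩ := h.mem_adom.1 hu
      rw [key, ih] at hφ
      exact ⟨c, hc.dom h.1, hc, hφ⟩
    · rintro ⟨c, -, hc, hφ⟩
      refine ⟨.const c, h.mem_adom.2 ⟨c, hc, rfl⟩, ?_⟩
      rwa [key, ih]

/-- The tuple is not a parameter of the formula; it is recovered from the input as the only values
for which the word after the bar fits. Distinctness of the answer variables makes the assignment
well defined. -/
theorem Represents.notAnswer_iff {Q : Query} {l : List (Atom Const)} {t : Fin Q.arity → Const}
    {J : Inst} (h : Represents (inputWord l t) w J) :
    NotAnswer Q (inputWord l t) w ↔ (fun i => Value.const (t i)) ∉ Q.output J := by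
  constructor
  · rintro hn ⟨hadom, ν, hν, hφ⟩
    let ν' : Var → Const := fun v => if h : ∃ i, Q.vars i = v then t h.choose else []
    have hν' : ∀ i, ν' (Q.vars i) = t i := by
      intro i
      have h : ∃ j, Q.vars j = Q.vars i := ⟨i, rfl⟩
      simp only [ν', dif_pos h]
      rw [Q.vars_injective h.choose_spec]
    refine hn ν' ⟨fun v => ?_, fun v hv => dif_neg fun h => hv (List.mem_ofFn.2 h)⟩
      ⟨blocks (l.map factBody), _, rfl, by simp [hν']⟩ ⟨fun i => ?_, ?_⟩
    · by_cases hv : ∃ i, Q.vars i = v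
      · obtain ⟨i, rfl⟩ := hv
        rw [hν']
        exact .inl (enc_infix_inputWord i)
      · simp only [ν', dif_neg hv]
        exact .inl List.nil_infix
    · obtain ⟨c, hc, hi⟩ := h.mem_adom.1 (hadom i)
      rw [hν', Value.const_injective hi]
      exact hc
    · rw [← h.holds_iff]
      refine (Q.formula.holds_congr fun v hv => ?_).1 hφ
      obtain ⟨i, rfl⟩ := Q.free_subset hv
      rw [hν, constVal, hν']
  · rintro hn ν - ⟨p, r, hp, rfl⟩ ⟨hadom, hφ⟩
    have ht := List.ofFn_injective (inputWord_eq_append hp)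
    subst ht
    exact hn ⟨fun i => h.mem_adom.2 ⟨_, hadom i, rfl⟩, constVal ν, fun i => rfl, (h.holds_iff _ _).2 hφ⟩

/-- The steps at the boundaries of the word. -/
def StepAt (x w : List (Ltr S.Rule)) (n : ℕ) (ρ : TGD) (ν : Var → Const) : Prop :=
  ∃ (h : ρ ∈ S.tgds) (p r : List (Ltr S.Rule)), w = p ++ ((stepBody ⟨ρ, h⟩ ν ++ [sym .semicolon]) ++ r) ∧
    AtBoundary p ∧ p.length = n ∧ Assign x w ρ.vars ν

theorem hasStep_iff {ρ : S.Rule} {ν : Var → Const} :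
    HasStep x w w ρ ν ↔ ∃ n, StepAt x w n ρ.1 ν := by
  constructor
  · rintro ⟨hν, p, r, h, hp⟩
    exact ⟨_, ρ.2, p, r, h, hp, rfl, hν⟩
  · rintro ⟨n, _, p, r, h, hp, _, hν⟩
    exact ⟨hν, p, r, h, hp⟩

theorem exists_assign_vars (x w : List (Ltr S.Rule)) {vs : List Var} {ν : Var → Const}
    (h : ∀ v ∈ vs, Dom x w (ν v)) : ∃ ν', Assign x w vs ν' ∧ ∀ v ∈ vs, ν' v = ν v := by
  classical
  refine ⟨fun v => if v ∈ vs then ν v else [], ⟨fun v => ?_, fun v hv => if_neg hv⟩,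
    fun v hv => if_pos hv⟩
  by_cases hv : v ∈ vs
  · simpa only [if_pos hv] using h v hv
  · simpa only [if_neg hv] using .inl List.nil_infix

/-- A certificate yields a supported solution for which the tuple is not an answer. -/
theorem Certificate.exists_supportedSolution {Q : Query} {l : List (Atom Const)}
    {t : Fin Q.arity → Const} (hl : ∀ b ∈ l, b.rel ∈ S.src)
    (h : Certificate Q (inputWord l t) w) :
    ∃ J, SupportedSolution S (instOfList l) J ∧ (fun i => Value.const (t i)) ∉ Q.output J := by
  classical
  set x : List (Ltr S.Rule) := inputWord l t with hx
  obtain ⟨hw, hfou, hfun, hegd, hsat, hans⟩ := h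
  let J : Inst := (finite_inHeads (x := x) hw).toFinset.image (Atom.map Value.const)
  have hJ : Represents x w J := ⟨hw, fun b => by simp [J]⟩
  have hI := (isSource_instOfList (S := S)).2 hl
  have hdom : ∀ b : Atom Const, b ∈ l ∨ InHeads x w w b → ∀ i, Dom x w (b.args i) := by
    rintro b (hb | hb) i
    · exact .inl (enc_infix_of_mem hb i)
    · exact (inAdom_iff.2 ⟨b, hb, i, rfl⟩).dom hw
  -- A homomorphism into the represented facts takes only values that occur in the two words.
  -- Resetting the irrelevant variables to `[]` thus brings it into the range of the quantifiers.
  have hassign : ∀ (A : List (Atom Term)) (ν : Var → Const),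
      (∀ a ∈ A, a.gr ν ∈ l ∨ InHeads x w w (a.gr ν)) →
      ∃ ν', Assign x w (varList A) ν' ∧ (∀ v ∈ varsOf A, ν' v = ν v) ∧ ∀ a ∈ A, a.gr ν' = a.gr ν := by
    intro A ν hA
    obtain ⟨ν', h1, h2⟩ := exists_assign_vars x w (vs := varList A) (ν := ν) fun v hv => by
      obtain ⟨a, ha, i, hi⟩ := mem_varList.1 hv
      have := hdom _ (hA a ha) i
      simpa [Atom.gr, Atom.map, hi, Term.evalC] using this
    refine ⟨ν', h1, fun v hv => h2 v (mem_varList.2 hv), fun a ha => Atom.gr_congr fun v hv => ?_⟩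
    exact h2 v (mem_varList.2 ⟨a, ha, hv⟩)
  -- The grade of a step is the position in `w` at which its block begins.
  refine ⟨J, supportedSolution_of_steps hI.1 (StepAt x w) ?_ ?_ ?_ ?_ ?_ ?_, hJ.notAnswer_iff.1 hans⟩
  · rintro n ρ ν ⟨hρ, -⟩
    exact mem_tgds.1 hρ
  · rintro n ρ ν ⟨hρ, p, r, hp, hb, rfl, hν⟩ a ha
    rw [Atom.map_eval_constVal, mem_instOfList]
    refine (hfou p _ hp hb ⟨ρ, hρ⟩ ν hν ⟨_, _, rfl, rfl⟩ a ha).imp inSrc_iff.1 ?_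
    rintro ⟨ρ', ν', ⟨hν', p', r', rfl, hb'⟩, a', ha', h⟩
    refine ⟨p'.length, ?_, ρ'.1, ν', ⟨ρ'.2, p', r' ++ (stepBody ⟨ρ, hρ⟩ ν ++ [sym .semicolon] ++ r), ?_, hb', rfl, hν'⟩, ?_⟩
    · simp [stepBody]
    · rw [hp]
      simp only [List.append_assoc]
    · rw [mem_headFacts]
      exact ⟨a', ha', by rw [Atom.map_eval_constVal, h]⟩
  · rintro n m ρ ν ν' ⟨hρ, p, r, hp, hb, -, hν⟩ ⟨_, p', r', hp', hb', -, hν'⟩ h v hv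
    exact hfun ⟨ρ, hρ⟩ ν hν ν' hν' ⟨p, r, hp, hb⟩ ⟨p', r', hp', hb'⟩ (fun v _ => h v) v
      (TGD.exvars_subset_vars hv) hv
  · intro ρ hρ ν hν
    have hA : ∀ a ∈ ρ.body, a.gr ν ∈ l ∨ InHeads x w w (a.gr ν) := by
      intro a ha
      have := hν a ha
      rwa [Atom.map_eval_constVal, Finset.mem_union, mem_instOfList, hJ.mem_iff] at this
    obtain ⟨ν', h1, h2, h3⟩ := hassign _ ν hA
    obtain ⟨ν'', h4, h5, h6⟩ := hsat ⟨ρ, mem_tgds.2 hρ⟩ ν' h1 fun a ha => by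
      rw [h3 a ha]
      exact (hA a ha).imp_left inSrc_iff.2
    obtain ⟨n, hn⟩ := hasStep_iff.1 ⟨h4, h5⟩
    refine ⟨n, ν'', hn, fun v hv => ?_⟩
    rw [← h6 v (TGD.frontier_subset_vars hv) hv, h2 v hv.1]
  · intro b
    rw [hJ.2]
    constructor
    · rintro ⟨_, ⟨ρ, ν, hν, a, ha, rfl⟩, rfl⟩
      obtain ⟨n, hn⟩ := hasStep_iff.1 hν
      exact ⟨n, ρ, ν, hn, mem_headFacts.2 ⟨a, ha, Atom.map_eval_constVal _ _⟩⟩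
    · rintro ⟨n, ρ, ν, hn, hb⟩
      obtain ⟨a, ha, rfl⟩ := mem_headFacts.1 hb
      exact ⟨a.gr ν, ⟨⟨ρ, hn.1⟩, ν, hasStep_iff.2 ⟨n, hn⟩, a, ha, rfl⟩, (Atom.map_eval_constVal _ _).symm⟩
  · intro η hη ν hν
    -- EGDs quantify over all values, nulls included, but every fact of `J` comes from a step and
    -- has only constants as entries.
    have hconst : ∀ v ∈ varsOf η.body, ∃ c, ν v = .const c := by
      rintro v ⟨a, ha, i, hi⟩
      have : ν v ∈ J.adom := ⟨_, hν a ha, i, by simp [Atom.map, hi, Term.eval]⟩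
      obtain ⟨c, -, hc⟩ := hJ.mem_adom.1 this
      exact ⟨c, hc⟩
    choose! f hf using hconst
    have hgr : ∀ a ∈ η.body, a.map (Term.eval ν) = (a.gr f).map Value.const := by
      intro a ha
      rw [← Atom.map_eval_constVal]
      refine Atom.ext_args fun i => ?_
      cases hi : a.args i with
      | const c => rfl
      | var v => exact hf v ⟨a, ha, i, hi⟩
    have hA : ∀ a ∈ η.body, InHeads x w w (a.gr f) := by
      intro a ha
      have := hν a ha
      rwa [hgr a ha, hJ.mem_iff] at this
    obtain ⟨ν', h1, h2, h3⟩ := hassign _ f fun a ha => .inr (hA a ha)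
    have := hegd _ hη ν' h1 fun a ha => by
      rw [h3 a ha]
      exact hA a ha
    rw [hf _ η.lhs_mem, hf _ η.rhs_mem, ← h2 _ η.lhs_mem, ← h2 _ η.rhs_mem, this]

end Setting

/-! ### Completeness of certificates -/

open Classical in
/-- A step in which the variables that do not occur in the TGD have the default value. -/
noncomputable def Step.norm (y : Step) : Step := (y.1, fun v => if v ∈ y.1.vars then y.2 v else [])

theorem Step.norm_apply {y : Step} {v : Var} (hv : v ∈ y.1.vars) : y.norm.2 v = y.2 v := if_pos hv

theorem Step.mark_norm (y : Step) : y.norm.mark = y.mark :=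
  Step.mark_eq.2 fun _ hv => Step.norm_apply (TGD.frontier_subset_vars hv)

theorem Step.headFacts_norm (y : Step) : headFacts y.norm.1 y.norm.2 = headFacts y.1 y.2 := by
  ext b
  simp only [mem_headFacts, Atom.map_eval_constVal]
  refine exists_congr fun a => and_congr_right fun ha => ?_
  rw [Atom.gr_congr (ν := y.norm.2) (ν' := y.2) fun v hv => Step.norm_apply
    (List.mem_append_right _ (mem_varList.2 ⟨a, ha, hv⟩))]

theorem chaseInst_map_norm (I : Inst) (L : List Step) :
    chaseInst I (L.map Step.norm) = chaseInst I L := by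
  induction L with
  | nil => rfl
  | cons y L ih => rw [List.map_cons, chaseInst, ih, Step.headFacts_norm, chaseInst]

theorem map_mark_norm (L : List Step) : (L.map Step.norm).map Step.mark = L.map Step.mark := by
  rw [List.map_map]
  exact List.map_congr_left fun y _ => Step.mark_norm y

/-- Neither body, head nor mark depends on variables outside the TGD, so these can be given the
default value that certificates presuppose. -/
theorem Derivation.map_norm {S : Setting} {I : Inst} {L : List Step} (h : Derivation S I L) :
    Derivation S I (L.map Step.norm) := by
  induction h with
  | nil => exact .nil
  | @cons y L _ hρ hb hm ih =>
    refine .cons ih hρ ?_ ?_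
    · rw [chaseInst_map_norm]
      exact hb.congr fun v hv => congrArg Value.const
        (Step.norm_apply (List.mem_append_left _ (mem_varList.2 hv))).symm
    · rwa [map_mark_norm, Step.mark_norm]

theorem length_blocks_le {T : Type} {bs : List (List (Ltr T))} {m : ℕ}
    (h : ∀ b ∈ bs, b.length ≤ m) : (blocks bs).length ≤ bs.length * (m + 1) := by
  induction bs with
  | nil => simp [blocks]
  | cons b bs ih =>
    have h1 := h b (by simp)
    have h2 := ih fun b hb => h b (by simp [hb])
    simp only [blocks_cons, List.length_append, List.length_cons, add_mul]
    omega

theorem length_encTuple_le {T : Type} {l : List Const} {m : ℕ} (h : ∀ c ∈ l, c.length ≤ m) :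
    (encTuple l : List (Ltr T)).length ≤ l.length * (m + 1) := by
  induction l with
  | nil => simp [encTuple]
  | cons c l ih =>
    have h1 := h c (by simp)
    have h2 := ih fun b hb => h b (by simp [hb])
    simp only [encTuple, List.flatMap_cons, List.length_append, List.length_cons, add_mul, enc,
      List.length_map] at h2 ⊢
    omega

/-- The letters of certificates. -/
def certLetter {T : Type} : Sym ⊕ T → Ltr T := Sum.elim sym mark

namespace Setting

variable {S : Setting}

/-- A bound on the number of variables of the TGDs of a setting. -/
noncomputable def varBound (S : Setting) : ℕ := S.tgds.sup fun ρ => ρ.vars.length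

/-- The word for the constants in the heads of the TGDs. -/
noncomputable def constWord (S : Setting) : List (Ltr S.Rule) :=
  sym .bar :: encTuple S.headConsts.toList

/-- The word for a sequence of steps. -/
noncomputable def certWord (K : List (S.Rule × (Var → Const))) : List (Ltr S.Rule) :=
  blocks (K.map fun y => stepBody y.1 y.2) ++ S.constWord

/-- The word records only the values of the variables of the TGD; the default `[]` elsewhere makes
the assignment recoverable. -/
theorem stepBody_inj {ρ ρ' : S.Rule} {ν ν' : Var → Const} (hν : ∀ v ∉ ρ.1.vars, ν v = [])
    (hν' : ∀ v ∉ ρ'.1.vars, ν' v = []) (h : stepBody ρ ν = stepBody ρ' ν') :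
    (ρ, ν) = (ρ', ν') := by
  simp only [stepBody, List.cons.injEq, mark, Sum.inr.injEq] at h
  obtain ⟨rfl, h⟩ := h
  have h := encTuple_injective h
  congr 1
  funext v
  by_cases hv : v ∈ ρ.1.vars
  · exact List.map_inj_left.1 h v hv
  · rw [hν v hv, hν' v hv]

theorem semicolon_notMem_stepBody (ρ : S.Rule) (ν : Var → Const) :
    sym .semicolon ∉ stepBody ρ ν := by
  intro h
  rcases List.mem_cons.1 h with h | h
  · simp [sym, mark] at h
  · exact semicolon_notMem_encTuple _ h

/-- Boundaries and semicolons locate the block among the steps. The trailing list of constants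
contains no semicolon and cannot contribute one. -/
theorem certWord_eq_append {K : List (S.Rule × (Var → Const))}
    (hK : ∀ y ∈ K, ∀ v ∉ y.1.1.vars, y.2 v = []) {ρ : S.Rule} {ν : Var → Const}
    (hν : ∀ v ∉ ρ.1.vars, ν v = []) {p r : List (Ltr S.Rule)} (hp : AtBoundary p)
    (h : certWord K = p ++ ((stepBody ρ ν ++ [sym .semicolon]) ++ r)) :
    ∃ K₁ K₂, K = K₁ ++ (ρ, ν) :: K₂ ∧ p = blocks (K₁.map fun y => stepBody y.1 y.2) := by
  rw [List.append_assoc] at h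
  have hs : ∀ b ∈ K.map fun y => stepBody y.1 y.2, sym .semicolon ∉ b := by
    intro b hb
    obtain ⟨y, -, rfl⟩ := List.mem_map.1 hb
    exact semicolon_notMem_stepBody _ _
  obtain ⟨bs₁, bs₂, h1, rfl, -⟩ := blocks_eq_append hs
    (fun h => (List.mem_cons.1 h).elim (by simp [sym]) (semicolon_notMem_encTuple _))
    (semicolon_notMem_stepBody _ _) hp h
  obtain ⟨K₁, K', rfl, rfl, h2⟩ := List.map_eq_append_iff.1 h1
  obtain ⟨y, K₂, rfl, h3, -⟩ := List.map_eq_cons_iff.1 h2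
  refine ⟨K₁, K₂, ?_, rfl⟩
  rw [← stepBody_inj (hK y (by simp)) hν h3]

theorem occ_blocks {K : List (S.Rule × (Var → Const))} {y : S.Rule × (Var → Const)} (hy : y ∈ K)
    (t : List (Ltr S.Rule)) : Occ (stepBody y.1 y.2 ++ [sym .semicolon])
      (blocks (K.map fun y => stepBody y.1 y.2) ++ t) := by
  obtain ⟨K₁, K₂, rfl⟩ := List.append_of_mem hy
  refine ⟨blocks (K₁.map fun y => stepBody y.1 y.2), blocks (K₂.map fun y => stepBody y.1 y.2) ++ t,
    ?_, .blocks _⟩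
  simp [blocks]

/-- The chase step given by a rule and an assignment. -/
def toStep (y : S.Rule × (Var → Const)) : Step := (y.1.1, y.2)

theorem mem_certWord {K : List (S.Rule × (Var → Const))}
    (hK : ∀ y ∈ K, ∀ v ∉ y.1.1.vars, y.2 v = []) (x : List (Ltr S.Rule)) {ρ : S.Rule}
    {ν : Var → Const} : HasStep x (certWord K) (certWord K) ρ ν ↔ (ρ, ν) ∈ K := by
  constructor
  · rintro ⟨hν, p, r, h, hp⟩
    obtain ⟨K₁, K₂, rfl, -⟩ := certWord_eq_append hK hν.2 hp h
    simp
  · intro h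
    refine ⟨⟨fun v => ?_, hK _ h⟩, occ_blocks h _⟩
    by_cases hv : v ∈ ρ.1.vars
    · refine .inr ((enc_infix_encTuple (List.mem_map.2 ⟨v, hv, rfl⟩)).trans ?_)
      obtain ⟨p, r, h, -⟩ := occ_blocks h S.constWord
      rw [certWord, h]
      exact ⟨p ++ [mark ρ], sym .semicolon :: r, by simp [stepBody]⟩
    · rw [show ν v = [] from hK _ h v hv]
      exact .inl List.nil_infix

/-- A halting chase sequence yields a certificate. -/
theorem certificate_of_derivation {Q : Query} {l : List (Atom Const)} {t : Fin Q.arity → Const}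
    {J : Inst} {K : List (S.Rule × (Var → Const))} (hl : ∀ b ∈ l, b.rel ∈ S.src)
    (hK : ∀ y ∈ K, ∀ v ∉ y.1.1.vars, y.2 v = [])
    (hd : Derivation S (instOfList l) (K.map toStep).reverse)
    (hegd : SatEGDs S (chaseInst (instOfList l) (K.map toStep).reverse))
    (htr : ¬ ∃ (ρ : TGD) (ν : Var → Const),
      Trigger S (chaseState (instOfList l) (K.map toStep).reverse) ρ ν)
    (hJ : chaseInst (instOfList l) (K.map toStep).reverse = instOfList l ∪ J)
    (hJS : S.IsTarget J) (hans : (fun i => Value.const (t i)) ∉ Q.output J) :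
    Certificate Q (inputWord l t) (certWord K) := by
  set x : List (Ltr S.Rule) := inputWord l t with hx
  have hI := (isSource_instOfList (S := S)).2 hl
  have hmemJ : ∀ b, b ∈ J ↔ ∃ y ∈ K, b ∈ headFacts y.1.1 y.2 := by
    intro b
    have hb := Finset.ext_iff.1 hJ b
    simp only [mem_chaseInst, Finset.mem_union, List.mem_reverse, List.mem_map] at hb
    constructor
    · intro h
      rcases hb.2 (.inr h) with h' | ⟨_, ⟨y, hy, rfl⟩, h'⟩
      · exact absurd (hJS b h) (Finset.disjoint_left.1 S.disjoint (hI.1 b h'))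
      · exact ⟨y, hy, h'⟩
    · rintro ⟨y, hy, h⟩
      refine (hb.1 (.inr ⟨_, ⟨y, hy, rfl⟩, h⟩)).resolve_left fun h' => ?_
      exact Finset.disjoint_left.1 S.disjoint (hI.1 b h') (rel_of_mem_headFacts (mem_tgds.1 y.1.2) h)
  have hR : Represents x (certWord K) J := by
    refine ⟨fun c hc => (enc_infix_encTuple (Finset.mem_toList.2 hc)).trans
      ⟨blocks (K.map fun y => stepBody y.1 y.2) ++ [sym .bar], [], by simp [certWord, constWord]⟩,
      fun b => ?_⟩
    rw [hmemJ]
    constructor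
    · rintro ⟨y, hy, h⟩
      obtain ⟨a, ha, rfl⟩ := mem_headFacts.1 h
      exact ⟨_, ⟨y.1, y.2, (mem_certWord hK x).2 hy, a, ha, rfl⟩, (Atom.map_eval_constVal _ _).symm⟩
    · rintro ⟨_, ⟨ρ, ν, hν, a, ha, rfl⟩, rfl⟩
      exact ⟨_, (mem_certWord hK x).1 hν, mem_headFacts.2 ⟨a, ha, Atom.map_eval_constVal _ _⟩⟩
  have hmemIJ : ∀ b : Atom Const, InSrc x b ∨ InHeads x (certWord K) (certWord K) b ↔
      b.map Value.const ∈ instOfList l ∪ J := by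
    intro b
    rw [Finset.mem_union, hR.mem_iff, mem_instOfList, inSrc_iff]
  refine ⟨hR.1, ?_, ?_, ?_, ?_, hR.notAnswer_iff.2 hans⟩
  · rintro p r hp hb ρ ν hν ⟨s, t, rfl, rfl⟩ a ha
    -- The prefix before the block consists of the earlier steps `K₁`; in the derivation they come
    -- after the step, since derivations list the last step first.
    obtain ⟨K₁, K₂, rfl, rfl⟩ := certWord_eq_append hK hν.2 hb hp
    have := hd.body (L₁ := (K₂.map toStep).reverse) (x := toStep (ρ, ν))
      (L₂ := (K₁.map toStep).reverse) (by simp) a ha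
    rw [toStep, Atom.map_eval_constVal, mem_chaseInst, mem_instOfList] at this
    refine this.imp inSrc_iff.2 ?_
    simp only [List.mem_reverse, List.mem_map]
    rintro ⟨_, ⟨y, hy, rfl⟩, h⟩
    obtain ⟨a', ha', h⟩ := mem_headFacts.1 h
    rw [Atom.map_eval_constVal] at h
    refine ⟨y.1, y.2, ⟨((mem_certWord hK x).2 (by simp [hy])).1, ?_⟩, a', ha', constFact_injective h⟩
    simpa using occ_blocks hy []
  · intro ρ ν hν ν' hν' ho ho' h v _ hv
    have h1 := (mem_certWord hK x).1 ⟨hν, ho⟩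
    have h2 := (mem_certWord hK x).1 ⟨hν', ho'⟩
    have h3 := List.inj_on_of_nodup_map hd.nodup
      (List.mem_reverse.2 (List.mem_map_of_mem (f := toStep) h1))
      (List.mem_reverse.2 (List.mem_map_of_mem (f := toStep) h2))
      (Step.mark_eq.2 fun v hv => h v (TGD.frontier_subset_vars hv) hv)
    exact congrFun (congrArg Prod.snd h3) v
  · rintro (ρ | η) hη
    · trivial
    · intro ν hν hb
      have := (hegd.anti (hJ ▸ Finset.subset_union_right)) η hη (constVal ν) fun a ha => by
        rw [Atom.map_eval_constVal, hR.mem_iff]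
        exact hb a ha
      exact Value.const_injective this
  · intro ρ ν hν hb
    -- The run has halted, so every matched body belongs to a pair that has been marked by some
    -- step.
    have : (⟨ρ.1, fun y => ν y⟩ : (ρ : TGD) × (ρ.frontier → Const)) ∈
        (chaseState (instOfList l) (K.map toStep).reverse).chosen := by
      by_contra h
      refine htr ⟨ρ.1, ν, mem_tgds.1 ρ.2, fun a ha => ?_, h⟩
      rw [chaseState, hJ, Atom.map_eval_constVal, ← hmemIJ]
      exact hb a ha
    obtain ⟨_, h1, h2⟩ := List.mem_map.1 this
    obtain ⟨⟨ρ', ν'⟩, hy, rfl⟩ := List.mem_map.1 (List.mem_reverse.1 h1)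
    obtain rfl : ρ' = ρ := Subtype.ext (congrArg Sigma.fst h2)
    have h3 := (mem_certWord hK x).2 hy
    exact ⟨ν', h3.1, h3.2, fun v _ hv => (Step.mark_eq.1 h2 v hv).symm⟩

theorem length_stepBody_le {ρ : S.Rule} {ν : Var → Const} {B : ℕ}
    (h : ∀ v ∈ ρ.1.vars, (ν v).length ≤ B) :
    (stepBody ρ ν).length ≤ S.varBound * (B + 1) + 1 := by
  have h1 := length_encTuple_le (T := S.Rule) (l := ρ.1.vars.map ν) (m := B) (by simpa using h)
  have h2 : ρ.1.vars.length ≤ S.varBound := Finset.le_sup (f := fun ρ => ρ.vars.length) ρ.2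
  rw [List.length_map] at h1
  rw [stepBody, List.length_cons]
  exact Nat.succ_le_succ (h1.trans (Nat.mul_le_mul_right _ h2))

theorem certWord_mem_range (K : List (S.Rule × (Var → Const))) :
    certWord K ∈ Set.range (List.map certLetter) := by
  have hs : ∀ s, sym s ∈ Set.range (certLetter : Sym ⊕ S.Rule → _) := fun s => ⟨.inl s, rfl⟩
  have hm : ∀ ρ, mark ρ ∈ Set.range (certLetter : Sym ⊕ S.Rule → _) := fun ρ => ⟨.inr ρ, rfl⟩
  have ht : ∀ l, ∀ a ∈ encTuple l, a ∈ Set.range (certLetter : Sym ⊕ S.Rule → _) := by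
    intro l a ha
    simp only [encTuple, List.mem_flatMap, List.mem_cons, enc, List.mem_map] at ha
    obtain ⟨c, -, rfl | ⟨b, -, rfl⟩⟩ := ha <;> exact hs _
  rw [Set.range_list_map]
  intro a ha
  simp only [certWord, constWord, blocks, stepBody, List.mem_append, List.mem_flatMap, List.mem_cons,
    List.mem_map, List.not_mem_nil, or_false] at ha
  rcases ha with ⟨_, ⟨y, -, rfl⟩, ha | rfl⟩ | rfl | ha
  · rcases List.mem_cons.1 ha with rfl | ha
    · exact hm _
    · exact ht _ a ha
  · exact hs _
  · exact hs _
  · exact ht _ a ha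

/-- A supported solution for which the tuple is not an answer yields a short certificate. -/
theorem exists_certificate (hw : S.IsWeaklyAcyclic) {Q : Query} {l : List (Atom Const)}
    {t : Fin Q.arity → Const} (hl : ∀ b ∈ l, b.rel ∈ S.src) {J : Inst}
    (hJ : SupportedSolution S (instOfList l) J) (hans : (fun i => Value.const (t i)) ∉ Q.output J)
    {B : ℕ} (hB : ∀ c, Value.const c ∈ (instOfList l ∪ J).adom → c.length ≤ B) :
    ∃ w ∈ Set.range (List.map (certLetter (T := S.Rule))), Certificate Q (inputWord l t) w ∧
      w.length ≤ S.chasePoly.eval (instOfList l).card * (S.varBound * (B + 1) + 2) +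
        S.constWord.length := by
  have hI := (isSource_instOfList (S := S)).2 hl
  obtain ⟨L, hd, hegd, htr, hL⟩ := hJ.exists_derivation hI fun L hL => hL.length_le hw hI
  have hL' : chaseState (instOfList l) (L.map Step.norm) = chaseState (instOfList l) L := by
    rw [chaseState, chaseState, chaseInst_map_norm, map_mark_norm]
  -- The certificate lists the steps in chronological order, opposite to derivations.
  have hlift : (L.map Step.norm).reverse ∈ Set.range (List.map (toStep (S := S))) := by
    rw [Set.range_list_map]
    intro y hy
    exact ⟨(⟨y.1, mem_tgds.2 (hd.map_norm.mem_allTGDs y (List.mem_reverse.1 hy))⟩, y.2), rfl⟩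
  obtain ⟨K, hK⟩ := hlift
  have hK' : (K.map toStep).reverse = L.map Step.norm := by rw [hK, List.reverse_reverse]
  have hmem : ∀ y ∈ K, ∃ z ∈ L, z.norm = toStep y := fun y hy => List.mem_map.1 (by
    rw [← hK', List.mem_reverse]
    exact List.mem_map_of_mem hy)
  rw [← hL', ← hK'] at htr
  rw [← chaseInst_map_norm, ← hK'] at hegd hL
  have hd' := hd.map_norm
  rw [← hK'] at hd'
  refine ⟨certWord K, certWord_mem_range K, certificate_of_derivation hl (fun y hy v hv => ?_)
    hd' hegd htr hL hJ.1 hans, ?_⟩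
  · obtain ⟨z, -, hz⟩ := hmem y hy
    have h1 : z.1 = y.1.1 := congrArg Prod.fst hz
    rw [← h1] at hv
    rw [show y.2 = z.norm.2 from (congrArg Prod.snd hz).symm]
    exact if_neg hv
  · rw [certWord, List.length_append]
    refine Nat.add_le_add_right ((length_blocks_le (m := S.varBound * (B + 1) + 1) ?_).trans ?_) _
    · intro b hb
      obtain ⟨y, hy, rfl⟩ := List.mem_map.1 hb
      refine length_stepBody_le fun v hv => hB _ ?_
      rw [← hL]
      -- Every value in a step occurs in the final instance: body variables in facts present before
      -- the step, head variables in facts it adds. Hence the bound `B` applies.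
      rcases List.mem_append.1 hv with hv | hv <;>
        obtain ⟨a, ha, i, hi⟩ := mem_varList.1 hv
      · obtain ⟨L₁, L₂, h⟩ := List.append_of_mem
          (List.mem_reverse.2 (List.mem_map_of_mem (f := toStep) hy))
        refine ⟨a.map (Term.eval (constVal y.2)), ?_, i, by simp [Atom.map, hi, Term.eval, constVal]⟩
        rcases mem_chaseInst.1 (hd'.body h a ha) with h' | ⟨z, hz, h'⟩
        · exact mem_chaseInst.2 (.inl h')
        · exact mem_chaseInst.2 (.inr ⟨z, by rw [h]; simp [hz], h'⟩)
      · exact ⟨a.map (Term.eval (constVal y.2)), mem_chaseInst.2 (.inr ⟨toStep y,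
          List.mem_reverse.2 (List.mem_map_of_mem hy), mem_headFacts.2 ⟨a, ha, rfl⟩⟩), i,
          by simp [Atom.map, hi, Term.eval, constVal]⟩
    · rw [List.length_map]
      refine Nat.mul_le_mul_right _ ?_
      rw [← List.length_map (f := toStep), ← List.length_reverse]
      exact hd'.length_le hw hI

end Setting

/-! ### Renaming constants -/

section Rename

variable (π : Equiv.Perm Const)

/-- Rename the constants. -/
def Value.ren : Value → Value
  | .const c => .const (π c)
  | .null n => .null n

theorem Value.ren_symm_ren (u : Value) : Value.ren π.symm (Value.ren π u) = u := by
  cases u <;> simp [Value.ren]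

theorem Value.ren_injective : Injective (Value.ren π) :=
  LeftInverse.injective (Value.ren_symm_ren π)

/-- Rename the constants in an instance. -/
def Inst.ren (J : Inst) : Inst := J.image (Atom.map (Value.ren π))

theorem Inst.ren_symm_ren (J : Inst) : Inst.ren π.symm (J.ren π) = J := by
  rw [Inst.ren, Inst.ren, Finset.image_image]
  refine (Finset.image_congr fun a _ => ?_).trans Finset.image_id
  exact Atom.ext_args fun i => Value.ren_symm_ren π (a.args i)

theorem Inst.mem_ren {J : Inst} {b : Fact} : b.map (Value.ren π) ∈ J.ren π ↔ b ∈ J :=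
  (Atom.map_injective (Value.ren_injective π)).mem_finset_image

theorem Inst.ren_union (I J : Inst) : Inst.ren π (I ∪ J) = I.ren π ∪ J.ren π :=
  Finset.image_union _ _

theorem Inst.mem_adom_ren {J : Inst} {u : Value} : u ∈ (J.ren π).adom ↔ ∃ v ∈ J.adom, v.ren π = u := by
  constructor
  · rintro ⟨b, hb, i, rfl⟩
    obtain ⟨b', hb', rfl⟩ := Finset.mem_image.1 hb
    exact ⟨_, ⟨b', hb', i, rfl⟩, rfl⟩
  · rintro ⟨_, ⟨b, hb, i, rfl⟩, rfl⟩
    exact ⟨_, (Inst.mem_ren π).2 hb, i, rfl⟩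

variable {π}

theorem Term.eval_ren {ν : Var → Value} {s : Term} (h : ∀ c, s = .const c → π c = c) :
    s.eval (fun v => (ν v).ren π) = (s.eval ν).ren π := by
  cases s with
  | const c => simp [Term.eval, Value.ren, h c rfl]
  | var v => rfl

theorem Atom.map_eval_ren {ν : Var → Value} {a : Atom Term}
    (h : ∀ i c, a.args i = .const c → π c = c) :
    a.map (Term.eval fun v => (ν v).ren π) = (a.map (Term.eval ν)).map (Value.ren π) :=
  Atom.ext_args fun i => Term.eval_ren (h i)

theorem HomInto.ren {ν : Var → Value} {A : List (Atom Term)} {K : Inst}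
    (hA : ∀ c ∈ constList A, π c = c) (h : HomInto ν A K) :
    HomInto (fun v => (ν v).ren π) A (K.ren π) := by
  intro a ha
  rw [Atom.map_eval_ren fun i c hc => hA c (mem_constList.2 ⟨a, ha, i, hc⟩), Inst.mem_ren]
  exact h a ha

/-- The constants in a dependency. -/
def Dependency.consts : Dependency → Finset Const
  | .tgd _ => ∅
  | .egd η => (constList η.body).toFinset

/-- The constants in the dependencies of a setting. -/
noncomputable def Setting.depConsts (S : Setting) : Finset Const :=
  (S.tgds.biUnion fun ρ => (constList ρ.body ++ constList ρ.head).toFinset) ∪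
    S.tDeps.biUnion Dependency.consts

variable {S : Setting}

theorem Setting.body_fixed (hπ : ∀ c ∈ S.depConsts, π c = c) {ρ : TGD} (hρ : ρ ∈ S.allTGDs) :
    ∀ c ∈ constList ρ.body, π c = c := fun c hc => hπ c <| Finset.mem_union_left _ <|
  Finset.mem_biUnion.2 ⟨ρ, mem_tgds.2 hρ, by simp [hc]⟩

theorem Setting.head_fixed (hπ : ∀ c ∈ S.depConsts, π c = c) {ρ : TGD} (hρ : ρ ∈ S.allTGDs) :
    ∀ c ∈ constList ρ.head, π c = c := fun c hc => hπ c <| Finset.mem_union_left _ <|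
  Finset.mem_biUnion.2 ⟨ρ, mem_tgds.2 hρ, by simp [hc]⟩

theorem Setting.egd_fixed (hπ : ∀ c ∈ S.depConsts, π c = c) {η : EGD}
    (hη : Dependency.egd η ∈ S.tDeps) : ∀ c ∈ constList η.body, π c = c := fun c hc =>
  hπ c <| Finset.mem_union_right _ <| Finset.mem_biUnion.2 ⟨_, hη, List.mem_toFinset.2 hc⟩

theorem Setting.symm_fixed {C : Finset Const} (hπ : ∀ c ∈ C, π c = c) :
    ∀ c ∈ C, π.symm c = c := fun c hc => by rw [Equiv.symm_apply_eq, hπ c hc]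

theorem SatEGDs.ren (hπ : ∀ c ∈ S.depConsts, π c = c) {J : Inst} (h : SatEGDs S J) :
    SatEGDs S (J.ren π) := by
  intro η hη ν hν
  have h1 := hν.ren (Setting.egd_fixed (Setting.symm_fixed hπ) hη)
  rw [Inst.ren_symm_ren] at h1
  exact Value.ren_injective _ (h η hη _ h1)

/-- Rename the constants in an ex-choice. -/
def ExChoice.ren (π : Equiv.Perm Const) (γ : ExChoice) : ExChoice :=
  fun ρ y z => π (γ ρ (fun v => π.symm (y v)) z)

theorem ExChoice.ren_symm_ren (γ : ExChoice) : ExChoice.ren π.symm (ExChoice.ren π γ) = γ := by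
  funext ρ y z
  simp [ExChoice.ren]

/-- Dependencies only see the constants they mention, and these are fixed. A match in the renamed
instance is pulled back by the inverse renaming, and the head found there is pushed forward; the
renamed ex-choice is conjugated accordingly. -/
theorem SatChoice.ren (hπ : ∀ c ∈ S.depConsts, π c = c) {γ : ExChoice} {I J : Inst}
    (hI : I.Over S.src) (h : SatChoice S γ I J) :
    SatChoice S (γ.ren π) (I.ren π) (J.ren π) := by
  have hI' : (I.ren π).Over S.src := by
    intro b hb
    obtain ⟨b', hb', rfl⟩ := Finset.mem_image.1 hb
    exact hI b' hb'
  obtain ⟨h1, h2⟩ := (satChoice_iff hI).1 h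
  refine (satChoice_iff hI').2 ⟨fun ρ hρ ν hν hb => ?_, h2.ren hπ⟩
  have hb' := hb.ren (Setting.body_fixed (Setting.symm_fixed hπ) hρ)
  rw [← Inst.ren_union, Inst.ren_symm_ren] at hb'
  have := (h1 ρ hρ (fun v => π.symm (ν v)) (fun z => ?_) hb').ren (Setting.head_fixed hπ hρ)
  · simp only [constVal, Value.ren, Equiv.apply_symm_apply] at this
    exact this
  · simp only [hν z, ExChoice.ren, Equiv.symm_apply_apply]

/-- A smaller solution inside the renamed instance would be mapped by the inverse permutation to a
smaller one inside `J` for the original ex-choice. -/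
theorem SupportedSolution.ren (hπ : ∀ c ∈ S.depConsts, π c = c) {I J : Inst}
    (hI : I.Over S.src) (hIπ : I.ren π = I) (h : SupportedSolution S I J) :
    SupportedSolution S I (J.ren π) := by
  obtain ⟨hJ, γ, hsat, hmin⟩ := h
  have hT : ∀ {π : Equiv.Perm Const} {J : Inst}, S.IsTarget J → S.IsTarget (J.ren π) := by
    intro π J hJ b hb
    obtain ⟨b', hb', rfl⟩ := Finset.mem_image.1 hb
    exact hJ b' hb'
  have hIπ' : Inst.ren π.symm I = I := by rw [← hIπ, Inst.ren_symm_ren, hIπ]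
  refine ⟨hT hJ, γ.ren π, by simpa only [hIπ] using hsat.ren hπ hI, ?_⟩
  rintro ⟨J', hJ', hlt, hsat'⟩
  refine hmin ⟨Inst.ren π.symm J', hT hJ', ?_, ?_⟩
  · rw [← Inst.ren_symm_ren π J]
    exact (Finset.image_ssubset_image (Atom.map_injective (Value.ren_injective _))).2 hlt
  · have := hsat'.ren (Setting.symm_fixed hπ) hI
    rwa [hIπ', ExChoice.ren_symm_ren] at this

/-- The constants in a formula. -/
def Formula.consts : Formula → Finset Const
  | .atom a => (constList [a]).toFinset
  -- A dummy binary atom carries the two terms.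
  | .eq s t => (constList [⟨⟨[], 2⟩, ![s, t]⟩]).toFinset
  | .neg φ => φ.consts
  | .and φ ψ => φ.consts ∪ ψ.consts
  | .ex _ φ => φ.consts

theorem Formula.holds_ren {J : Inst} {φ : Formula} (hπ : ∀ c ∈ φ.consts, π c = c)
    {ν : Var → Value} : φ.Holds (J.ren π) (fun v => (ν v).ren π) ↔ φ.Holds J ν := by
  induction φ generalizing ν with
  | atom a =>
    rw [Formula.Holds, Atom.map_eval_ren fun i c hc => hπ c (List.mem_toFinset.2
      (mem_constList.2 ⟨a, by simp, i, hc⟩)), Inst.mem_ren, Formula.Holds]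
  | eq s t =>
    have hs : ∀ c, s = .const c → π c = c := fun c hc => hπ c (List.mem_toFinset.2
      (mem_constList.2 ⟨_, List.mem_singleton.2 rfl, 0, hc⟩))
    have ht : ∀ c, t = .const c → π c = c := fun c hc => hπ c (List.mem_toFinset.2
      (mem_constList.2 ⟨_, List.mem_singleton.2 rfl, 1, hc⟩))
    rw [Formula.Holds, Term.eval_ren hs, Term.eval_ren ht, (Value.ren_injective π).eq_iff,
      Formula.Holds]
  | neg φ ih => exact not_congr (ih hπ)
  | and φ ψ ih ih' =>
    exact and_congr (ih fun c hc => hπ c (Finset.mem_union_left _ hc))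
      (ih' fun c hc => hπ c (Finset.mem_union_right _ hc))
  | ex v φ ih =>
    have key : ∀ u : Value, update (fun v => (ν v).ren π) v (u.ren π) =
        fun v' => (update ν v u v').ren π := by
      intro u
      funext v'
      by_cases hv : v' = v
      · subst hv
        simp
      · simp [hv]
    simp only [Formula.Holds, Inst.mem_adom_ren]
    constructor
    · rintro ⟨_, ⟨u, hu, rfl⟩, h⟩
      rw [key, ih hπ] at h
      exact ⟨u, hu, h⟩
    · rintro ⟨u, hu, h⟩
      refine ⟨_, ⟨u, hu, rfl⟩, ?_⟩
      rwa [key, ih hπ]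

theorem Query.mem_output_of_ren {Q : Query} (hπ : ∀ c ∈ Q.formula.consts, π c = c) {J : Inst}
    {t : Fin Q.arity → Value} (ht : ∀ i, (t i).ren π = t i) (h : t ∈ Q.output (J.ren π)) :
    t ∈ Q.output J := by
  obtain ⟨h1, ν, h2, h3⟩ := h
  have ht' : ∀ i, (t i).ren π.symm = t i := fun i => by
    conv_lhs => rw [← ht i, Value.ren_symm_ren]
  refine ⟨fun i => ?_, fun v => (ν v).ren π.symm, fun i => by simp only [h2, ht'], ?_⟩
  · obtain ⟨v, hv, h⟩ := (Inst.mem_adom_ren π).1 (h1 i)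
    rw [← Value.ren_injective π (h.trans (ht i).symm)]
    exact hv
  · have := (Formula.holds_ren (Setting.symm_fixed hπ)).2 h3
    rwa [Inst.ren_symm_ren] at this

end Rename

/-- The constants in `N` can be made short without changing the constants in `D`. -/
theorem exists_perm_length_le {D : Finset Const} {b : ℕ} (hD : ∀ c ∈ D, c.length ≤ b)
    (N : Finset Const) : ∃ π : Equiv.Perm Const, (∀ c ∈ D, π c = c) ∧
      ∀ c ∈ N, (π c).length ≤ b + N.card := by
  induction N using Finset.induction_on with
  | empty => exact ⟨1, by simp, by simp⟩
  | insert a N ha ih =>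
    obtain ⟨π, h1, h2⟩ := ih
    rw [Finset.card_insert_of_notMem ha]
    by_cases h : (π a).length ≤ b + (N.card + 1)
    · refine ⟨π, h1, fun c hc => ?_⟩
      rcases Finset.mem_insert.1 hc with rfl | hc
      · exact h
      · exact (h2 c hc).trans (by omega)
    -- If the image of `a` is too long, it is swapped with a string of length exactly `b + N.card +
    -- 1`. That is longer than all constants of `D` and all images of `N`, so the swap disturbs none
    -- of them.
    · let d : Const := List.replicate (b + N.card + 1) true
      have hd : d.length = b + N.card + 1 := List.length_replicate
      refine ⟨π.trans (Equiv.swap (π a) d), fun c hc => ?_, fun c hc => ?_⟩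
      · have hl := hD c hc
        rw [Equiv.trans_apply, h1 c hc]
        refine Equiv.swap_apply_of_ne_of_ne ?_ ?_ <;> rintro rfl <;> omega
      · rw [Equiv.trans_apply]
        rcases Finset.mem_insert.1 hc with rfl | hc
        · rw [Equiv.swap_apply_left]
          omega
        · have hl := h2 c hc
          rw [Equiv.swap_apply_of_ne_of_ne]
          · omega
          · exact fun h => ha (π.injective h ▸ hc)
          · intro h
            rw [h] at hl
            omega

/-! ### The number of constants in supported solutions -/

namespace Setting

variable {S : Setting}

/-- A bound on the arities of the target relations. -/
def arityBound (S : Setting) : ℕ := S.trg.sup RelSym.arity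

/-- A bound on the number of atoms in the heads of the TGDs. -/
noncomputable def headLength (S : Setting) : ℕ := S.tgds.sup fun ρ => ρ.head.length

theorem card_chaseInst_le {I : Inst} {L : List Step} (h : ∀ y ∈ L, y.1 ∈ S.tgds) :
    (chaseInst I L).card ≤ I.card + L.length * S.headLength := by
  induction L with
  | nil => simp [chaseInst]
  | cons y L ih =>
    have h1 := ih fun z hz => h z (by simp [hz])
    have h2 : (headFacts y.1 y.2).card ≤ S.headLength := by
      refine ((List.toFinset_card_le _).trans (List.length_map _).le).trans ?_
      exact Finset.le_sup (f := fun ρ : TGD => ρ.head.length) (h y (by simp))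
    have h3 := Finset.card_union_le (chaseInst I L) (headFacts y.1 y.2)
    rw [chaseInst, List.length_cons, add_mul]
    omega

/-- A bound on the number of constants in a supported solution. -/
noncomputable def solutionPoly (S : Setting) : Polynomial ℕ :=
  (.X + S.chasePoly * .C S.headLength) * .C S.arityBound

theorem _root_.DataExchange.SupportedSolution.card_consts_le (hw : S.IsWeaklyAcyclic) {I J : Inst}
    (hI : S.IsSource I) (hJ : SupportedSolution S I J) :
    J.consts.card ≤ S.solutionPoly.eval I.card := by
  obtain ⟨L, hd, -, -, hL⟩ := hJ.exists_derivation hI fun L hL => hL.length_le hw hI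
  refine (Inst.card_consts_le fun a ha => Finset.le_sup (f := RelSym.arity) (hJ.1 a ha)).trans ?_
  have h1 : J.card ≤ (chaseInst I L).card := Finset.card_le_card (hL ▸ Finset.subset_union_right)
  have h2 := card_chaseInst_le (I := I) fun y hy => mem_tgds.2 (hd.mem_allTGDs y hy)
  have h3 := hd.length_le hw hI
  simp only [solutionPoly, Polynomial.eval_add, Polynomial.eval_mul, Polynomial.eval_C,
    Polynomial.eval_X]
  exact Nat.mul_le_mul_right _ (h1.trans (h2.trans (by gcongr)))

end Setting

/-! ### Supported certain answers are in coNP -/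

namespace Setting

variable {S : Setting}

theorem length_le_of_enc_infix {T : Type} {c : Const} {x : List (Ltr T)} (h : enc c <:+: x) :
    c.length ≤ x.length := by
  simpa [enc] using h.length_le

theorem length_le_inputWord {T : Type} {n : ℕ} (l : List (Atom Const)) (t : Fin n → Const) :
    l.length ≤ (inputWord l t : List (Ltr T)).length := by
  have h : l.length ≤ (blocks (l.map factBody) : List (Ltr T)).length := by
    induction l with
    | nil => simp
    | cons b l ih =>
      simp only [List.map_cons, blocks_cons, List.length_append, List.length_cons]
      omega
  rw [inputWord, List.length_append]
  omega

/-- The constants in the dependencies and the query. -/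
noncomputable def fixedConsts (S : Setting) (Q : Query) : Finset Const :=
  S.depConsts ∪ Q.formula.consts

/-- A bound on the length of certificates. -/
noncomputable def certPoly (S : Setting) (Q : Query) : Polynomial ℕ :=
  S.chasePoly * (.C S.varBound * (.C ((S.fixedConsts Q).sup List.length) + .X + S.solutionPoly + 1) +
    2) + .C S.constWord.length

theorem polynomial_eval_mono (p : Polynomial ℕ) : Monotone fun n => p.eval n := by
  intro m n h
  simp only [Polynomial.eval_eq_sum_range]
  gcongr

/-- A tuple that is not a supported certain answer has a certificate of polynomial length. -/
theorem exists_short_certificate (hw : S.IsWeaklyAcyclic) {Q : Query} {l : List (Atom Const)}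
    {t : Fin Q.arity → Const} (hl : ∀ b ∈ l, b.rel ∈ S.src) {J : Inst}
    (hJ : SupportedSolution S (instOfList l) J) (hans : (fun i => Value.const (t i)) ∉ Q.output J) :
    ∃ w : List (Sym ⊕ S.Rule), w.length ≤ (S.certPoly Q).eval (encodeInput l t).length ∧
      Certificate Q ((encodeInput l t).map sym) (w.map certLetter) := by
  classical
  set n := (encodeInput l t).length with hn
  have hI := (isSource_instOfList (S := S)).2 hl
  have hx := map_encodeInput (T := S.Rule) l t
  have hxn : (inputWord l t : List (Ltr S.Rule)).length = n := by rw [← hx, List.length_map]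
  let I := instOfList l
  -- The renaming must fix everything on which rejecting the tuple depends: the constants of the
  -- dependencies, the query, the source instance and the tuple. All of these have length at most
  -- `b`.
  let D := S.fixedConsts Q ∪ I.consts ∪ Finset.univ.image t
  let b := (S.fixedConsts Q).sup List.length + n
  have hIc : ∀ c ∈ I.consts, c.length ≤ n := by
    intro c hc
    obtain ⟨a, ha, i, h⟩ := Inst.mem_consts.1 hc
    obtain ⟨a', ha', rfl⟩ := exists_of_mem_instOfList ha
    rw [← Value.const_injective h, ← hxn]
    exact length_le_of_enc_infix (enc_infix_of_mem ha' i)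
  have hD : ∀ c ∈ D, c.length ≤ b := by
    intro c hc
    rcases Finset.mem_union.1 hc with hc | hc
    · rcases Finset.mem_union.1 hc with hc | hc
      · exact (Finset.le_sup (f := List.length) hc).trans (Nat.le_add_right _ _)
      · exact (hIc c hc).trans (Nat.le_add_left _ _)
    · obtain ⟨i, -, rfl⟩ := Finset.mem_image.1 hc
      refine le_trans ?_ (Nat.le_add_left n _)
      rw [← hxn]
      exact length_le_of_enc_infix (enc_infix_inputWord i)
  obtain ⟨π, h1, h2⟩ := exists_perm_length_le hD J.consts
  have hfix : ∀ c ∈ S.fixedConsts Q, π c = c := fun c hc =>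
    h1 c (Finset.mem_union_left _ (Finset.mem_union_left _ hc))
  have hIπ : I.ren π = I := by
    refine (Finset.image_congr fun a ha => ?_).trans Finset.image_id
    refine Atom.ext_args fun i => ?_
    have hmem : a.args i ∈ I.adom := ⟨a, ha, i, rfl⟩
    obtain ⟨c, hc⟩ := hI.2 _ hmem
    rw [hc] at hmem ⊢
    exact congrArg Value.const (h1 c (Finset.mem_union_left _ (Finset.mem_union_right _
      (Inst.mem_consts.2 hmem))))
  have hJ' := hJ.ren (fun c hc => hfix c (Finset.mem_union_left _ hc)) hI.1 hIπ
  obtain ⟨w, ⟨w, rfl⟩, h3, h4⟩ := exists_certificate hw hl hJ'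
    (fun h => hans (Query.mem_output_of_ren (fun c hc => hfix c (Finset.mem_union_right _ hc))
      (fun i => congrArg Value.const (h1 _ (Finset.mem_union_right _ (by simp)))) h))
    (B := b + J.consts.card) (fun c ⟨a, ha, i, h⟩ => by
      rcases Finset.mem_union.1 ha with ha | ha
      · exact (hIc c (Inst.mem_consts.2 ⟨a, ha, i, h⟩)).trans (by omega)
      · obtain ⟨u, hu, h⟩ := (Inst.mem_adom_ren π).1 ⟨a, ha, i, h⟩
        cases u with
        | null _ => cases h
        | const c' =>
          rw [← Value.const_injective h]
          exact h2 c' (Inst.mem_consts.2 hu))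
  refine ⟨w, ?_, hx ▸ h3⟩
  rw [List.length_map] at h4
  have h5 : I.card ≤ n := by
    rw [← hxn]
    refine le_trans ?_ (length_le_inputWord l t)
    exact (List.toFinset_card_le _).trans (List.length_map _).le
  have h6 := hJ.card_consts_le hw hI
  refine h4.trans ?_
  simp only [certPoly, Polynomial.eval_add, Polynomial.eval_mul, Polynomial.eval_C,
    Polynomial.eval_X, Polynomial.eval_one, Polynomial.eval_ofNat]
  have h7 := polynomial_eval_mono S.chasePoly h5
  have h8 := h6.trans (polynomial_eval_mono S.solutionPoly h5)
  gcongr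

theorem isInput_map_sym {n : ℕ} {x : List Sym} : S.IsInput n (x.map sym) ↔
    ∃ (l : List (Atom Const)) (t : Fin n → Const), (∀ b ∈ l, b.rel ∈ S.src) ∧
      x = encodeInput l t := by
  rw [isInput_iff]
  refine exists_congr fun l => exists_congr fun t => and_congr_right fun _ => ?_
  rw [← map_encodeInput]
  exact (List.map_injective_iff.2 Sum.inl_injective).eq_iff

/-- The language quantifies over some instance and tuple encoded by the string; since decoding is
unique up to the order and repetition of facts, any encoding may be used. -/
theorem encodeInput_mem_scertLanguage {Q : Query} {l : List (Atom Const)} {t : Fin Q.arity → Const}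
    (hl : ∀ b ∈ l, b.rel ∈ S.src) : encodeInput l t ∈ scertLanguage S Q ↔
      ∀ J, SupportedSolution S (instOfList l) J → (fun i => Value.const (t i)) ∈ Q.output J := by
  constructor
  · rintro ⟨I, t', -, ⟨l', rfl, h⟩, hmem⟩ J hJ
    have h' : (inputWord l t : List (Ltr S.Rule)) = inputWord l' t' := by
      rw [← map_encodeInput, ← map_encodeInput, h]
    obtain rfl : t = t' := List.ofFn_injective (inputWord_eq_append h')
    have hl' : instOfList l = instOfList l' := by
      have : ∀ b, b ∈ l ↔ b ∈ l' := fun b => by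
        rw [← inSrc_iff (S := S) (t := t), h', inSrc_iff]
      ext b
      simp [instOfList, this]
    exact Set.mem_iInter₂.1 hmem J (hl' ▸ hJ)
  · exact fun h => ⟨_, t, isSource_instOfList.2 hl, ⟨l, rfl, rfl⟩, Set.mem_iInter₂.2 h⟩

theorem notMem_scertLanguage_iff (hw : S.IsWeaklyAcyclic) (Q : Query) (x : List Sym) :
    x ∉ scertLanguage S Q ↔ ∃ w : List (Sym ⊕ S.Rule), w.length ≤ (S.certPoly Q).eval x.length ∧
      (¬ S.IsInput Q.arity (x.map sym) ∨ Certificate Q (x.map sym) (w.map certLetter)) := by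
  by_cases hx : S.IsInput Q.arity (x.map sym)
  · obtain ⟨l, t, hl, rfl⟩ := isInput_map_sym.1 hx
    rw [encodeInput_mem_scertLanguage hl]
    simp only [hx, not_true_eq_false, false_or]
    constructor
    · intro h
      push Not at h
      obtain ⟨J, hJ, hans⟩ := h
      exact exists_short_certificate hw hl hJ hans
    · rintro ⟨w, -, h⟩ h'
      rw [map_encodeInput] at h
      obtain ⟨J, hJ, hans⟩ := h.exists_supportedSolution hl
      exact hans (h' J hJ)
  · simp only [hx, not_false_eq_true, true_or, and_true]
    -- Strings that are not inputs lie in the complement and are accepted with the empty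
    -- certificate.
    refine iff_of_true ?_ ⟨[], Nat.zero_le _⟩
    rintro ⟨I, t, hI, ⟨l, rfl, rfl⟩, -⟩
    exact hx (isInput_map_sym.2 ⟨l, t, isSource_instOfList.1 hI, rfl⟩)

theorem inCoNP_scertLanguage (hw : S.IsWeaklyAcyclic) (Q : Query) :
    InCoNP (scertLanguage S Q) := by
  classical
  refine ⟨Sym ⊕ S.Rule, inferInstance, fun y => decide (¬ S.IsInput Q.arity (y.1.map sym) ∨
    Certificate Q (y.1.map sym) (y.2.map certLetter)), S.certPoly Q, ?_, fun x => ?_⟩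
  · have : Nonempty Sym := ⟨.bar⟩
    refine Def.computableInPolyTime (Sum.elim .inl certLetter)
      -- The index `true` stands for the input and `false` for the certificate; letters of the
      -- latter are translated by `certLetter`.
      (((Def.isInput Q.arity true).not).or (Def.certificate Q true false)) _ fun x w => ?_
    simp only [decide_eq_true_eq]
    exact Iff.rfl
  · rw [Set.mem_compl_iff, notMem_scertLanguage_iff hw]
    simp only [decide_eq_true_eq]

end Setting
end DataExchange

theorem mainTheorem3 (S : DataExchange.Setting) (hS : S.IsWeaklyAcyclic) :
    (∀ Q : DataExchange.Query, Q.formula.Over S.trg →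
      DataExchange.InCoNP (DataExchange.scertLanguage S Q)) ∧
    (∃ p : Polynomial ℕ, ∀ I : DataExchange.Inst, S.IsSource I →
      ∀ (n : ℕ) (s : DataExchange.ChaseState),
        DataExchange.ChaseRun S I n s → n ≤ p.eval I.card) ∧
    (∀ I : DataExchange.Inst, S.IsSource I → ∀ J : DataExchange.Inst,
      DataExchange.ChaseProduces S I J ↔ DataExchange.SupportedSolution S I J) := by
  refine ⟨fun Q _ => DataExchange.Setting.inCoNP_scertLanguage hS Q,
    ⟨S.chasePoly, fun I hI n s h => ?_⟩,
    fun I hI J => DataExchange.chaseProduces_iff hI fun L hL => hL.length_le hS hI⟩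
  obtain ⟨L, hL, rfl, -⟩ := h.exists_derivation
  exact hL.length_le hS hI
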